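/- **Setting.** Let $d\ge 0$, let $\mathfrak L^-$ be a finite set and $0\notin\mathfrak L^-$. Fix a scaling $\mathfrak s_1,\dots,\mathfrak s_d\in[1,\infty)$, an order $\eta>0$, homogeneities $\alpha_{\mathfrak l}\in\mathbb R$ ($\mathfrak l\in\mathfrak L^-\cup\{0\}$) with $\alpha_0=0$, numbers $\mathrm{reg}(\mathfrak l)<\alpha_{\mathfrak l}$ and $\mathrm{reg}_{sol}\in\mathbb R$ with $\mathrm{reg}_{sol}\le\mathfrak s_i$ for all $i=1,\dots,d$. For a set $I$ let $M(I)$ be the set of finitely supported maps $I\to\mathbb N_0$, $\ell(m)=\sum_i m(i)$, $m!=\prod_i m(i)!$, and $e_i\in M(I)$ the indicator of $i$. For $\mathbf n\in\mathbb N_0^d$ put $|\mathbf n|=\sum_i\mathfrak s_i\mathbf n(i)$. Let $\mathcal C=((\mathfrak L^-\cup\{0\})\times M(\mathbb N_0^d))\sqcup\mathbb N_0^d$, with one variable $\mathsf z_x$ for each $x\in\mathcal C$, and $\mathsf z^\beta=\prod_x\mathsf z_x^{\beta(x)}$ for $\beta\in M(\mathcal C)$. For $\beta\in M(\mathcal C)$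 let $$[\beta]=\sum_{(\mathfrak l,k)}(1-\ell(k))\beta(\mathfrak l,k)+\sum_{\mathbf n}\beta(\mathbf n),$$ $$|\beta|=\sum_{(\mathfrak l,k)}\Big(\alpha_{\mathfrak l}+\sum_{\mathbf n}(\eta-|\mathbf n|)k(\mathbf n)\Big)\beta(\mathfrak l,k)+\sum_{\mathbf n}(|\mathbf n|-\eta)\beta(\mathbf n).$$ A pair $(\mathfrak l,k)$ is *subcritical* if $$\mathrm{reg}_{sol}<\eta+\min\{\mathrm{reg}(\mathfrak l),\,m_k,\,\mathrm{reg}(\mathfrak l)+m_k\},\qquad m_k=\min_{0<k'\le k}\sum_{\mathbf n}(\mathrm{reg}_{sol}-|\mathbf n|)k'(\mathbf n)$$ ($m_0=+\infty$); $\beta$ is subcritical if $(\mathfrak l,k)$ is subcritical whenever $\beta(\mathfrak l,k)\neq0$. Let $\mathcal P=\{e_{\mathbf n}\}_{\mathbf n\in\mathbb N_0^d}$, let $\mathcal N^-$ be the set of subcritical $\beta$ with $[\beta]=1$ and $\beta(\mathbf n)=0$ whenever $|\mathbf n|<\mathrm{reg}_{sol}$, let $\mathcal N=\{\beta\in\mathcal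 N^-:\sum_{\mathfrak l\in\mathfrak L^-}\sum_k\beta(\mathfrak l,k)>0\}$, and $\mathcal M=\mathcal N\times\mathbb N_0^d$. Let $T^*_{\mathcal N}\subset\mathbb R[[\mathcal C]]$ be the space of power series supported in $\mathcal N$. On $\mathbb R[[\mathcal C]]$ let $$D^{(\mathbf n)}=\Big(\sum_{(\mathfrak l,k):\,(\mathfrak l,k+e_{\mathbf n})\text{ subcritical}}(k(\mathbf n)+1)\mathsf z_{(\mathfrak l,k+e_{\mathbf n})}\partial_{\mathsf z_{(\mathfrak l,k)}}+\partial_{\mathsf z_{\mathbf n}}\Big)P,\qquad \boldsymbol\partial_i=\sum_{\mathbf n}(\mathbf n(i)+1)\mathsf z_{\mathbf n+e_i}D^{(\mathbf n)},$$ where $P$ is the projection onto the series supported in $\mathcal P\cup\mathcal N^-$. Let $L$ be the Lie algebra generated by the endomorphisms $\mathsf z^\gamma D^{(\mathbf n)}$, $(\gamma,\mathbf n)\in\mathcal M$, and $\boldsymbol\partial_i$, $i=1,\dots,d$, under the commutator, $\mathrm U(L)$ its universal enveloping algebra, $\mathrm{cop}:\mathrm U(L)\to\mathrm U(L)\otimes\mathrm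 U(L)$ the algebra morphism with $D\mapsto1\otimes D+D\otimes1$ for $D\in L$, and $\rho:\mathrm U(L)\to\mathrm{End}(\mathbb R[[\mathcal C]])$ the algebra morphism that extends the inclusion of $L$. For $D\in L$ write $D\mathsf z^\gamma=\sum_\beta D^\gamma_\beta\mathsf z^\beta$; for $\gamma\in\mathcal N$ this is a finite sum over $\beta\in\mathcal N$. For $(\gamma,\mathbf n)\in\mathcal M$ the linear maps $U\mapsto\mathsf z^\gamma UD^{(\mathbf n)}$ of $\mathrm U(L)$ are determined by $$\mathsf z^\gamma1D^{(\mathbf n)}=\mathsf z^\gamma D^{(\mathbf n)},\qquad \mathsf z^\gamma DU D^{(\mathbf n)}=D\,\mathsf z^\gamma UD^{(\mathbf n)}-\sum_\beta D^\gamma_\beta\,\mathsf z^\beta UD^{(\mathbf n)}\quad(D\in L,\ U\in\mathrm U(L)).$$ For $J\in M(\mathcal M)$, $\mathbf m\in\mathbb N_0^d$ let $$\mathsf D_{(J,\mathbf m)}=\frac1{J!\,\mathbf m!}\prod_{(\gamma,\mathbf n)}(\mathsf z^\gamma)^{J(\gamma,\mathbf n)}\ \boldsymbol\partial^{\mathbf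 m}\prod_{(\gamma,\mathbf n)}(D^{(\mathbf n)})^{J(\gamma,\mathbf n)},$$ that is, these maps, each taken $J(\gamma,\mathbf n)$ times, are applied successively to $\boldsymbol\partial^{\mathbf m}=\prod_i\boldsymbol\partial_i^{\mathbf m(i)}$. Put $|(\gamma,\mathbf n)|=|\gamma|+\eta-|\mathbf n|$ and $|i|=\mathfrak s_i$, let $L_\kappa$ be the span of the generators of homogeneity $\kappa$, and let $\mathrm U_\nu$ be the span of the products $D_1\cdots D_r$ ($r\ge0$) with $D_j\in L_{\kappa_j}$, $\sum_j\kappa_j=\nu$. **Statement.** (0) The generators $\mathsf z^\gamma D^{(\mathbf n)}$, $(\gamma,\mathbf n)\in\mathcal M$, and $\boldsymbol\partial_i$, $i=1,\dots,d$, form a basis of $L$, and $$[\mathsf z^{\gamma'}D^{(\mathbf n')},\mathsf z^\gamma D^{(\mathbf n)}]=\sum_\beta(\mathsf z^{\gamma'}D^{(\mathbf n')})^\gamma_\beta\mathsf z^\beta D^{(\mathbf n)}-\sum_\beta(\mathsf z^{\gamma}D^{(\mathbf n)})^{\gamma'}_\beta\mathsf z^\beta D^{(\mathbf n')},$$ $$[\boldsymbol\partial_i,\mathsf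 z^\gamma D^{(\mathbf n)}]=\sum_\beta(\boldsymbol\partial_i)^\gamma_\beta\mathsf z^\beta D^{(\mathbf n)}-\mathbf n(i)\mathsf z^\gamma D^{(\mathbf n-e_i)},\qquad[\boldsymbol\partial_i,\boldsymbol\partial_j]=0.$$ The maps $U\mapsto\mathsf z^\gamma UD^{(\mathbf n)}$, $(\gamma,\mathbf n)\in\mathcal M$, commute with each other, so that $\mathsf D_{(J,\mathbf m)}$ does not depend on the order of its factors. (i) The family $\{\mathsf D_{(J,\mathbf m)}\}_{(J,\mathbf m)\in M(\mathcal M)\times\mathbb N_0^d}$ is a basis of $\mathrm U(L)$. (ii) $$\mathrm{cop}\,\mathsf D_{(J,\mathbf m)}=\sum_{(J',\mathbf m')+(J'',\mathbf m'')=(J,\mathbf m)}\mathsf D_{(J',\mathbf m')}\otimes\mathsf D_{(J'',\mathbf m'')}.$$ Consequently, for the pairing of $\mathrm U(L)$ with the free commutative algebra $\mathbb R[\mathcal M\sqcup\{1,\dots,d\}]$ in which $\{\mathsf D_{(J,\mathbf m)}\}$ is dual to the monomials $\mathsf Z^{(J,\mathbf m)}$, one has $\langle U,M_1M_2\rangle=\langle\mathrm{cop}\,U,M_1\otimes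 M_2\rangle$ for all $U\in\mathrm U(L)$ and all $M_1,M_2$. (iii) For $\mathbf n\in\mathbb N_0^d$ let the linear map $\iota_{\mathbf n}:\mathrm U(L)\to T^*_{\mathcal N}$ send $\mathsf D_{(J,\mathbf m)}$ to $\mathsf z^\gamma$ if $(J,\mathbf m)=(e_{(\gamma,\mathbf n)},0)$ for some $\gamma\in\mathcal N$ and to $0$ otherwise, and let the linear map $\epsilon_{\mathbf n}:\mathrm U(L)\to\mathbb R$ send $\mathsf D_{(J,\mathbf m)}$ to $1$ if $(J,\mathbf m)=(0,\mathbf n)$ and to $0$ otherwise. Then for all $U_1,U_2\in\mathrm U(L)$ and $\mathbf n\in\mathbb N_0^d$ $$\iota_{\mathbf n}(U_1U_2)=\rho(U_1)\,\iota_{\mathbf n}(U_2)+\sum_{\mathbf m}\binom{\mathbf n+\mathbf m}{\mathbf m}\iota_{\mathbf n+\mathbf m}(U_1)\,\epsilon_{\mathbf m}(U_2),$$ where only finitely many $\mathbf m$ satisfy $\epsilon_{\mathbf m}(U_2)\ne0$. (iv) $\mathsf D_{(J,\mathbf m)}\in\mathrm U_{|(J,\mathbf m)|}$, where $|(J,\mathbf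 m)|=\sum_{(\gamma,\mathbf n)\in\mathcal M}J(\gamma,\mathbf n)|(\gamma,\mathbf n)|+\sum_i\mathbf m(i)|i|$. -/

import Mathlib

open scoped TensorProduct

attribute [local instance 100] LieRing.ofAssociativeRing

namespace MultiIndexSPDE

/-- `ℕ₀ᵈ`. -/
abbrev NIdx (d : ℕ) : Type := Fin d →₀ ℕ

/-- The index set of the coordinates: `((𝔏⁻ ∪ {0}) × M(ℕ₀ᵈ)) ⊔ ℕ₀ᵈ`. The noises are labelled by `ℒ`
and the additional label `0` is `none : Option ℒ`. -/
abbrev Coord (d : ℕ) (ℒ : Type*) : Type _ := (Option ℒ × (NIdx d →₀ ℕ)) ⊕ NIdx d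

/-- Multi-indices over the coordinates. -/
abbrev MIdx (d : ℕ) (ℒ : Type*) : Type _ := Coord d ℒ →₀ ℕ

/-- Formal power series in the variables `z_x`, `x` a coordinate. -/
abbrev PS (d : ℕ) (ℒ : Type*) : Type _ := MvPowerSeries (Coord d ℒ) ℝ

/-- Multi-index factorial. -/
def mfact {I : Type*} (m : I →₀ ℕ) : ℕ := m.prod fun _ a => a.factorial

/-- Multi-index binomial coefficient. -/
def mchoose {d : ℕ} (n m : NIdx d) : ℕ := ∏ i, (n i).choose (m i)

/-- The length of a multi-index. -/
def len {I : Type*} (m : I →₀ ℕ) : ℕ := m.sum fun _ a => a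

/-- `[β] = ∑_{(𝔩,k)} (1 - len k) β(𝔩,k) + ∑_n β(n)`. -/
def bra {d : ℕ} {ℒ : Type*} (β : MIdx d ℒ) : ℤ :=
  β.sum fun x b =>
    match x with
    | .inl (_, k) => (1 - (len k : ℤ)) * b
    | .inr _ => (b : ℤ)

/-- The noise homogeneity `∑_{𝔩 ∈ 𝔏⁻} ∑_k β(𝔩,k)`. -/
def noise {d : ℕ} {ℒ : Type*} (β : MIdx d ℒ) : ℕ :=
  β.sum fun x b =>
    match x with
    | .inl (some _, _) => b
    | _ => 0

/-- The data of the equation. -/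
structure Setting (d : ℕ) (ℒ : Type*) where
  /-- the scaling `𝔰` -/
  scaling : Fin d → ℝ
  /-- the order `η` of the operator -/
  eta : ℝ
  /-- the noise homogeneities `α` -/
  alpha : Option ℒ → ℝ
  /-- placeholder for the regularity of the noises -/
  reg : Option ℒ → ℝ
  /-- placeholder for the regularity of the solution -/
  regSol : ℝ
  one_le_scaling : ∀ i, 1 ≤ scaling i
  eta_pos : 0 < eta
  alpha_none : alpha none = 0
  reg_lt_alpha : ∀ l, reg l < alpha l
  /-- The expected regularity of the solution does not exceed the scaled degree of any first order
  derivative; otherwise the space-time shifts do not preserve the set `setN` below. -/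
  regSol_le_scaling : ∀ i, regSol ≤ scaling i

namespace Setting

variable {d : ℕ} {ℒ : Type*} (S : Setting d ℒ)

/-- The scaled degree `|n|` of `n ∈ ℕ₀ᵈ`. -/
def sdeg (n : NIdx d) : ℝ := ∑ i, S.scaling i * n i

/-- The homogeneity `|β|`. -/
noncomputable def homog (β : MIdx d ℒ) : ℝ :=
  β.sum fun x b =>
    match x with
    | .inl (l, k) => (S.alpha l + k.sum fun n a => (S.eta - S.sdeg n) * a) * b
    | .inr n => (S.sdeg n - S.eta) * b

/-- `∑_n (reg_sol - |n|) k(n)`. -/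
noncomputable def regSum (k : NIdx d →₀ ℕ) : ℝ := k.sum fun n a => (S.regSol - S.sdeg n) * a

/-- Subcriticality of a pair `(𝔩,k)`; a minimum over the empty set (for `k = 0`) is `+∞`. -/
def SubcritPair (l : Option ℒ) (k : NIdx d →₀ ℕ) : Prop :=
  S.regSol < S.eta + S.reg l ∧
    ∀ k' : NIdx d →₀ ℕ, 0 < k' → k' ≤ k →
      S.regSol < S.eta + S.regSum k' ∧ S.regSol < S.eta + (S.reg l + S.regSum k')

/-- Subcriticality of a multi-index. -/
def Subcrit (β : MIdx d ℒ) : Prop := ∀ l k, β (.inl (l, k)) ≠ 0 → S.SubcritPair l k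

/-- The set `𝒩⁻`. -/
def setNmin : Set (MIdx d ℒ) :=
  {β | bra β = 1 ∧ S.Subcrit β ∧ ∀ n, S.sdeg n < S.regSol → β (.inr n) = 0}

/-- The set `𝒩`. -/
def setN : Set (MIdx d ℒ) := {β | β ∈ S.setNmin ∧ 0 < noise β}

/-- The set `𝒫` of the multi-indices `e_n`, `n ∈ ℕ₀ᵈ`. -/
def setP (_S : Setting d ℒ) : Set (MIdx d ℒ) :=
  Set.range fun n : NIdx d => Finsupp.single (.inr n) 1

end Setting

section Series

variable {d : ℕ} {ℒ : Type*}

open Classical in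
/-- The projection of the space of power series onto the series supported in `V`. -/
noncomputable def proj (V : Set (MIdx d ℒ)) : Module.End ℝ (PS d ℒ) where
  toFun π := fun β => if β ∈ V then MvPowerSeries.coeff β π else 0
  map_add' π π' := by
    funext β
    change (if β ∈ V then MvPowerSeries.coeff β (π + π') else 0) =
      (if β ∈ V then MvPowerSeries.coeff β π else 0) +
        (if β ∈ V then MvPowerSeries.coeff β π' else 0)
    by_cases h : β ∈ V <;> simp [h]
  map_smul' c π := by
    funext β
    change (if β ∈ V then MvPowerSeries.coeff β (c • π) else 0) =
      c * (if β ∈ V then MvPowerSeries.coeff β π else 0)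
    by_cases h : β ∈ V <;> simp [h]

/-- The space `T*_V` of the power series supported in `V`. -/
def TStar (V : Set (MIdx d ℒ)) : Submodule ℝ (PS d ℒ) where
  carrier := {π | ∀ β, β ∉ V → MvPowerSeries.coeff β π = 0}
  add_mem' h h' β hβ := by simp [h β hβ, h' β hβ]
  zero_mem' β _ := by simp
  smul_mem' c π h β hβ := by simp [h β hβ]

/-- The sum of a family of endomorphisms of the space of power series of which, for each fixed
`β`, only finitely many contribute to the coefficient of `z^β`. -/
noncomputable def locSum {ι : Type*} (T : ι → Module.End ℝ (PS d ℒ))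
    (h : ∀ β, {i | ∃ π, MvPowerSeries.coeff β (T i π) ≠ 0}.Finite) :
    Module.End ℝ (PS d ℒ) where
  toFun π := fun β => ∑ᶠ i, MvPowerSeries.coeff β (T i π)
  map_add' π π' := by
    funext β
    have hs : ∀ π, (Function.support fun i => MvPowerSeries.coeff β (T i π)).Finite := fun π =>
      (h β).subset fun i hi => ⟨π, hi⟩
    simp only [map_add]
    exact finsum_add_distrib (hs π) (hs π')
  map_smul' c π := by
    funext β
    have hs : (Function.support fun i => MvPowerSeries.coeff β (T i π)).Finite :=
      (h β).subset fun i hi => ⟨π, hi⟩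
    simp only [map_smul, RingHom.id_apply]
    exact (smul_finsum' c hs).symm

theorem coeff_locSum {ι : Type*} (T : ι → Module.End ℝ (PS d ℒ))
    (h : ∀ β, {i | ∃ π, MvPowerSeries.coeff β (T i π) ≠ 0}.Finite) (π : PS d ℒ) (β : MIdx d ℒ) :
    MvPowerSeries.coeff β (locSum T h π) = ∑ᶠ i, MvPowerSeries.coeff β (T i π) := rfl

theorem exists_ne_of_fs {ι : Type*} {f : ι → ℝ} (h : ∑ᶠ i, f i ≠ 0) : ∃ i, f i ≠ 0 := by
  by_contra! h'
  exact h (by simp [h'])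

theorem apply_ne_zero_of_coeff_X_mul {x : Coord d ℒ} {π : PS d ℒ} {β : MIdx d ℒ}
    (h : MvPowerSeries.coeff β (MvPowerSeries.X x * π) ≠ 0) :
    ∃ β', β = β' + Finsupp.single x 1 ∧ MvPowerSeries.coeff β' π ≠ 0 := by
  classical
  rw [MvPowerSeries.X, MvPowerSeries.coeff_monomial_mul] at h
  split_ifs at h with h1
  · exact ⟨β - Finsupp.single x 1, (tsub_add_cancel_of_le h1).symm, by simpa using h⟩
  · exact absurd rfl h

/-- Multiplication by a power series. -/
noncomputable def mulBy (π : PS d ℒ) : Module.End ℝ (PS d ℒ) := LinearMap.mulLeft ℝ π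

/-- The partial derivative with respect to the variable `z_x`. -/
noncomputable def dz (x : Coord d ℒ) : Module.End ℝ (PS d ℒ) :=
  (MvPowerSeries.pderiv ℝ x).toLinearMap

end Series

namespace Setting

variable {d : ℕ} {ℒ : Type*} (S : Setting d ℒ)

open Classical in
/-- The summand `(k(n)+1) z_{(𝔩,k+e_n)} ∂_{z_{(𝔩,k)}}`, present if `(𝔩,k+e_n)` is subcritical. -/
noncomputable def summandD (n : NIdx d) (p : Option ℒ × (NIdx d →₀ ℕ)) : Module.End ℝ (PS d ℒ) :=
  if S.SubcritPair p.1 (p.2 + Finsupp.single n 1) then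
    ((p.2 n : ℝ) + 1) •
      (mulBy (MvPowerSeries.X (.inl (p.1, p.2 + Finsupp.single n 1))) ∘ₗ dz (.inl p))
  else 0

theorem summandD_coeff {n : NIdx d} {p : Option ℒ × (NIdx d →₀ ℕ)} {π : PS d ℒ} {β : MIdx d ℒ}
    (h : MvPowerSeries.coeff β (S.summandD n p π) ≠ 0) :
    S.SubcritPair p.1 (p.2 + Finsupp.single n 1) ∧
      ∃ β', β = β' + Finsupp.single (.inl (p.1, p.2 + Finsupp.single n 1)) 1 ∧
        MvPowerSeries.coeff (β' + Finsupp.single (.inl p) 1) π ≠ 0 := by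
  unfold summandD at h
  split_ifs at h with hs
  · refine ⟨hs, ?_⟩
    simp only [LinearMap.smul_apply, LinearMap.comp_apply, map_smul, smul_eq_mul] at h
    obtain ⟨β', h1, h2⟩ := apply_ne_zero_of_coeff_X_mul (right_ne_zero_of_mul h)
    refine ⟨β', h1, ?_⟩
    have h3 : MvPowerSeries.coeff β' (MvPowerSeries.pderiv ℝ (.inl p) π) ≠ 0 := h2
    rw [MvPowerSeries.coeff_pderiv] at h3
    exact left_ne_zero_of_mul h3
  · simp at h

theorem summandD_finite (n : NIdx d) (β : MIdx d ℒ) :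
    {p | ∃ π, MvPowerSeries.coeff β (S.summandD n p π) ≠ 0}.Finite := by
  have hinj : Function.Injective fun p : Option ℒ × (NIdx d →₀ ℕ) =>
      (Sum.inl (p.1, p.2 + Finsupp.single n 1) : Coord d ℒ) := by
    rintro ⟨l, k⟩ ⟨l', k'⟩ h
    simpa using h
  refine (β.support.finite_toSet.preimage hinj.injOn).subset ?_
  rintro p ⟨π, hπ⟩
  obtain ⟨-, β', rfl, -⟩ := S.summandD_coeff hπ
  simp

/-- The derivation `D^{(n)}`, precomposed with the projection onto `𝒫 ∪ 𝒩⁻`. -/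
noncomputable def derivD (n : NIdx d) : Module.End ℝ (PS d ℒ) :=
  (locSum (S.summandD n) (S.summandD_finite n) + dz (.inr n)) ∘ₗ proj (S.setP ∪ S.setNmin)

/-- The summand `(n(i)+1) z_{n+e_i} D^{(n)}`. -/
noncomputable def summandX (i : Fin d) (n : NIdx d) : Module.End ℝ (PS d ℒ) :=
  ((n i : ℝ) + 1) • (mulBy (MvPowerSeries.X (.inr (n + Finsupp.single i 1))) ∘ₗ S.derivD n)

theorem summandX_coeff {i : Fin d} {n : NIdx d} {π : PS d ℒ} {β : MIdx d ℒ}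
    (h : MvPowerSeries.coeff β (S.summandX i n π) ≠ 0) :
    ∃ β', β = β' + Finsupp.single (.inr (n + Finsupp.single i 1)) 1 ∧
      MvPowerSeries.coeff β' (S.derivD n π) ≠ 0 := by
  simp only [summandX, LinearMap.smul_apply, LinearMap.comp_apply, map_smul, smul_eq_mul] at h
  exact apply_ne_zero_of_coeff_X_mul (right_ne_zero_of_mul h)

theorem summandX_finite (i : Fin d) (β : MIdx d ℒ) :
    {n | ∃ π, MvPowerSeries.coeff β (S.summandX i n π) ≠ 0}.Finite := by
  have hinj : Function.Injective fun n : NIdx d =>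
      (Sum.inr (n + Finsupp.single i 1) : Coord d ℒ) := by
    intro n n' h
    simpa using h
  refine (β.support.finite_toSet.preimage hinj.injOn).subset ?_
  rintro n ⟨π, hπ⟩
  obtain ⟨β', rfl, -⟩ := S.summandX_coeff hπ
  simp

/-- The generator `∂_i` of the space-time shift, `∂_i = ∑_n (n(i)+1) z_{n+e_i} D^{(n)}`. -/
noncomputable def derivX (i : Fin d) : Module.End ℝ (PS d ℒ) :=
  locSum (S.summandX i) (S.summandX_finite i)

/-- The index set `ℳ = 𝒩 × ℕ₀ᵈ`. -/
abbrev M : Type _ := S.setN × NIdx d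

/-- The monomial `z^β`. -/
noncomputable def z (β : MIdx d ℒ) : PS d ℒ := MvPowerSeries.monomial β 1

/-- The generators `z^γ D^{(n)}`, `(γ,n) ∈ ℳ`, and `∂_i`, `i = 1,…,d`, as endomorphisms. -/
noncomputable def genEnd : S.M ⊕ Fin d → Module.End ℝ (PS d ℒ)
  | .inl (γ, n) => mulBy (z γ.1) ∘ₗ S.derivD n
  | .inr i => S.derivX i

/-- The Lie algebra generated by the endomorphisms `z^γ D^{(n)}` and `∂_i`. -/
noncomputable def L : LieSubalgebra ℝ (Module.End ℝ (PS d ℒ)) :=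
  LieSubalgebra.lieSpan ℝ _ (Set.range S.genEnd)

/-- The generators as elements of the Lie algebra. -/
noncomputable def gen (x : S.M ⊕ Fin d) : S.L :=
  ⟨S.genEnd x, LieSubalgebra.subset_lieSpan (Set.mem_range_self x)⟩

/-- The span of the monomials `z^γ`, `γ ∈ 𝒩`. -/
noncomputable def polyN : Submodule ℝ (PS d ℒ) := Submodule.span ℝ (z '' S.setN)

/-! The generators map the span of the monomials `z^γ`, `γ ∈ 𝒩`, to itself. -/

theorem mem_polyN_of {π : PS d ℒ} (h : ∀ β, MvPowerSeries.coeff β π ≠ 0 → β ∈ S.setN)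
    (hf : {β | MvPowerSeries.coeff β π ≠ 0}.Finite) : π ∈ S.polyN := by
  classical
  have e : π = ∑ β ∈ hf.toFinset, MvPowerSeries.coeff β π • z β := by
    ext β
    simp only [map_sum, map_smul, smul_eq_mul, z, MvPowerSeries.coeff_monomial, mul_ite, mul_one,
      mul_zero]
    have hs := Finset.sum_eq_single (s := hf.toFinset)
      (f := fun x => if β = x then MvPowerSeries.coeff x π else 0) β
      (fun x _ hx => if_neg (Ne.symm hx))
      (fun hβ => by simpa using hβ)
    rw [if_pos rfl] at hs
    exact hs.symm
  rw [e]
  refine Submodule.sum_mem _ fun β hβ => Submodule.smul_mem _ _ (Submodule.subset_span ⟨β, ?_, rfl⟩)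
  exact h β (by simpa using hβ)

theorem coeff_z_ne {β γ : MIdx d ℒ} (h : MvPowerSeries.coeff β (z γ) ≠ 0) : β = γ := by
  classical
  rw [z, MvPowerSeries.coeff_monomial] at h
  by_contra h'
  exact h (if_neg h')

theorem coeff_proj_ne {V : Set (MIdx d ℒ)} {β : MIdx d ℒ} {π : PS d ℒ}
    (h : MvPowerSeries.coeff β (proj V π) ≠ 0) : MvPowerSeries.coeff β π ≠ 0 := by
  classical
  have h' : (if β ∈ V then MvPowerSeries.coeff β π else 0) ≠ 0 := h
  split_ifs at h' with h1
  · exact h'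
  · exact absurd rfl h'

theorem derivD_z {n : NIdx d} {γ β : MIdx d ℒ}
    (h : MvPowerSeries.coeff β (S.derivD n (z γ)) ≠ 0) :
    (∃ l k, S.SubcritPair l (k + Finsupp.single n 1) ∧ ∃ δ,
      β = δ + Finsupp.single (.inl (l, k + Finsupp.single n 1)) 1 ∧
      γ = δ + Finsupp.single (.inl (l, k)) 1) ∨ γ = β + Finsupp.single (.inr n) 1 := by
  rw [derivD, LinearMap.comp_apply, LinearMap.add_apply, map_add] at h
  by_cases h1 : MvPowerSeries.coeff β (dz (.inr n) (proj (S.setP ∪ S.setNmin) (z γ))) = 0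
  · rw [h1, add_zero, coeff_locSum] at h
    obtain ⟨⟨l, k⟩, hp⟩ := exists_ne_of_fs h
    obtain ⟨hs, δ, rfl, hδ⟩ := S.summandD_coeff hp
    exact .inl ⟨l, k, hs, δ, rfl, (coeff_z_ne (coeff_proj_ne hδ)).symm⟩
  · right
    have h3 : MvPowerSeries.coeff β
        (MvPowerSeries.pderiv ℝ (.inr n) (proj (S.setP ∪ S.setNmin) (z γ))) ≠ 0 := h1
    rw [MvPowerSeries.coeff_pderiv] at h3
    exact (coeff_z_ne (coeff_proj_ne (left_ne_zero_of_mul h3))).symm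

theorem derivX_z {i : Fin d} {γ β : MIdx d ℒ}
    (h : MvPowerSeries.coeff β (S.derivX i (z γ)) ≠ 0) :
    ∃ n δ, β = δ + Finsupp.single (.inr (n + Finsupp.single i 1)) 1 ∧
      MvPowerSeries.coeff δ (S.derivD n (z γ)) ≠ 0 := by
  rw [derivX, coeff_locSum] at h
  obtain ⟨n, hn⟩ := exists_ne_of_fs h
  obtain ⟨δ, h1, h2⟩ := S.summandX_coeff hn
  exact ⟨n, δ, h1, h2⟩

theorem derivD_z_finite (n : NIdx d) (γ : MIdx d ℒ) :
    {β | MvPowerSeries.coeff β (S.derivD n (z γ)) ≠ 0}.Finite := by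
  classical
  let f : Coord d ℒ → MIdx d ℒ := fun x =>
    match x with
    | .inl (l, k) => γ - Finsupp.single (.inl (l, k)) 1
        + Finsupp.single (.inl (l, k + Finsupp.single n 1)) 1
    | .inr m => γ - Finsupp.single (.inr m) 1
  refine (γ.support.finite_toSet.image f).subset ?_
  intro β hβ
  rcases S.derivD_z hβ with ⟨l, k, -, δ, rfl, rfl⟩ | rfl
  · exact ⟨.inl (l, k), by simp, by simp [f]⟩
  · exact ⟨.inr n, by simp, by simp [f]⟩

theorem sdeg_add (n m : NIdx d) : S.sdeg (n + m) = S.sdeg n + S.sdeg m := by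
  simp [sdeg, mul_add, Finset.sum_add_distrib]

theorem sdeg_single (i : Fin d) : S.sdeg (Finsupp.single i 1) = S.scaling i := by
  classical
  simp [sdeg, Finsupp.single_apply]

theorem sdeg_nonneg (n : NIdx d) : 0 ≤ S.sdeg n :=
  Finset.sum_nonneg fun i _ =>
    mul_nonneg (zero_le_one.trans (S.one_le_scaling i)) (Nat.cast_nonneg _)

theorem sdeg_lt_eta {l : Option ℒ} {k : NIdx d →₀ ℕ} {n : NIdx d}
    (h : S.SubcritPair l (k + Finsupp.single n 1)) : S.sdeg n < S.eta := by
  have h1 := (h.2 (Finsupp.single n 1) (by simp [pos_iff_ne_zero]) (by simp)).1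
  simp [regSum] at h1
  linarith

theorem sdeg_lt_finite (c : ℝ) : {n : NIdx d | S.sdeg n < c}.Finite := by
  refine (Set.finite_Iic (Finsupp.equivFunOnFinite.symm fun _ : Fin d => ⌈c⌉₊)).subset ?_
  intro n hn i
  have h1 : (n i : ℝ) ≤ S.sdeg n := by
    have h2 : S.scaling i * n i ≤ S.sdeg n :=
      Finset.single_le_sum (f := fun i => S.scaling i * (n i : ℝ))
        (fun i _ => mul_nonneg (zero_le_one.trans (S.one_le_scaling i)) (Nat.cast_nonneg _))
        (Finset.mem_univ i)
    nlinarith [S.one_le_scaling i, (Nat.cast_nonneg (n i) : (0 : ℝ) ≤ n i)]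
  have h3 : (n i : ℝ) ≤ ⌈c⌉₊ := (h1.trans (le_of_lt hn)).trans (Nat.le_ceil c)
  simpa using Nat.cast_le.mp h3

theorem derivX_z_finite (i : Fin d) (γ : MIdx d ℒ) :
    {β | MvPowerSeries.coeff β (S.derivX i (z γ)) ≠ 0}.Finite := by
  classical
  have hA : {n : NIdx d | S.sdeg n < S.eta ∨ (.inr n : Coord d ℒ) ∈ γ.support}.Finite :=
    (S.sdeg_lt_finite S.eta).union
      (γ.support.finite_toSet.preimage Sum.inr_injective.injOn)
  refine (hA.biUnion fun n _ => (S.derivD_z_finite n γ).image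
    fun δ => δ + Finsupp.single (.inr (n + Finsupp.single i 1)) 1).subset ?_
  intro β hβ
  obtain ⟨n, δ, rfl, hδ⟩ := S.derivX_z hβ
  refine Set.mem_biUnion (x := n) ?_ ⟨δ, hδ, rfl⟩
  rcases S.derivD_z hδ with ⟨l, k, hs, -⟩ | rfl
  · exact .inl (S.sdeg_lt_eta hs)
  · exact .inr (by simp)

theorem bra_add (β γ : MIdx d ℒ) : bra (β + γ) = bra β + bra γ := by
  classical
  refine Finsupp.sum_add_index' ?_ ?_
  · rintro (⟨l, k⟩ | n) <;> simp
  · rintro (⟨l, k⟩ | n) a b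
    · push_cast; ring
    · push_cast; ring

theorem bra_inl (l : Option ℒ) (k : NIdx d →₀ ℕ) :
    bra (Finsupp.single (.inl (l, k)) 1 : MIdx d ℒ) = 1 - len k := by simp [bra]

theorem bra_inr (n : NIdx d) : bra (Finsupp.single (.inr n) 1 : MIdx d ℒ) = 1 := by simp [bra]

theorem len_add_single (k : NIdx d →₀ ℕ) (n : NIdx d) :
    len (k + Finsupp.single n 1) = len k + 1 := by
  classical
  rw [len, Finsupp.sum_add_index' (by simp) (by simp)]
  simp [len]

theorem noise_add (β γ : MIdx d ℒ) : noise (β + γ) = noise β + noise γ := by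
  classical
  refine Finsupp.sum_add_index' ?_ ?_
  · rintro (⟨_ | l, k⟩ | n) <;> simp
  · rintro (⟨_ | l, k⟩ | n) a b <;> simp

theorem noise_inl (l : Option ℒ) (k k' : NIdx d →₀ ℕ) :
    noise (Finsupp.single (.inl (l, k)) 1 : MIdx d ℒ) =
      noise (Finsupp.single (.inl (l, k')) 1 : MIdx d ℒ) := by
  cases l <;> simp [noise]

theorem noise_inr (n : NIdx d) : noise (Finsupp.single (.inr n) 1 : MIdx d ℒ) = 0 := by
  simp [noise]

/-- If `z^β` occurs in `D^{(n)} z^γ` with `γ ∈ 𝒩`, and `z^δ` with `[δ] = 1` is such that `δ` is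
subcritical and has no polynomial components of low degree, then `δ + β ∈ 𝒩`. -/
theorem add_mem_setN {n : NIdx d} {γ β δ : MIdx d ℒ} (hγ : γ ∈ S.setN) (hδ : δ ∈ S.setNmin)
    (h : MvPowerSeries.coeff β (S.derivD n (z γ)) ≠ 0) : δ + β ∈ S.setN := by
  classical
  obtain ⟨⟨g1, g2, g3⟩, g4⟩ := hγ
  obtain ⟨d1, d2, d3⟩ := hδ
  rcases S.derivD_z h with ⟨l, k, hs, ε, rfl, rfl⟩ | rfl
  · refine ⟨⟨?_, ?_, ?_⟩, ?_⟩
    · rw [bra_add, bra_inl] at g1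
      rw [bra_add, bra_add, bra_inl, d1, len_add_single]
      push_cast
      linarith
    · intro l' k' h'
      by_cases e1 : δ (.inl (l', k')) = 0
      · by_cases e2 : ε (.inl (l', k')) = 0
        · rw [Finsupp.add_apply, Finsupp.add_apply, e1, e2, zero_add, zero_add,
            Finsupp.single_apply_ne_zero] at h'
          obtain ⟨rfl, rfl⟩ : l' = l ∧ k' = k + Finsupp.single n 1 := by simpa using h'.1
          exact hs
        · exact g2 l' k' (by simp [e2])
      · exact d2 l' k' e1
    · intro m hm
      have h1 := g3 m hm
      simp at h1
      simp [d3 m hm, h1]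
    · rw [noise_add, noise_inl l k (k + Finsupp.single n 1), ← noise_add] at g4
      rw [noise_add]
      omega
  · refine ⟨⟨?_, ?_, ?_⟩, ?_⟩
    · rw [bra_add, bra_inr] at g1
      rw [bra_add, d1]
      linarith
    · intro l' k' h'
      by_cases e1 : δ (.inl (l', k')) = 0
      · refine g2 l' k' ?_
        simpa [e1] using h'
      · exact d2 l' k' e1
    · intro m hm
      have h1 := g3 m hm
      simp at h1
      simp [d3 m hm, h1.1]
    · rw [noise_add, noise_inr] at g4
      rw [noise_add]
      omega

theorem genEnd_z_mem (x : S.M ⊕ Fin d) {γ : MIdx d ℒ} (hγ : γ ∈ S.setN) :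
    S.genEnd x (z γ) ∈ S.polyN := by
  classical
  rcases x with ⟨⟨γ', hγ'⟩, n⟩ | i
  · have key : ∀ β, MvPowerSeries.coeff β (S.genEnd (.inl (⟨γ', hγ'⟩, n)) (z γ)) ≠ 0 →
        ∃ δ, β = γ' + δ ∧ MvPowerSeries.coeff δ (S.derivD n (z γ)) ≠ 0 := by
      intro β h
      have h' : MvPowerSeries.coeff β (MvPowerSeries.monomial γ' 1 * S.derivD n (z γ)) ≠ 0 := h
      rw [MvPowerSeries.coeff_monomial_mul] at h'
      split_ifs at h' with h1
      · exact ⟨β - γ', (add_tsub_cancel_of_le h1).symm, by simpa using h'⟩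
      · exact absurd rfl h'
    refine S.mem_polyN_of ?_ ?_
    · intro β h
      obtain ⟨δ, rfl, hδ⟩ := key β h
      exact S.add_mem_setN hγ hγ'.1 hδ
    · refine ((S.derivD_z_finite n γ).image fun δ => γ' + δ).subset ?_
      intro β h
      obtain ⟨δ, rfl, hδ⟩ := key β h
      exact ⟨δ, hδ, rfl⟩
  · refine S.mem_polyN_of ?_ (S.derivX_z_finite i γ)
    intro β h
    obtain ⟨n, δ, rfl, hδ⟩ := S.derivX_z h
    rw [add_comm]
    refine S.add_mem_setN hγ ⟨bra_inr _, ?_, ?_⟩ hδ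
    · intro l k h'
      simp at h'
    · intro m hm
      rw [Finsupp.single_apply_eq_zero]
      intro e
      obtain rfl : m = n + Finsupp.single i 1 := by simpa using e
      rw [sdeg_add, sdeg_single] at hm
      linarith [S.sdeg_nonneg n, S.regSol_le_scaling i]

/-- The Lie subalgebra of the endomorphisms that map `polyN` to itself. -/
noncomputable def stab : LieSubalgebra ℝ (Module.End ℝ (PS d ℒ)) where
  carrier := {D | ∀ π ∈ S.polyN, D π ∈ S.polyN}
  add_mem' h h' π hπ := S.polyN.add_mem (h π hπ) (h' π hπ)
  zero_mem' _ _ := S.polyN.zero_mem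
  smul_mem' c _ h π hπ := S.polyN.smul_mem c (h π hπ)
  lie_mem' {D D'} h h' π hπ := by
    rw [LieRing.of_associative_ring_bracket]
    exact S.polyN.sub_mem (h _ (h' π hπ)) (h' _ (h π hπ))

theorem L_le_stab : S.L ≤ S.stab := by
  refine LieSubalgebra.lieSpan_le.mpr ?_
  rintro _ ⟨x, rfl⟩ π hπ
  induction hπ using Submodule.span_induction with
  | mem π h =>
    obtain ⟨γ, hγ, rfl⟩ := h
    exact S.genEnd_z_mem x hγ
  | zero => rw [map_zero]; exact S.polyN.zero_mem
  | add π π' _ _ h h' => rw [map_add]; exact S.polyN.add_mem h h'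
  | smul c π _ h => rw [map_smul]; exact S.polyN.smul_mem c h

/-- The action of an element of the Lie algebra on the span of the monomials `z^γ`, `γ ∈ 𝒩`. -/
noncomputable def actN (D : S.L) : Module.End ℝ S.polyN :=
  (D : Module.End ℝ (PS d ℒ)).restrict fun π hπ => S.L_le_stab D.2 π hπ

theorem mul_derivD_mem (n : NIdx d) (π : S.polyN) : mulBy π.1 ∘ₗ S.derivD n ∈ S.L := by
  obtain ⟨π, hπ⟩ := π
  change mulBy π ∘ₗ S.derivD n ∈ S.L
  induction hπ using Submodule.span_induction with
  | mem π h =>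
    obtain ⟨γ, hγ, rfl⟩ := h
    exact LieSubalgebra.subset_lieSpan ⟨.inl (⟨γ, hγ⟩, n), rfl⟩
  | zero =>
    have e : mulBy (0 : PS d ℒ) ∘ₗ S.derivD n = 0 := by ext1; simp [mulBy]
    rw [e]; exact S.L.zero_mem
  | add π π' _ _ h h' =>
    have e : mulBy (π + π') ∘ₗ S.derivD n = mulBy π ∘ₗ S.derivD n + mulBy π' ∘ₗ S.derivD n := by
      ext1; simp [mulBy, add_mul]
    rw [e]; exact S.L.add_mem h h'
  | smul c π _ h =>
    have e : mulBy (c • π) ∘ₗ S.derivD n = c • (mulBy π ∘ₗ S.derivD n) := by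
      ext1; simp [mulBy]
    rw [e]; exact S.L.smul_mem c h

/-- The linear map `π ↦ π D^{(n)}`, with `π` in the span of the monomials `z^γ`, `γ ∈ 𝒩`. -/
noncomputable def mulD (n : NIdx d) : S.polyN →ₗ[ℝ] S.L where
  toFun π := ⟨mulBy π.1 ∘ₗ S.derivD n, S.mul_derivD_mem n π⟩
  map_add' π π' := by
    apply Subtype.ext
    change mulBy (π.1 + π'.1) ∘ₗ S.derivD n = mulBy π.1 ∘ₗ S.derivD n + mulBy π'.1 ∘ₗ S.derivD n
    ext1; simp [mulBy, add_mul]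
  map_smul' c π := by
    apply Subtype.ext
    change mulBy (c • π.1) ∘ₗ S.derivD n = c • (mulBy π.1 ∘ₗ S.derivD n)
    ext1; simp [mulBy]

/-- The monomial `z^γ`, `γ ∈ 𝒩`, as an element of `polyN`. -/
noncomputable def zN (γ : S.setN) : S.polyN := ⟨z γ.1, Submodule.subset_span ⟨γ.1, γ.2, rfl⟩⟩

/-- The universal enveloping algebra `U(L)`. -/
abbrev U : Type _ := UniversalEnvelopingAlgebra ℝ S.L

/-- The canonical map `L → U(L)`. -/
noncomputable def ιU : S.L →ₗ⁅ℝ⁆ S.U := UniversalEnvelopingAlgebra.ι ℝ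

/-- The representation of `U(L)` on the space of power series that extends the tautological
action of `L`. -/
noncomputable def rho : S.U →ₐ[ℝ] Module.End ℝ (PS d ℒ) :=
  UniversalEnvelopingAlgebra.lift ℝ S.L.incl

/-- The coproduct of `U(L)`: the algebra morphism with `D ↦ 1 ⊗ D + D ⊗ 1` for `D ∈ L`. -/
noncomputable def coprod : S.U →ₐ[ℝ] S.U ⊗[ℝ] S.U :=
  UniversalEnvelopingAlgebra.lift ℝ
    { toFun := fun D => (1 : S.U) ⊗ₜ[ℝ] S.ιU D + S.ιU D ⊗ₜ[ℝ] (1 : S.U)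
      map_add' := fun D D' => by
        rw [map_add, TensorProduct.tmul_add, TensorProduct.add_tmul]; abel
      map_smul' := fun c D => by
        simp [TensorProduct.smul_tmul']
      map_lie' := fun {D D'} => by
        simp only [LieHom.map_lie, LieRing.of_associative_ring_bracket, mul_add, add_mul,
          Algebra.TensorProduct.tmul_mul_tmul, one_mul, mul_one, TensorProduct.tmul_sub,
          TensorProduct.sub_tmul]
        abel }

/-- `L` acts on the linear maps `f : polyN → U(L)` by `(D · f)(π) = D f(π) - f(D π)`. -/
noncomputable def homAct : S.L →ₗ⁅ℝ⁆ Module.End ℝ (S.polyN →ₗ[ℝ] S.U) where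
  toFun D :=
    { toFun := fun f => LinearMap.mulLeft ℝ (S.ιU D) ∘ₗ f - f ∘ₗ S.actN D
      map_add' := fun f g => by
        ext π; simp [mul_add]; abel
      map_smul' := fun c f => by
        ext π; simp [smul_sub] }
  map_add' D D' := by
    ext f π
    have e : S.actN (D + D') π = S.actN D π + S.actN D' π := rfl
    simp [e, add_mul]; abel
  map_smul' c D := by
    ext f π
    have e : S.actN (c • D) π = c • S.actN D π := rfl
    simp [e, smul_sub]
  map_lie' {D D'} := by
    ext f π
    have e : S.actN ⁅D, D'⁆ π = S.actN D (S.actN D' π) - S.actN D' (S.actN D π) := rfl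
    simp [e, LieRing.of_associative_ring_bracket, mul_sub, sub_mul, mul_assoc]
    abel

/-- `U ↦ π U D^{(n)}`, linear in `U ∈ U(L)` and in `π ∈ polyN`; the following two lemmas are the
recursion that characterizes it. -/
noncomputable def sandwichHom (n : NIdx d) : S.U →ₗ[ℝ] S.polyN →ₗ[ℝ] S.U :=
  LinearMap.applyₗ (S.ιU.toLinearMap ∘ₗ S.mulD n) ∘ₗ
    (UniversalEnvelopingAlgebra.lift ℝ S.homAct).toLinearMap

theorem sandwichHom_one (n : NIdx d) (π : S.polyN) :
    S.sandwichHom n 1 π = S.ιU (S.mulD n π) := by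
  simp [sandwichHom]

theorem sandwichHom_mul (n : NIdx d) (D : S.L) (V : S.U) (π : S.polyN) :
    S.sandwichHom n (S.ιU D * V) π =
      S.ιU D * S.sandwichHom n V π - S.sandwichHom n V (S.actN D π) := by
  have e : UniversalEnvelopingAlgebra.lift ℝ S.homAct (S.ιU D) = S.homAct D :=
    UniversalEnvelopingAlgebra.lift_ι_apply ℝ S.homAct D
  simp only [sandwichHom, LinearMap.comp_apply, AlgHom.toLinearMap_apply, map_mul, e]
  rfl

/-- The linear map `U ↦ z^γ U D^{(n)}` of `U(L)`, for `(γ,n) ∈ ℳ`. -/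
noncomputable def sandwich (x : S.M) : S.U →ₗ[ℝ] S.U where
  toFun V := S.sandwichHom x.2 V (S.zN x.1)
  map_add' V W := by simp
  map_smul' c V := by simp

/-- The iterated application of the maps `U ↦ z^γ U D^{(n)}`, `(γ,n)` running through a list. -/
noncomputable def sandwichList (l : List S.M) (V : S.U) : S.U :=
  l.foldr (fun x W => S.sandwich x W) V

/-- `∂^m = ∏_i ∂_i^{m(i)}` in `U(L)`. -/
noncomputable def powX (m : NIdx d) : S.U :=
  (List.ofFn fun i => S.ιU (S.gen (.inr i)) ^ m i).prod

/-- The set `M(ℳ) × ℕ₀ᵈ` of the indices `(J,m)`. -/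
abbrev Idx : Type _ := (S.M →₀ ℕ) × NIdx d

/-- The element `D_{(J,m)}` of `U(L)`: the maps `U ↦ z^γ U D^{(n)}`, each taken `J(γ,n)` times, are
applied to `∂^m`, and the result is divided by `J! m!`. -/
noncomputable def D (p : S.Idx) : S.U :=
  ((mfact p.1 : ℝ) * mfact p.2)⁻¹ •
    S.sandwichList (Finsupp.toMultiset p.1).toList (S.powX p.2)

open Classical in
/-- The projection `ι_n : U(L) → T*_𝒩` in coordinates. -/
noncomputable def iota (b : Module.Basis S.Idx ℝ S.U) (n : NIdx d) : S.U →ₗ[ℝ] TStar S.setN :=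
  b.constr ℝ fun p =>
    if h : ∃ γ : S.setN, p = (Finsupp.single (γ, n) 1, 0) then
      ⟨z h.choose.1, fun β hβ => by
        by_contra h'
        exact hβ (coeff_z_ne h' ▸ h.choose.2)⟩
    else 0

open Classical in
/-- The generalized counit `ε_m : U(L) → ℝ` in coordinates. -/
noncomputable def eps (b : Module.Basis S.Idx ℝ S.U) (m : NIdx d) : S.U →ₗ[ℝ] ℝ :=
  b.constr ℝ fun p => if p = (0, m) then 1 else 0

/-- The pairing of `U(L)` with the free commutative algebra over `ℳ ⊔ {1,…,d}` for which the basis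
of `U(L)` is dual to the monomials. -/
noncomputable def pairing (b : Module.Basis S.Idx ℝ S.U) :
    S.U →ₗ[ℝ] MvPolynomial (S.M ⊕ Fin d) ℝ →ₗ[ℝ] ℝ :=
  b.constr ℝ fun p =>
    MvPolynomial.lcoeff ℝ (Finsupp.sumFinsuppEquivProdFinsupp.symm p)

/-- The pairing of `U(L) ⊗ U(L)` with `M₁ ⊗ M₂`. -/
noncomputable def pairing₂ (b : Module.Basis S.Idx ℝ S.U) (M₁ M₂ : MvPolynomial (S.M ⊕ Fin d) ℝ) :
    S.U ⊗[ℝ] S.U →ₗ[ℝ] ℝ :=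
  LinearMap.mul' ℝ ℝ ∘ₗ
    TensorProduct.map ((S.pairing b).flip M₁) ((S.pairing b).flip M₂)

/-- The homogeneities `|(γ,n)| = |γ| + η - |n|` and `|i| = |e_i|`. -/
noncomputable def genHomog : S.M ⊕ Fin d → ℝ
  | .inl (γ, n) => S.homog γ.1 + S.eta - S.sdeg n
  | .inr i => S.sdeg (Finsupp.single i 1)

/-- The homogeneity `|(J,m)|`. -/
noncomputable def idxHomog (p : S.Idx) : ℝ :=
  (p.1.sum fun x a => (a : ℝ) * S.genHomog (.inl x)) +
    ∑ i, (p.2 i : ℝ) * S.genHomog (.inr i)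

/-- The homogeneous subspaces `L_κ` of `L`. -/
noncomputable def Lgr (κ : ℝ) : Submodule ℝ S.L :=
  Submodule.span ℝ {D | ∃ x, S.genHomog x = κ ∧ D = S.gen x}

/-- The homogeneous subspaces `U_ν` of `U(L)`: the span of the products `D₁ ⋯ D_r`, `r ≥ 0`, of
homogeneous elements of `L` of which the homogeneities add up to `ν`. -/
noncomputable def Ugr (ν : ℝ) : Submodule ℝ S.U :=
  Submodule.span ℝ {V | ∃ l : List (ℝ × S.L),
    (∀ q ∈ l, q.2 ∈ S.Lgr q.1) ∧ (l.map Prod.fst).sum = ν ∧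
      V = (l.map fun q => S.ιU q.2).prod}

end Setting

end MultiIndexSPDE

/-! The theorem is a Poincaré–Birkhoff–Witt statement in explicit coordinates, obtained by letting
`L` act on the polynomial algebra `S.Poly`, whose variables are the pairs `(γ,n)` and the directions
`i`.

For the bracket relations, `D^{(n)}` and `∂_i` without the projection `P` are derivations of power
series each of whose output coefficients depends on finitely many input coefficients. An identity
between commutators of such maps need only be checked on the variables (`IsDeriv.eq_zero`). The
projection does no harm because the unprojected generators preserve the series supported in `𝒫 ∪
𝒩⁻`, so in a product only the rightmost projection survives (`genEnd_genEnd`). Hence the span of the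
generators is closed under brackets. Independence follows by testing on the variables `z_n`, where
the generators act in the simplest way.

For the basis of `U(L)`, an element of `L` acts on `S.Poly` as a derivation (`polyDer`), in which it
differentiates the monomials `z^γ` inside the variables, plus a creation operator: multiplication by
the variable for `∂_i`, and for `z^γ D^{(n)}` the normal-ordered product `normMul`, which carries
`D^{(n)}` to the right past the `∂_i` and leaves `z^γ` on the left. The bracket relations say that
this is a representation (`polyRepFun_lie`). Applying it to `1` gives the `symbol` of an element of
`U(L)`. The recursion for `U ↦ z^γ U D^{(n)}` turns into multiplication by the variable `(γ,n)`
(`symbol_sandwichHom`), so the symbol of `D_{(J,m)}` is the monomial with exponent `(J,m)` divided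
by `J! m!`; independence is then immediate. The same recursion read backwards shows that the span of
the `D_{(J,m)}` is stable under left multiplication by `L`.

The remaining claims follow from the same recursion. The maps `U ↦ z^γ U D^{(n)}` are coderivations
(`coprod_sandwichHom`), which with the factorials as divided powers gives the coproduct formula. The
projection `ι_n` is the linear part of the symbol (`coe_iota`), and `ε_m` selects the components
with `J = 0`. For a right factor with `J ≠ 0` the creation operators do not reach the linear part,
so only the action `ρ` remains; for a right factor `∂^m/m!` the index `n` is shifted and a binomial
coefficient appears. Homogeneity is followed through the recursion word by word. -/

namespace MultiIndexSPDE

/-! ### Derivations of power series that are determined by their values on the variables. -/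

section LocalDerivations

variable {d : ℕ} {ℒ : Type*}

open MvPowerSeries (coeff X)

/-- Every coefficient of `T π` is determined by finitely many coefficients of `π`. -/
def FinDep (T : Module.End ℝ (PS d ℒ)) : Prop :=
  ∀ β, ∃ F : Finset (MIdx d ℒ), ∀ π, (∀ γ ∈ F, coeff γ π = 0) → coeff β (T π) = 0

/-- The Leibniz rule. -/
def IsDeriv (T : Module.End ℝ (PS d ℒ)) : Prop := ∀ π ρ, T (π * ρ) = π * T ρ + ρ * T π

namespace FinDep

variable {T T' : Module.End ℝ (PS d ℒ)}

theorem comp (h : FinDep T) (h' : FinDep T') : FinDep (T ∘ₗ T') := by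
  classical
  intro β
  obtain ⟨F, hF⟩ := h β
  choose G hG using h'
  refine ⟨F.biUnion G, fun π hπ => hF _ fun γ hγ => hG γ π fun δ hδ => hπ δ ?_⟩
  exact Finset.mem_biUnion.mpr ⟨γ, hγ, hδ⟩

theorem add (h : FinDep T) (h' : FinDep T') : FinDep (T + T') := by
  classical
  intro β
  obtain ⟨F, hF⟩ := h β
  obtain ⟨F', hF'⟩ := h' β
  refine ⟨F ∪ F', fun π hπ => ?_⟩
  rw [LinearMap.add_apply, map_add, hF π fun γ hγ => hπ γ (Finset.mem_union_left _ hγ),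
    hF' π fun γ hγ => hπ γ (Finset.mem_union_right _ hγ), add_zero]

theorem smul (c : ℝ) (h : FinDep T) : FinDep (c • T) := by
  intro β
  obtain ⟨F, hF⟩ := h β
  exact ⟨F, fun π hπ => by rw [LinearMap.smul_apply, map_smul, hF π hπ, smul_zero]⟩

theorem sub (h : FinDep T) (h' : FinDep T') : FinDep (T - T') := by
  classical
  intro β
  obtain ⟨F, hF⟩ := h β
  obtain ⟨F', hF'⟩ := h' β
  refine ⟨F ∪ F', fun π hπ => ?_⟩
  rw [LinearMap.sub_apply, map_sub, hF π fun γ hγ => hπ γ (Finset.mem_union_left _ hγ),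
    hF' π fun γ hγ => hπ γ (Finset.mem_union_right _ hγ), sub_zero]

theorem zero : FinDep (0 : Module.End ℝ (PS d ℒ)) := fun _ => ⟨∅, fun _ _ => by simp⟩

theorem mulBy (π : PS d ℒ) : FinDep (mulBy π) := by
  classical
  intro β
  refine ⟨(Finset.HasAntidiagonal.antidiagonal β).image Prod.snd, fun ρ hρ => ?_⟩
  change coeff β (π * ρ) = 0
  rw [MvPowerSeries.coeff_mul]
  exact Finset.sum_eq_zero fun p hp => by rw [hρ p.2 (Finset.mem_image_of_mem _ hp), mul_zero]

theorem dz (x : Coord d ℒ) : FinDep (dz x) := fun β =>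
  ⟨{β + Finsupp.single x 1}, fun π hπ => by
    change coeff β (MvPowerSeries.pderiv ℝ x π) = 0
    rw [MvPowerSeries.coeff_pderiv, hπ _ (Finset.mem_singleton_self _), zero_mul]⟩

theorem locSum {ι : Type*} {T : ι → Module.End ℝ (PS d ℒ)}
    (h : ∀ β, {i | ∃ π, coeff β (T i π) ≠ 0}.Finite) (hT : ∀ i, FinDep (T i)) :
    FinDep (locSum T h) := by
  classical
  intro β
  choose G hG using fun i => hT i β
  refine ⟨(h β).toFinset.biUnion G, fun π hπ => ?_⟩
  rw [coeff_locSum]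
  refine finsum_eq_zero_of_forall_eq_zero fun i => ?_
  by_contra hi
  exact hi (hG i π fun γ hγ => hπ γ (Finset.mem_biUnion.mpr ⟨i, by simpa using ⟨π, hi⟩, hγ⟩))

/-- A power series is no finite combination of monomials, but for a fixed output coefficient only
the finitely many input coefficients in `F` matter; subtracting the polynomial that carries these
does not change the image. -/
theorem eq_zero (h : FinDep T) (hz : ∀ γ, T (Setting.z γ) = 0) : T = 0 := by
  classical
  ext π β
  obtain ⟨F, hF⟩ := h β
  have e : coeff β (T (π - ∑ γ ∈ F, coeff γ π • Setting.z γ)) = 0 := by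
    refine hF _ fun γ hγ => ?_
    simp only [map_sub, map_sum, map_smul, smul_eq_mul, Setting.z, MvPowerSeries.coeff_monomial,
      mul_ite, mul_one, mul_zero]
    have hs := Finset.sum_eq_single (s := F)
      (f := fun x => if γ = x then coeff x π else 0) γ
      (fun x _ hx => if_neg (Ne.symm hx)) (fun h => absurd hγ h)
    rw [if_pos rfl] at hs
    exact sub_eq_zero.mpr hs.symm
  have e' : T (∑ γ ∈ F, coeff γ π • Setting.z γ) = 0 := by
    simp only [map_sum, map_smul, hz, smul_zero, Finset.sum_const_zero]
  rw [map_sub, e', sub_zero] at e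
  simpa using e

end FinDep

namespace IsDeriv

variable {T T' : Module.End ℝ (PS d ℒ)}

theorem add (h : IsDeriv T) (h' : IsDeriv T') : IsDeriv (T + T') := fun π ρ => by
  simp only [LinearMap.add_apply, h π ρ, h' π ρ]; ring

theorem smul (c : ℝ) (h : IsDeriv T) : IsDeriv (c • T) := fun π ρ => by
  simp only [LinearMap.smul_apply, h π ρ, smul_add, mul_smul_comm]

theorem sub (h : IsDeriv T) (h' : IsDeriv T') : IsDeriv (T - T') := fun π ρ => by
  simp only [LinearMap.sub_apply, h π ρ, h' π ρ]; ring

theorem zero : IsDeriv (0 : Module.End ℝ (PS d ℒ)) := fun π ρ => by simp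

theorem mulBy_comp (κ : PS d ℒ) (h : IsDeriv T) : IsDeriv (mulBy κ ∘ₗ T) := fun π ρ => by
  simp only [mulBy, LinearMap.comp_apply, LinearMap.mulLeft_apply, h π ρ]; ring

theorem commutator (h : IsDeriv T) (h' : IsDeriv T') : IsDeriv (T ∘ₗ T' - T' ∘ₗ T) :=
  fun π ρ => by
    simp only [LinearMap.sub_apply, LinearMap.comp_apply, h π ρ, h' π ρ, map_add, h _ _, h' _ _]
    ring

theorem dz (x : Coord d ℒ) : IsDeriv (dz x) := fun π ρ =>
  (MvPowerSeries.pderiv ℝ x).leibniz π ρ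

/-- A coefficient of a product involves the finite antidiagonal only, so for each of them only
finitely many `i` contribute and the Leibniz rule may be summed term by term. -/
theorem locSum {ι : Type*} {T : ι → Module.End ℝ (PS d ℒ)}
    (h : ∀ β, {i | ∃ π, coeff β (T i π) ≠ 0}.Finite) (hT : ∀ i, IsDeriv (T i)) :
    IsDeriv (locSum T h) := by
  classical
  have hs : ∀ β π, (Function.support fun i => coeff β (T i π)).Finite := fun β π =>
    (h β).subset fun i hi => ⟨π, hi⟩
  have hs' : ∀ β (p : MIdx d ℒ × MIdx d ℒ) (π ρ : PS d ℒ), p ∈ Finset.HasAntidiagonal.antidiagonal β →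
      (Function.support fun i => coeff p.1 π * coeff p.2 (T i ρ)).Finite := fun β p π ρ _ =>
    (hs p.2 ρ).subset fun i hi => right_ne_zero_of_mul hi
  have key : ∀ π ρ β, coeff β (π * MultiIndexSPDE.locSum T h ρ) =
      ∑ᶠ i, coeff β (π * T i ρ) := by
    intro π ρ β
    simp only [MvPowerSeries.coeff_mul, coeff_locSum]
    rw [finsum_sum_comm _ _ fun p hp => hs' β p π ρ hp]
    exact Finset.sum_congr rfl fun p _ => mul_finsum _ _
  have hk : ∀ π ρ β, (Function.support fun i => coeff β (π * T i ρ)).Finite := by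
    intro π ρ β
    refine (Set.Finite.biUnion (Finset.HasAntidiagonal.antidiagonal β).finite_toSet
      fun p _ => hs p.2 ρ).subset fun i hi => ?_
    rw [Function.mem_support, MvPowerSeries.coeff_mul] at hi
    obtain ⟨p, hp, hpi⟩ := Finset.exists_ne_zero_of_sum_ne_zero hi
    exact Set.mem_biUnion hp (right_ne_zero_of_mul hpi)
  intro π ρ
  ext β
  rw [coeff_locSum, map_add, key, key, ← finsum_add_distrib (hk _ _ _) (hk _ _ _)]
  exact finsum_congr fun i => by rw [hT i, map_add]

theorem map_one (h : IsDeriv T) : T 1 = 0 := by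
  simpa using h 1 1

theorem map_z (h : IsDeriv T) (hX : ∀ x, T (X x) = 0) (γ : MIdx d ℒ) :
    T (Setting.z γ) = 0 := by
  have h1 := h.map_one
  have hpow : ∀ (x : Coord d ℒ) (n : ℕ), T (X x ^ n) = 0 := by
    intro x n
    induction n with
    | zero => rw [pow_zero, h1]
    | succ n ih => rw [pow_succ, h, ih, hX, mul_zero, mul_zero, add_zero]
  induction γ using Finsupp.induction_linear with
  | zero => exact h1
  | add f g hf hg =>
    have e : (Setting.z (f + g) : PS d ℒ) = Setting.z f * Setting.z g := by
      simp [Setting.z, MvPowerSeries.monomial_mul_monomial]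
    rw [e, h, hf, hg, mul_zero, mul_zero, add_zero]
  | single x n =>
    have e : (Setting.z (Finsupp.single x n) : PS d ℒ) = X x ^ n := by
      rw [MvPowerSeries.X_pow_eq]; rfl
    rw [e, hpow]

theorem eq_zero (h : IsDeriv T) (hf : FinDep T) (hX : ∀ x, T (X x) = 0) : T = 0 :=
  hf.eq_zero (h.map_z hX)

end IsDeriv

end LocalDerivations

/-! ### The unprojected derivations `D^{(n)}`, `∂_i` and their commutators. -/

namespace Setting

variable {d : ℕ} {ℒ : Type*} (S : Setting d ℒ)

open MvPowerSeries (coeff X)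

/-- The derivation `D^{(n)}` before the projection. -/
noncomputable def derivD₀ (n : NIdx d) : Module.End ℝ (PS d ℒ) :=
  locSum (S.summandD n) (S.summandD_finite n) + dz (.inr n)

theorem derivD_eq (n : NIdx d) :
    S.derivD n = S.derivD₀ n ∘ₗ proj (S.setP ∪ S.setNmin) := rfl

theorem summandX₀_finite (i : Fin d) (β : MIdx d ℒ) :
    {n : NIdx d | ∃ π, coeff β ((((n i : ℝ) + 1) •
      (mulBy (X (.inr (n + Finsupp.single i 1))) ∘ₗ S.derivD₀ n)) π) ≠ 0}.Finite := by
  have hinj : Function.Injective fun n : NIdx d =>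
      (Sum.inr (n + Finsupp.single i 1) : Coord d ℒ) := by
    intro n n' h
    simpa using h
  refine (β.support.finite_toSet.preimage hinj.injOn).subset ?_
  rintro n ⟨π, hπ⟩
  simp only [LinearMap.smul_apply, LinearMap.comp_apply, map_smul, smul_eq_mul] at hπ
  obtain ⟨β', rfl, -⟩ := apply_ne_zero_of_coeff_X_mul (right_ne_zero_of_mul hπ)
  simp

/-- The derivation `∂_i` before the projection. -/
noncomputable def derivX₀ (i : Fin d) : Module.End ℝ (PS d ℒ) :=
  locSum (fun n : NIdx d => ((n i : ℝ) + 1) •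
    (mulBy (X (.inr (n + Finsupp.single i 1))) ∘ₗ S.derivD₀ n)) (S.summandX₀_finite i)

theorem derivX_eq (i : Fin d) :
    S.derivX i = S.derivX₀ i ∘ₗ proj (S.setP ∪ S.setNmin) := by
  ext π β
  rfl

theorem isDeriv_summandD (n : NIdx d) (p : Option ℒ × (NIdx d →₀ ℕ)) :
    IsDeriv (S.summandD n p) := by
  unfold summandD
  split_ifs
  · exact ((IsDeriv.dz _).mulBy_comp _).smul _
  · exact IsDeriv.zero

theorem finDep_summandD (n : NIdx d) (p : Option ℒ × (NIdx d →₀ ℕ)) :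
    FinDep (S.summandD n p) := by
  unfold summandD
  split_ifs
  · exact ((FinDep.mulBy _).comp (FinDep.dz _)).smul _
  · exact FinDep.zero

theorem isDeriv_derivD₀ (n : NIdx d) : IsDeriv (S.derivD₀ n) :=
  (IsDeriv.locSum _ (S.isDeriv_summandD n)).add (IsDeriv.dz _)

theorem finDep_derivD₀ (n : NIdx d) : FinDep (S.derivD₀ n) :=
  (FinDep.locSum _ (S.finDep_summandD n)).add (FinDep.dz _)

theorem isDeriv_derivX₀ (i : Fin d) : IsDeriv (S.derivX₀ i) :=
  IsDeriv.locSum _ fun n => ((S.isDeriv_derivD₀ n).mulBy_comp _).smul _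

theorem finDep_derivX₀ (i : Fin d) : FinDep (S.derivX₀ i) :=
  FinDep.locSum _ fun n => ((FinDep.mulBy _).comp (S.finDep_derivD₀ n)).smul _

open Classical in
theorem derivD₀_X_inr (n m : NIdx d) :
    S.derivD₀ n (X (.inr m)) = if n = m then 1 else 0 := by
  have h : locSum (S.summandD n) (S.summandD_finite n) (X (.inr m)) = 0 := by
    ext β
    rw [coeff_locSum]
    refine finsum_eq_zero_of_forall_eq_zero fun p => ?_
    unfold summandD
    split_ifs
    · simp [mulBy, dz, MvPowerSeries.pderiv_X_of_ne]
    · simp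
  rw [derivD₀, LinearMap.add_apply, h, zero_add]
  change MvPowerSeries.pderiv ℝ _ _ = _
  split_ifs with hn
  · rw [hn, MvPowerSeries.pderiv_X_self]
  · exact MvPowerSeries.pderiv_X_of_ne (by simpa using Ne.symm hn)

open Classical in
theorem derivD₀_X_inl (n : NIdx d) (l : Option ℒ) (k : NIdx d →₀ ℕ) :
    S.derivD₀ n (X (.inl (l, k))) = if S.SubcritPair l (k + Finsupp.single n 1) then
      ((k n : ℝ) + 1) • X (.inl (l, k + Finsupp.single n 1)) else 0 := by
  have h0 : ∀ p, p ≠ (l, k) → S.summandD n p (X (.inl (l, k))) = 0 := by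
    intro p hp
    unfold summandD
    split_ifs
    · have : MvPowerSeries.pderiv ℝ (.inl p) (X (.inl (l, k)) : PS d ℒ) = 0 :=
        MvPowerSeries.pderiv_X_of_ne (by simpa using hp.symm)
      simp [dz, this]
    · simp
  have h : locSum (S.summandD n) (S.summandD_finite n) (X (.inl (l, k))) =
      S.summandD n (l, k) (X (.inl (l, k))) := by
    ext β
    rw [coeff_locSum]
    exact finsum_eq_single _ _ fun p hp => by rw [h0 p hp, map_zero]
  have h' : dz (.inr n) (X (.inl (l, k)) : PS d ℒ) = 0 :=
    MvPowerSeries.pderiv_X_of_ne (by simp)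
  rw [derivD₀, LinearMap.add_apply, h, h', add_zero, summandD]
  split_ifs
  · simp [dz, mulBy]
  · simp

theorem SubcritPair.mono {l : Option ℒ} {k k' : NIdx d →₀ ℕ} (h : S.SubcritPair l k')
    (hk : k ≤ k') : S.SubcritPair l k :=
  ⟨h.1, fun k'' h0 h1 => h.2 k'' h0 (h1.trans hk)⟩

/-- Both orders send `z_{(l,k)}` to a multiple of `z_{(l,k+e_n+e_m)}`. The truncation to subcritical
pairs does not break the symmetry, since subcriticality is inherited by smaller `k` and the
intermediate pair imposes no further condition. -/
theorem derivD₀_comm (n m : NIdx d) (π : PS d ℒ) :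
    S.derivD₀ n (S.derivD₀ m π) = S.derivD₀ m (S.derivD₀ n π) := by
  classical
  have h : S.derivD₀ n ∘ₗ S.derivD₀ m - S.derivD₀ m ∘ₗ S.derivD₀ n = 0 := by
    refine ((S.isDeriv_derivD₀ n).commutator (S.isDeriv_derivD₀ m)).eq_zero
      (((S.finDep_derivD₀ n).comp (S.finDep_derivD₀ m)).sub
        ((S.finDep_derivD₀ m).comp (S.finDep_derivD₀ n))) ?_
    have main : ∀ (n m : NIdx d) l k, S.derivD₀ n (S.derivD₀ m (X (.inl (l, k)))) =
        if S.SubcritPair l (k + Finsupp.single m 1 + Finsupp.single n 1) then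
          (((k m : ℝ) + 1) * ((k + Finsupp.single m 1 : NIdx d →₀ ℕ) n + 1 : ℝ)) •
            X (.inl (l, k + Finsupp.single m 1 + Finsupp.single n 1)) else 0 := by
      intro n m l k
      rw [derivD₀_X_inl]
      split_ifs with h1 h2 h2
      · rw [map_smul, derivD₀_X_inl, if_pos h2, smul_smul]
      · rw [map_smul, derivD₀_X_inl, if_neg h2, smul_zero]
      · exact absurd (SubcritPair.mono S h2 le_self_add) h1
      · rw [map_zero]
    rintro (⟨l, k⟩ | j)
    · rw [LinearMap.sub_apply, LinearMap.comp_apply, LinearMap.comp_apply, main, main,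
        add_right_comm k (Finsupp.single n 1), sub_eq_zero]
      refine if_congr Iff.rfl ?_ rfl
      congr 1
      by_cases e : n = m
      · rw [e]
      · simp [e, Ne.symm e]; ring
    · simp only [LinearMap.sub_apply, LinearMap.comp_apply, derivD₀_X_inr]
      split_ifs <;> simp [(S.isDeriv_derivD₀ _).map_one]
  have h1 := LinearMap.congr_fun h π
  simpa [sub_eq_zero] using h1

theorem derivX₀_eq_sum {i : Fin d} {π : PS d ℒ} (F : Finset (NIdx d))
    (h : ∀ n ∉ F, S.derivD₀ n π = 0) :
    S.derivX₀ i π =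
      ∑ n ∈ F, ((n i : ℝ) + 1) • (X (.inr (n + Finsupp.single i 1)) * S.derivD₀ n π) := by
  ext β
  rw [derivX₀, coeff_locSum, map_sum]
  refine finsum_eq_sum_of_support_subset _ fun n hn => ?_
  by_contra hF
  exact hn (by simp [h n hF])

theorem derivX₀_X_inr (i : Fin d) (m : NIdx d) :
    S.derivX₀ i (X (.inr m)) = ((m i : ℝ) + 1) • X (.inr (m + Finsupp.single i 1)) := by
  classical
  rw [S.derivX₀_eq_sum {m} fun n hn => by
    rw [derivD₀_X_inr, if_neg (by simpa using hn)]]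
  simp [derivD₀_X_inr]

/-- Subcriticality of `(l, k+e_n)` forces `|n| < η`, so one finite index set serves for all `(l,k)`.
-/
theorem derivX₀_X_inl (i : Fin d) (l : Option ℒ) (k : NIdx d →₀ ℕ) :
    S.derivX₀ i (X (.inl (l, k))) = ∑ n ∈ (S.sdeg_lt_finite S.eta).toFinset,
      ((n i : ℝ) + 1) •
        (X (.inr (n + Finsupp.single i 1)) * S.derivD₀ n (X (.inl (l, k)))) := by
  classical
  refine S.derivX₀_eq_sum _ fun n hn => ?_
  rw [derivD₀_X_inl, if_neg fun h => hn (by simpa using S.sdeg_lt_eta h)]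

theorem derivX₀_derivD₀_X_inl (i : Fin d) (m : NIdx d) (l : Option ℒ) (k : NIdx d →₀ ℕ) :
    S.derivX₀ i (S.derivD₀ m (X (.inl (l, k)))) = ∑ n ∈ (S.sdeg_lt_finite S.eta).toFinset,
      ((n i : ℝ) + 1) •
        (X (.inr (n + Finsupp.single i 1)) * S.derivD₀ n (S.derivD₀ m (X (.inl (l, k))))) := by
  classical
  rw [derivD₀_X_inl]
  split_ifs
  · simp only [map_smul, derivX₀_X_inl, mul_smul_comm, Finset.smul_sum]
    exact Finset.sum_congr rfl fun n _ => smul_comm _ _ _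
  · simp

/-- On `z_{(l,k)}` the Leibniz rule splits the composition into a single sum, where `∂_i` hits the
coefficient `z_{m+e_j}`, and a double sum with two derivations. Each is symmetric in `i` and `j`,
the second because the `D^{(n)}` commute. -/
theorem derivX₀_comm (i j : Fin d) (π : PS d ℒ) :
    S.derivX₀ i (S.derivX₀ j π) = S.derivX₀ j (S.derivX₀ i π) := by
  classical
  have h : S.derivX₀ i ∘ₗ S.derivX₀ j - S.derivX₀ j ∘ₗ S.derivX₀ i = 0 := by
    refine ((S.isDeriv_derivX₀ i).commutator (S.isDeriv_derivX₀ j)).eq_zero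
      (((S.finDep_derivX₀ i).comp (S.finDep_derivX₀ j)).sub
        ((S.finDep_derivX₀ j).comp (S.finDep_derivX₀ i))) ?_
    have coefs : ∀ (i j : Fin d) (m : NIdx d),
        ((m j : ℝ) + 1) * ((m + Finsupp.single j 1 : NIdx d) i + 1 : ℝ) =
        ((m i : ℝ) + 1) * ((m + Finsupp.single i 1 : NIdx d) j + 1 : ℝ) := by
      intro i j m
      by_cases e : i = j
      · rw [e]
      · simp [e, Ne.symm e]; ring
    rintro (⟨l, k⟩ | m)
    · have main : ∀ i j : Fin d, S.derivX₀ i (S.derivX₀ j (X (.inl (l, k)))) =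
          (∑ m ∈ (S.sdeg_lt_finite S.eta).toFinset,
            (((m j : ℝ) + 1) * ((m + Finsupp.single j 1 : NIdx d) i + 1 : ℝ)) •
              (X (.inr (m + Finsupp.single j 1 + Finsupp.single i 1)) *
                S.derivD₀ m (X (.inl (l, k))))) +
          ∑ m ∈ (S.sdeg_lt_finite S.eta).toFinset, ∑ n ∈ (S.sdeg_lt_finite S.eta).toFinset,
            (((m j : ℝ) + 1) * ((n i : ℝ) + 1)) • (X (.inr (m + Finsupp.single j 1)) *
              X (.inr (n + Finsupp.single i 1)) *
                S.derivD₀ n (S.derivD₀ m (X (.inl (l, k))))) := by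
        intro i j
        rw [derivX₀_X_inl, map_sum, ← Finset.sum_add_distrib]
        refine Finset.sum_congr rfl fun m _ => ?_
        rw [map_smul, S.isDeriv_derivX₀ i, derivX₀_X_inr, derivX₀_derivD₀_X_inl, smul_add,
          add_comm]
        congr 1
        · rw [mul_smul_comm, smul_smul, mul_comm (S.derivD₀ m _)]
        · rw [Finset.mul_sum, Finset.smul_sum]
          refine Finset.sum_congr rfl fun n _ => ?_
          rw [mul_smul_comm, smul_smul, mul_assoc]
      rw [LinearMap.sub_apply, LinearMap.comp_apply, LinearMap.comp_apply, main, main, sub_eq_zero]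
      congr 1
      · refine Finset.sum_congr rfl fun m _ => ?_
        rw [coefs, add_right_comm m]
      · rw [Finset.sum_comm]
        refine Finset.sum_congr rfl fun m _ => Finset.sum_congr rfl fun n _ => ?_
        rw [S.derivD₀_comm, mul_comm (X (.inr (m + Finsupp.single i 1)) : PS d ℒ),
          mul_comm ((m i : ℝ) + 1)]
    · simp only [LinearMap.sub_apply, LinearMap.comp_apply, derivX₀_X_inr, map_smul, smul_smul]
      rw [coefs, add_right_comm m, sub_self]
  have h1 := LinearMap.congr_fun h π
  simpa [sub_eq_zero] using h1

/-- The commutator comes only from `D^{(n)}` hitting a coefficient `z_{m+e_i}` of `∂_i`, which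
selects `m = n - e_i` with weight `m(i)+1 = n(i)`. For `n(i) = 0` the truncated subtraction is
harmless, since the weight vanishes. -/
theorem derivX₀_derivD₀ (i : Fin d) (n : NIdx d) (π : PS d ℒ) :
    S.derivX₀ i (S.derivD₀ n π) =
      S.derivD₀ n (S.derivX₀ i π) - (n i : ℝ) • S.derivD₀ (n - Finsupp.single i 1) π := by
  classical
  have h : (S.derivD₀ n ∘ₗ S.derivX₀ i - S.derivX₀ i ∘ₗ S.derivD₀ n) -
      (n i : ℝ) • S.derivD₀ (n - Finsupp.single i 1) = 0 := by
    refine IsDeriv.eq_zero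
      (((S.isDeriv_derivD₀ n).commutator (S.isDeriv_derivX₀ i)).sub
        ((S.isDeriv_derivD₀ _).smul _))
      ((((S.finDep_derivD₀ n).comp (S.finDep_derivX₀ i)).sub
        ((S.finDep_derivX₀ i).comp (S.finDep_derivD₀ n))).sub ((S.finDep_derivD₀ _).smul _)) ?_
    have hn : ∀ m : NIdx d, n = m + Finsupp.single i 1 ↔
        n i ≠ 0 ∧ n - Finsupp.single i 1 = m := by
      intro m
      constructor
      · rintro rfl
        simp
      · rintro ⟨h, rfl⟩
        refine (tsub_add_cancel_of_le ?_).symm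
        simpa [Nat.one_le_iff_ne_zero] using h
    rintro (⟨l, k⟩ | m)
    · simp only [LinearMap.sub_apply, LinearMap.comp_apply, LinearMap.smul_apply]
      rw [derivX₀_derivD₀_X_inl, derivX₀_X_inl, map_sum, ← Finset.sum_sub_distrib]
      have hterm : ∀ m : NIdx d,
          S.derivD₀ n (((m i : ℝ) + 1) •
            (X (.inr (m + Finsupp.single i 1)) * S.derivD₀ m (X (.inl (l, k))))) -
          ((m i : ℝ) + 1) • (X (.inr (m + Finsupp.single i 1)) *
            S.derivD₀ m (S.derivD₀ n (X (.inl (l, k))))) =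
          if n - Finsupp.single i 1 = m then (n i : ℝ) • S.derivD₀ m (X (.inl (l, k))) else 0 := by
        intro m
        rw [map_smul, S.isDeriv_derivD₀ n, S.derivD₀_comm n m, derivD₀_X_inr, ← smul_sub,
          add_sub_cancel_left]
        simp only [hn, mul_ite, mul_one, mul_zero]
        by_cases h1 : n - Finsupp.single i 1 = m
        · by_cases h2 : n i = 0
          · simp [h2]
          · rw [if_pos ⟨h2, h1⟩, if_pos h1, (hn m).mpr ⟨h2, h1⟩]
            simp
        · rw [if_neg fun h => h1 h.2, if_neg h1, smul_zero]
      rw [Finset.sum_congr rfl fun m _ => hterm m, Finset.sum_ite_eq, sub_eq_zero]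
      split_ifs with h1
      · rfl
      · rw [derivD₀_X_inl, if_neg fun h => h1 (by simpa using S.sdeg_lt_eta h), smul_zero]
    · simp only [LinearMap.sub_apply, LinearMap.comp_apply, LinearMap.smul_apply, derivX₀_X_inr,
        map_smul, derivD₀_X_inr, hn]
      by_cases h1 : n - Finsupp.single i 1 = m
      · by_cases h2 : n i = 0
        · simp [h1, h2, apply_ite (S.derivX₀ i), (S.isDeriv_derivX₀ i).map_one]
        · have h3 := (hn m).mpr ⟨h2, h1⟩
          have h4 : n i = m i + 1 := by rw [h3]; simp
          rw [if_pos ⟨h2, h1⟩, if_pos h1, h4, apply_ite (S.derivX₀ i),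
            (S.isDeriv_derivX₀ i).map_one, map_zero, ite_self]
          simp
      · rw [if_neg fun h => h1 h.2, if_neg h1, apply_ite (S.derivX₀ i),
          (S.isDeriv_derivX₀ i).map_one, map_zero, ite_self]
        simp
  have h1 := LinearMap.congr_fun h π
  simp only [LinearMap.sub_apply, LinearMap.comp_apply, LinearMap.smul_apply,
    LinearMap.zero_apply] at h1
  rw [sub_sub, add_comm, ← sub_sub, sub_eq_zero] at h1
  exact h1.symm

end Setting

/-! ### Removal of the projection, the brackets of the generators and the basis of `L`. -/

namespace Setting

variable {d : ℕ} {ℒ : Type*} (S : Setting d ℒ)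

open MvPowerSeries (coeff X)

/-- The monomial `z^β` occurs in the image of `z^γ` under `D^{(n)}`. -/
def StepD (n : NIdx d) (γ β : MIdx d ℒ) : Prop :=
  (∃ l k, S.SubcritPair l (k + Finsupp.single n 1) ∧ ∃ δ,
    β = δ + Finsupp.single (.inl (l, k + Finsupp.single n 1)) 1 ∧
    γ = δ + Finsupp.single (.inl (l, k)) 1) ∨ γ = β + Finsupp.single (.inr n) 1

theorem exists_stepD_of_coeff_derivD₀ {n : NIdx d} {π : PS d ℒ} {β : MIdx d ℒ}
    (h : coeff β (S.derivD₀ n π) ≠ 0) : ∃ γ, coeff γ π ≠ 0 ∧ S.StepD n γ β := by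
  rw [derivD₀, LinearMap.add_apply, map_add] at h
  by_cases h1 : coeff β (dz (.inr n) π) = 0
  · rw [h1, add_zero, coeff_locSum] at h
    obtain ⟨⟨l, k⟩, hp⟩ := exists_ne_of_fs h
    obtain ⟨hs, δ, rfl, hδ⟩ := S.summandD_coeff hp
    exact ⟨_, hδ, .inl ⟨l, k, hs, δ, rfl, rfl⟩⟩
  · have h3 : coeff β (MvPowerSeries.pderiv ℝ (.inr n) π) ≠ 0 := h1
    rw [MvPowerSeries.coeff_pderiv] at h3
    exact ⟨_, left_ne_zero_of_mul h3, .inr rfl⟩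

theorem exists_add_of_coeff_z_mul {γ β : MIdx d ℒ} {π : PS d ℒ} (h : coeff β (z γ * π) ≠ 0) :
    ∃ δ, β = γ + δ ∧ coeff δ π ≠ 0 := by
  classical
  rw [z, MvPowerSeries.coeff_monomial_mul] at h
  split_ifs at h with h1
  · exact ⟨β - γ, (add_tsub_cancel_of_le h1).symm, by simpa using h⟩
  · exact absurd rfl h

/-- A step lowers `[·]` by one, which `[δ] = 1` restores; it creates no polynomial variable, and the
pair it creates is subcritical. From `γ = e_m` a step can only lead to `β = 0`. -/
theorem add_mem_setNmin {n : NIdx d} {γ β δ : MIdx d ℒ} (hγ : γ ∈ S.setP ∪ S.setNmin)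
    (hδ : δ ∈ S.setNmin) (h : S.StepD n γ β) : δ + β ∈ S.setNmin := by
  classical
  obtain ⟨d1, d2, d3⟩ := hδ
  rcases hγ with ⟨m, rfl⟩ | ⟨g1, g2, g3⟩
  · rcases h with ⟨l, k, hs, ε, rfl, h⟩ | h
    · have := DFunLike.congr_fun h (.inl (l, k))
      simp at this
    · have hβ : β = 0 := by
        have h1 : β ≤ Finsupp.single (.inr m) 1 := le_self_add.trans_eq h.symm
        ext x
        have h2 := DFunLike.congr_fun h x
        have h3 := h1 x
        rw [Finsupp.add_apply] at h2
        by_cases hm : x = .inr m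
        · subst hm
          by_cases hn : n = m
          · subst hn
            simpa using h2
          · have h4 := DFunLike.congr_fun h (.inr n)
            simp [Ne.symm hn] at h4
        · rw [Finsupp.single_eq_of_ne hm] at h3
          exact Nat.le_zero.mp h3
      subst hβ
      rw [add_zero]
      exact ⟨d1, d2, d3⟩
  · rcases h with ⟨l, k, hs, ε, rfl, rfl⟩ | rfl
    · refine ⟨?_, ?_, ?_⟩
      · rw [bra_add, bra_inl] at g1
        rw [bra_add, bra_add, bra_inl, d1, len_add_single]
        push_cast
        linarith
      · intro l' k' h'
        by_cases e1 : δ (.inl (l', k')) = 0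
        · by_cases e2 : ε (.inl (l', k')) = 0
          · rw [Finsupp.add_apply, Finsupp.add_apply, e1, e2, zero_add, zero_add,
              Finsupp.single_apply_ne_zero] at h'
            obtain ⟨rfl, rfl⟩ : l' = l ∧ k' = k + Finsupp.single n 1 := by simpa using h'.1
            exact hs
          · exact g2 l' k' (by simp [e2])
        · exact d2 l' k' e1
      · intro m hm
        have h1 := g3 m hm
        simp at h1
        simp [d3 m hm, h1]
    · refine ⟨?_, ?_, ?_⟩
      · rw [bra_add, bra_inr] at g1
        rw [bra_add, d1]
        linarith
      · intro l' k' h'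
        by_cases e1 : δ (.inl (l', k')) = 0
        · refine g2 l' k' ?_
          simpa [e1] using h'
        · exact d2 l' k' e1
      · intro m hm
        have h1 := g3 m hm
        simp at h1
        simp [d3 m hm, h1.1]

/-- The coefficients `z_{n+e_i}` of `∂_i` are admissible because `|n+e_i| ≥ 𝔰_i ≥ reg_sol`. -/
theorem single_inr_mem_setNmin (n : NIdx d) (i : Fin d) :
    (Finsupp.single (.inr (n + Finsupp.single i 1)) 1 : MIdx d ℒ) ∈ S.setNmin := by
  classical
  refine ⟨bra_inr _, ?_, ?_⟩
  · intro l k h'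
    simp at h'
  · intro m hm
    rw [Finsupp.single_apply_eq_zero]
    intro e
    obtain rfl : m = n + Finsupp.single i 1 := by simpa using e
    rw [sdeg_add, sdeg_single] at hm
    linarith [S.sdeg_nonneg n, S.regSol_le_scaling i]

/-- The generators before the projection. -/
noncomputable def genEnd₀ : S.M ⊕ Fin d → Module.End ℝ (PS d ℒ)
  | .inl (γ, n) => mulBy (z γ.1) ∘ₗ S.derivD₀ n
  | .inr i => S.derivX₀ i

theorem genEnd_eq (x : S.M ⊕ Fin d) :
    S.genEnd x = S.genEnd₀ x ∘ₗ proj (S.setP ∪ S.setNmin) := by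
  rcases x with ⟨γ, n⟩ | i
  · rfl
  · exact S.derivX_eq i

theorem proj_mem (V : Set (MIdx d ℒ)) (π : PS d ℒ) : proj V π ∈ TStar V := by
  classical
  intro β hβ
  change (if β ∈ V then coeff β π else 0) = 0
  rw [if_neg hβ]

theorem proj_eq_self {V : Set (MIdx d ℒ)} {π : PS d ℒ} (h : π ∈ TStar V) : proj V π = π := by
  classical
  ext β
  change (if β ∈ V then coeff β π else 0) = coeff β π
  split_ifs with hβ
  · rfl
  · exact (h β hβ).symm

theorem proj_z {V : Set (MIdx d ℒ)} {γ : MIdx d ℒ} (h : γ ∈ V) : proj V (z γ) = z γ :=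
  proj_eq_self fun β hβ => by
    by_contra h'
    exact hβ (coeff_z_ne h' ▸ h)

theorem genEnd₀_mem (x : S.M ⊕ Fin d) {π : PS d ℒ} (hπ : π ∈ TStar (S.setP ∪ S.setNmin)) :
    S.genEnd₀ x π ∈ TStar (S.setP ∪ S.setNmin) := by
  intro β hβ
  by_contra h
  have hmem : ∀ γ, coeff γ π ≠ 0 → γ ∈ S.setP ∪ S.setNmin := fun γ h1 => by
    by_contra h2
    exact h1 (hπ γ h2)
  refine hβ (.inr ?_)
  rcases x with ⟨γ, n⟩ | i
  · obtain ⟨δ, rfl, hδ⟩ := exists_add_of_coeff_z_mul h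
    obtain ⟨ε, hε, hs⟩ := S.exists_stepD_of_coeff_derivD₀ hδ
    exact S.add_mem_setNmin (hmem ε hε) γ.2.1 hs
  · change coeff β (S.derivX₀ i π) ≠ 0 at h
    rw [derivX₀, coeff_locSum] at h
    obtain ⟨n, hn⟩ := exists_ne_of_fs h
    simp only [LinearMap.smul_apply, LinearMap.comp_apply, map_smul, smul_eq_mul] at hn
    obtain ⟨δ, rfl, hδ⟩ := exists_add_of_coeff_z_mul (right_ne_zero_of_mul hn)
    obtain ⟨ε, hε, hs⟩ := S.exists_stepD_of_coeff_derivD₀ hδ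
    exact S.add_mem_setNmin (hmem ε hε) (S.single_inr_mem_setNmin n i) hs

/-- The inner projection acts as the identity on the image of `genEnd₀ y`. Brackets of generators
are thus brackets of genuine derivations applied to a projected series. -/
theorem genEnd_genEnd (x y : S.M ⊕ Fin d) (π : PS d ℒ) :
    S.genEnd x (S.genEnd y π) =
      S.genEnd₀ x (S.genEnd₀ y (proj (S.setP ∪ S.setNmin) π)) := by
  rw [genEnd_eq, genEnd_eq, LinearMap.comp_apply, LinearMap.comp_apply,
    proj_eq_self (S.genEnd₀_mem y (proj_mem _ π))]

theorem genEnd_z (x : S.M ⊕ Fin d) (γ : S.setN) : S.genEnd x (z γ.1) = S.genEnd₀ x (z γ.1) := by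
  rw [genEnd_eq, LinearMap.comp_apply, proj_z (.inr γ.2.1)]

/-- The second-order terms `z^γ z^{γ'} D^{(n)} D^{(n')}` cancel because the `D^{(n)}` commute; what
is left are the terms where one generator differentiates the monomial of the other. -/
theorem lie_inl_inl (γ γ' : S.setN) (n n' : NIdx d) :
    ⁅S.gen (.inl (γ', n')), S.gen (.inl (γ, n))⁆ =
      S.mulD n (S.actN (S.gen (.inl (γ', n'))) (S.zN γ)) -
        S.mulD n' (S.actN (S.gen (.inl (γ, n))) (S.zN γ')) := by
  apply Subtype.ext
  refine LinearMap.ext fun π => ?_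
  change S.genEnd (.inl (γ', n')) (S.genEnd (.inl (γ, n)) π) -
      S.genEnd (.inl (γ, n)) (S.genEnd (.inl (γ', n')) π) =
    S.genEnd (.inl (γ', n')) (z γ.1) * S.derivD n π -
      S.genEnd (.inl (γ, n)) (z γ'.1) * S.derivD n' π
  rw [genEnd_genEnd, genEnd_genEnd, genEnd_z, genEnd_z, derivD_eq, derivD_eq,
    LinearMap.comp_apply, LinearMap.comp_apply]
  generalize proj (S.setP ∪ S.setNmin) π = ρ
  change z γ'.1 * S.derivD₀ n' (z γ.1 * S.derivD₀ n ρ) -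
      z γ.1 * S.derivD₀ n (z γ'.1 * S.derivD₀ n' ρ) =
    z γ'.1 * S.derivD₀ n' (z γ.1) * S.derivD₀ n ρ -
      z γ.1 * S.derivD₀ n (z γ'.1) * S.derivD₀ n' ρ
  rw [S.isDeriv_derivD₀ n', S.isDeriv_derivD₀ n, S.derivD₀_comm n' n]
  ring

theorem lie_inr_inl (i : Fin d) (γ : S.setN) (n : NIdx d) :
    ⁅S.gen (.inr i), S.gen (.inl (γ, n))⁆ =
      S.mulD n (S.actN (S.gen (.inr i)) (S.zN γ)) -
        (n i : ℝ) • S.gen (.inl (γ, n - Finsupp.single i 1)) := by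
  apply Subtype.ext
  refine LinearMap.ext fun π => ?_
  change S.genEnd (.inr i) (S.genEnd (.inl (γ, n)) π) -
      S.genEnd (.inl (γ, n)) (S.genEnd (.inr i) π) =
    S.genEnd (.inr i) (z γ.1) * S.derivD n π -
      (n i : ℝ) • (z γ.1 * S.derivD (n - Finsupp.single i 1) π)
  rw [genEnd_genEnd, genEnd_genEnd, genEnd_z, derivD_eq, derivD_eq,
    LinearMap.comp_apply, LinearMap.comp_apply]
  generalize proj (S.setP ∪ S.setNmin) π = ρ
  change S.derivX₀ i (z γ.1 * S.derivD₀ n ρ) - z γ.1 * S.derivD₀ n (S.derivX₀ i ρ) =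
    S.derivX₀ i (z γ.1) * S.derivD₀ n ρ -
      (n i : ℝ) • (z γ.1 * S.derivD₀ (n - Finsupp.single i 1) ρ)
  rw [S.isDeriv_derivX₀ i, S.derivX₀_derivD₀, mul_sub, mul_smul_comm]
  ring

theorem lie_inr_inr (i j : Fin d) : ⁅S.gen (.inr i), S.gen (.inr j)⁆ = 0 := by
  apply Subtype.ext
  refine LinearMap.ext fun π => ?_
  change S.genEnd (.inr i) (S.genEnd (.inr j) π) - S.genEnd (.inr j) (S.genEnd (.inr i) π) = 0
  rw [genEnd_genEnd, genEnd_genEnd, sub_eq_zero]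
  exact S.derivX₀_comm i j _

theorem span_range_zN : Submodule.span ℝ (Set.range S.zN) = ⊤ := by
  rw [eq_top_iff]
  rintro ⟨π, hπ⟩ -
  have h : S.polyN ≤ (Submodule.span ℝ (Set.range S.zN)).map S.polyN.subtype := by
    refine Submodule.span_le.mpr ?_
    rintro _ ⟨γ, hγ, rfl⟩
    exact ⟨S.zN ⟨γ, hγ⟩, Submodule.subset_span ⟨_, rfl⟩, rfl⟩
  obtain ⟨y, hy, hyx⟩ := h hπ
  have e : y = ⟨π, hπ⟩ := Subtype.ext hyx
  exact e ▸ hy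

theorem mulD_mem_span (n : NIdx d) (π : S.polyN) :
    S.mulD n π ∈ Submodule.span ℝ (Set.range S.gen) := by
  have h : (Submodule.span ℝ (Set.range S.zN)).map (S.mulD n) ≤
      Submodule.span ℝ (Set.range S.gen) := by
    rw [Submodule.map_span_le]
    rintro _ ⟨γ, rfl⟩
    exact Submodule.subset_span ⟨.inl (γ, n), rfl⟩
  exact h ⟨π, by rw [span_range_zN]; trivial, rfl⟩

theorem lie_gen_mem_span (x y : S.M ⊕ Fin d) :
    ⁅S.gen x, S.gen y⁆ ∈ Submodule.span ℝ (Set.range S.gen) := by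
  have key : ∀ (i : Fin d) (p : S.M),
      ⁅S.gen (.inr i), S.gen (.inl p)⁆ ∈ Submodule.span ℝ (Set.range S.gen) := by
    rintro i ⟨γ, n⟩
    rw [lie_inr_inl]
    exact Submodule.sub_mem _ (S.mulD_mem_span _ _)
      (Submodule.smul_mem _ _ (Submodule.subset_span ⟨_, rfl⟩))
  rcases x with ⟨γ, n⟩ | i <;> rcases y with ⟨γ', n'⟩ | j
  · rw [lie_inl_inl]
    exact Submodule.sub_mem _ (S.mulD_mem_span _ _) (S.mulD_mem_span _ _)
  · rw [← lie_skew]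
    exact Submodule.neg_mem _ (key j _)
  · exact key i _
  · rw [lie_inr_inr]
    exact Submodule.zero_mem _

theorem span_range_gen : Submodule.span ℝ (Set.range S.gen) = ⊤ := by
  let W : LieSubalgebra ℝ S.L :=
    { Submodule.span ℝ (Set.range S.gen) with
      lie_mem' := by
        intro x y hx hy
        change ⁅x, y⁆ ∈ Submodule.span ℝ (Set.range S.gen)
        induction hx, hy using Submodule.span_induction₂ with
        | mem_mem x y hx hy =>
          obtain ⟨x, rfl⟩ := hx
          obtain ⟨y, rfl⟩ := hy
          exact S.lie_gen_mem_span x y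
        | zero_left y hy => rw [zero_lie]; exact Submodule.zero_mem _
        | zero_right x hx => rw [lie_zero]; exact Submodule.zero_mem _
        | add_left x y z _ _ _ h h' => rw [add_lie]; exact Submodule.add_mem _ h h'
        | add_right x y z _ _ _ h h' => rw [lie_add]; exact Submodule.add_mem _ h h'
        | smul_left c x y _ _ h => rw [smul_lie]; exact Submodule.smul_mem _ c h
        | smul_right c x y _ _ h => rw [lie_smul]; exact Submodule.smul_mem _ c h }
  have hW : S.L ≤ W.map S.L.incl := by
    refine LieSubalgebra.lieSpan_le.mpr ?_
    rintro _ ⟨x, rfl⟩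
    exact ⟨S.gen x, Submodule.subset_span ⟨x, rfl⟩, rfl⟩
  rw [eq_top_iff]
  rintro x -
  obtain ⟨y, hy, hxy⟩ := hW x.2
  have e : y = x := Subtype.ext hxy
  exact e ▸ hy

theorem genEnd_inl_z (γ : S.setN) (n m : NIdx d) [Decidable (n = m)] :
    S.genEnd (.inl (γ, n)) (z (Finsupp.single (.inr m) 1)) = if n = m then z γ.1 else 0 := by
  classical
  rw [genEnd_eq, LinearMap.comp_apply, proj_z (.inl ⟨m, rfl⟩)]
  change z γ.1 * S.derivD₀ n (X (.inr m)) = _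
  rw [derivD₀_X_inr]
  split_ifs <;> simp

theorem genEnd_inr_z (i : Fin d) (m : NIdx d) :
    S.genEnd (.inr i) (z (Finsupp.single (.inr m) 1)) =
      ((m i : ℝ) + 1) • z (Finsupp.single (.inr (m + Finsupp.single i 1)) 1) := by
  rw [genEnd_eq, LinearMap.comp_apply, proj_z (.inl ⟨m, rfl⟩)]
  exact S.derivX₀_X_inr i m

open Classical in
theorem coeff_z (β γ : MIdx d ℒ) : coeff β (z γ : PS d ℒ) = if β = γ then 1 else 0 := by
  rw [z, MvPowerSeries.coeff_monomial]

theorem ne_single_inr (γ : S.setN) (m : NIdx d) : γ.1 ≠ Finsupp.single (.inr m) 1 := fun h => by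
  have h1 := γ.2.2
  rw [h, noise_inr] at h1
  exact lt_irrefl _ h1

/-- Dual functionals are obtained from `z^γ D^{(n)} z_m = δ_{nm} z^γ` and `∂_i z_0 = z_{e_i}`. The
two kinds of generators do not mix, since `γ ∈ 𝒩` contains a noise and is never of the form `e_m`.
-/
theorem linearIndependent_gen : LinearIndependent ℝ S.gen := by
  classical
  let ev : PS d ℒ → MIdx d ℒ → Module.Dual ℝ S.L := fun π β =>
    coeff β ∘ₗ LinearMap.applyₗ π ∘ₗ (S.L.incl : S.L →ₗ[ℝ] Module.End ℝ (PS d ℒ))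
  let φ : S.M ⊕ Fin d → Module.Dual ℝ S.L := fun x =>
    match x with
    | .inl (γ, n) => ev (z (Finsupp.single (.inr n) 1)) γ.1
    | .inr i => ev (z (Finsupp.single (.inr 0) 1)) (Finsupp.single (.inr (Finsupp.single i 1)) 1)
  have hev : ∀ π β x, ev π β (S.gen x) = coeff β (S.genEnd x π) := fun _ _ _ => rfl
  refine LinearIndependent.of_pairwise_dual_eq_zero_one S.gen φ ?_ ?_
  · rintro (⟨γ, n⟩ | i) (⟨γ', n'⟩ | j) hne
    · simp only [φ]
      rw [hev, genEnd_inl_z]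
      split_ifs with h
      · rw [coeff_z, if_neg]
        rintro h'
        exact hne (by rw [h, Subtype.ext h'])
      · rw [map_zero]
    · simp only [φ]
      rw [hev, genEnd_inr_z, map_smul, coeff_z, if_neg (S.ne_single_inr γ _), smul_zero]
    · simp only [φ]
      rw [hev, genEnd_inl_z]
      split_ifs with h
      · rw [coeff_z, if_neg (S.ne_single_inr γ' _).symm]
      · rw [map_zero]
    · simp only [φ]
      rw [hev, genEnd_inr_z, map_smul, coeff_z, if_neg, smul_zero]
      intro h
      have h' : (Finsupp.single i 1 : NIdx d) = Finsupp.single j 1 := by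
        simpa [Finsupp.single_left_inj] using h
      exact hne (by rw [(Finsupp.single_left_inj one_ne_zero).mp h'])
  · rintro (⟨γ, n⟩ | i)
    · simp only [φ]
      rw [hev, genEnd_inl_z, if_pos rfl, coeff_z, if_pos rfl]
    · simp only [φ]
      rw [hev, genEnd_inr_z, map_smul, coeff_z, zero_add, if_pos rfl]
      simp

/-- The basis of `L` given by the generators. -/
noncomputable def genBasis : Module.Basis (S.M ⊕ Fin d) ℝ S.L :=
  Module.Basis.mk S.linearIndependent_gen S.span_range_gen.ge

theorem genBasis_apply (x : S.M ⊕ Fin d) : S.genBasis x = S.gen x :=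
  Module.Basis.mk_apply _ _ x

theorem linearIndependent_zN : LinearIndependent ℝ S.zN := by
  classical
  refine LinearIndependent.of_pairwise_dual_eq_zero_one S.zN
    (fun γ => coeff γ.1 ∘ₗ S.polyN.subtype) ?_ ?_
  · intro γ γ' hne
    change coeff γ.1 (z γ'.1) = 0
    rw [coeff_z, if_neg fun h => hne (Subtype.ext h)]
  · intro γ
    change coeff γ.1 (z γ.1) = 1
    rw [coeff_z, if_pos rfl]

/-- The monomials `z^γ`, `γ ∈ 𝒩`, form a basis of their span. -/
noncomputable def zBasis : Module.Basis S.setN ℝ S.polyN :=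
  Module.Basis.mk S.linearIndependent_zN S.span_range_zN.ge

theorem zBasis_apply (γ : S.setN) : S.zBasis γ = S.zN γ :=
  Module.Basis.mk_apply _ _ γ

theorem mulD_zN (n : NIdx d) (γ : S.setN) : S.mulD n (S.zN γ) = S.gen (.inl (γ, n)) := rfl

theorem polyN_induction {p : S.polyN → Prop} (mem : ∀ γ, p (S.zN γ))
    (zero : p 0) (add : ∀ π π', p π → p π' → p (π + π')) (smul : ∀ (c : ℝ) π, p π → p (c • π))
    (π : S.polyN) : p π := by
  have h : π ∈ Submodule.span ℝ (Set.range S.zN) := by rw [span_range_zN]; trivial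
  induction h using Submodule.span_induction with
  | mem x h => obtain ⟨γ, rfl⟩ := h; exact mem γ
  | zero => exact zero
  | add x y _ _ h h' => exact add x y h h'
  | smul c x _ h => exact smul c x h

theorem actN_add (D D' : S.L) (π : S.polyN) : S.actN (D + D') π = S.actN D π + S.actN D' π := rfl

theorem actN_smul (c : ℝ) (D : S.L) (π : S.polyN) : S.actN (c • D) π = c • S.actN D π := rfl

theorem actN_lie (D D' : S.L) (π : S.polyN) :
    S.actN ⁅D, D'⁆ π = S.actN D (S.actN D' π) - S.actN D' (S.actN D π) := rfl

theorem lie_mulD_mulD (n n' : NIdx d) (π π' : S.polyN) :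
    ⁅S.mulD n' π', S.mulD n π⁆ =
      S.mulD n (S.actN (S.mulD n' π') π) - S.mulD n' (S.actN (S.mulD n π) π') := by
  induction π using S.polyN_induction with
  | mem γ =>
    induction π' using S.polyN_induction with
    | mem γ' => exact S.lie_inl_inl γ γ' n n'
    | zero => simp [show S.actN 0 (S.zN γ) = 0 from rfl]
    | add π π' h h' => simp only [map_add, add_lie, h, h', actN_add]; abel
    | smul c π h => simp only [map_smul, smul_lie, h, actN_smul, smul_sub]
  | zero => simp [show S.actN 0 π' = 0 from rfl]
  | add π π' h h' => simp only [map_add, lie_add, h, h', actN_add]; abel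
  | smul c π h => simp only [map_smul, lie_smul, h, actN_smul, smul_sub]

theorem lie_inr_mulD (i : Fin d) (n : NIdx d) (π : S.polyN) :
    ⁅S.gen (.inr i), S.mulD n π⁆ =
      S.mulD n (S.actN (S.gen (.inr i)) π) -
        (n i : ℝ) • S.mulD (n - Finsupp.single i 1) π := by
  induction π using S.polyN_induction with
  | mem γ => exact S.lie_inr_inl i γ n
  | zero => simp
  | add π π' h h' => simp only [map_add, lie_add, h, h', smul_add]; abel
  | smul c π h =>
    simp only [map_smul, lie_smul, h, smul_sub]
    rw [smul_comm]

end Setting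

/-! ### Factorials of multi-indices. -/

section Factorials

variable {I : Type*}

theorem mfact_pos (m : I →₀ ℕ) : 0 < mfact m := Finset.prod_pos fun _ _ => Nat.factorial_pos _

theorem mfact_ne_zero (m : I →₀ ℕ) : (mfact m : ℝ) ≠ 0 := Nat.cast_ne_zero.mpr (mfact_pos m).ne'

@[simp] theorem mfact_zero : mfact (0 : I →₀ ℕ) = 1 := rfl

theorem mfact_add_single (m : I →₀ ℕ) (x : I) :
    mfact (m + Finsupp.single x 1) = (m x + 1) * mfact m := by
  classical
  have e1 : mfact (m + Finsupp.single x 1) =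
      ∏ i ∈ insert x m.support, ((m + Finsupp.single x 1 : I →₀ ℕ) i).factorial :=
    Finsupp.prod_of_support_subset _ (by
      intro i hi
      by_contra h
      simp only [Finset.mem_insert, Finsupp.mem_support_iff, not_or, not_not] at h
      simp [h.2, Finsupp.single_eq_of_ne h.1] at hi) _ (by simp)
  have e2 : mfact m = ∏ i ∈ insert x m.support, (m i).factorial :=
    Finsupp.prod_of_support_subset _ (Finset.subset_insert _ _) _ (by simp)
  rw [e1, e2, ← Finset.mul_prod_erase _ _ (Finset.mem_insert_self x _),
    ← Finset.mul_prod_erase _ (fun i => (m i).factorial) (Finset.mem_insert_self x _)]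
  rw [Finset.prod_congr rfl fun i hi => by
    rw [Finsupp.add_apply, Finsupp.single_eq_of_ne (Finset.ne_of_mem_erase hi), add_zero]]
  rw [Finsupp.add_apply, Finsupp.single_eq_same, Nat.factorial_succ, mul_assoc]

theorem mfact_eq_mul {m : I →₀ ℕ} {x : I} (h : Finsupp.single x 1 ≤ m) :
    mfact m = m x * mfact (m - Finsupp.single x 1) := by
  have e := mfact_add_single (m - Finsupp.single x 1) x
  rw [tsub_add_cancel_of_le h] at e
  rw [e]
  congr 1
  have := h x
  simp at this ⊢
  omega

theorem single_one_le_iff {m : I →₀ ℕ} {x : I} : Finsupp.single x 1 ≤ m ↔ m x ≠ 0 := by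
  rw [Finsupp.single_le_iff, Nat.one_le_iff_ne_zero]

end Factorials

/-! ### The representation of `L` on polynomials, symbols, and commutation of the maps `U ↦ z^γ U
D^{(n)}`. -/

namespace Setting

variable {d : ℕ} {ℒ : Type*} (S : Setting d ℒ)

open MvPolynomial (X)

/-- The polynomials in the coordinates of the second kind. -/
abbrev Poly : Type _ := MvPolynomial (S.M ⊕ Fin d) ℝ

theorem poly_induction {p : S.Poly → Prop} (one : p 1) (add : ∀ f g, p f → p g → p (f + g))
    (smul : ∀ (c : ℝ) f, p f → p (c • f)) (inl : ∀ x f, p f → p (X (.inl x) * f))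
    (inr : ∀ i f, p f → p (X (.inr i) * f)) (f : S.Poly) : p f := by
  induction f using MvPolynomial.induction_on with
  | C a =>
    have e : (MvPolynomial.C a : S.Poly) = a • 1 := by rw [MvPolynomial.smul_eq_C_mul, mul_one]
    exact e ▸ smul a 1 one
  | add f g hf hg => exact add f g hf hg
  | mul_X f x hf =>
    rw [mul_comm]
    rcases x with x | i
    · exact inl x f hf
    · exact inr i f hf

/-- The element `π D^{(n)}` of the polynomial algebra, linear in `π`. -/
noncomputable def Zlin (n : NIdx d) : S.polyN →ₗ[ℝ] S.Poly :=
  S.zBasis.constr ℝ fun γ => X (.inl (γ, n))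

theorem Zlin_zN (n : NIdx d) (γ : S.setN) : S.Zlin n (S.zN γ) = X (.inl (γ, n)) := by
  rw [← zBasis_apply]
  exact S.zBasis.constr_basis ℝ _ γ

/-- The derivation of the polynomial algebra that extends the action on `polyN`. -/
noncomputable def polyDer (D : S.L) : Derivation ℝ S.Poly S.Poly :=
  MvPolynomial.mkDerivation ℝ (Sum.elim (fun x => S.Zlin x.2 (S.actN D (S.zN x.1))) 0)

theorem polyDer_X_inl (D : S.L) (x : S.M) :
    S.polyDer D (X (.inl x)) = S.Zlin x.2 (S.actN D (S.zN x.1)) := by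
  simp [polyDer]

theorem polyDer_X_inr (D : S.L) (i : Fin d) : S.polyDer D (X (.inr i)) = 0 := by
  simp [polyDer]

theorem polyDer_Zlin (D : S.L) (n : NIdx d) (π : S.polyN) :
    S.polyDer D (S.Zlin n π) = S.Zlin n (S.actN D π) := by
  induction π using S.polyN_induction with
  | mem γ => rw [Zlin_zN, polyDer_X_inl]
  | zero => simp
  | add π π' h h' => simp only [map_add, h, h']
  | smul c π h => simp only [map_smul, Derivation.map_smul, h]

theorem polyDer_add (D D' : S.L) : S.polyDer (D + D') = S.polyDer D + S.polyDer D' := by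
  refine MvPolynomial.derivation_ext fun x => ?_
  rcases x with x | i
  · simp [polyDer_X_inl, actN_add]
  · simp [polyDer_X_inr]

theorem polyDer_smul (c : ℝ) (D : S.L) : S.polyDer (c • D) = c • S.polyDer D := by
  refine MvPolynomial.derivation_ext fun x => ?_
  rcases x with x | i
  · simp [polyDer_X_inl, actN_smul]
  · simp [polyDer_X_inr]

theorem polyDer_lie (D D' : S.L) : S.polyDer ⁅D, D'⁆ = ⁅S.polyDer D, S.polyDer D'⁆ := by
  refine MvPolynomial.derivation_ext fun x => ?_
  rcases x with x | i
  · simp [Derivation.commutator_apply, polyDer_X_inl, actN_lie, polyDer_Zlin]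
  · simp [Derivation.commutator_apply, polyDer_X_inr]

/-- The translation of the variables `∂_i` by formal parameters. -/
noncomputable def taylor : S.Poly →ₐ[ℝ] MvPowerSeries (Fin d) S.Poly :=
  MvPolynomial.aeval (Sum.elim (fun x => MvPowerSeries.C (X (.inl x)))
    fun i => MvPowerSeries.C (X (.inr i)) + MvPowerSeries.X i)

/-- The exponential generating series of `n ↦ π D^{(n)}`. -/
noncomputable def Zser (π : S.polyN) : MvPowerSeries (Fin d) S.Poly :=
  fun j => (mfact j : ℝ)⁻¹ • S.Zlin j π

theorem coeff_Zser (π : S.polyN) (j : NIdx d) :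
    MvPowerSeries.coeff j (S.Zser π) = (mfact j : ℝ)⁻¹ • S.Zlin j π := rfl

/-- The normal-ordered left multiplication by `π D^{(n)}`. -/
noncomputable def normMul (n : NIdx d) : S.polyN →ₗ[ℝ] S.Poly →ₗ[ℝ] S.Poly :=
  LinearMap.mk₂ ℝ
    (fun π f => (mfact n : ℝ) • MvPowerSeries.coeff n (S.Zser π * S.taylor f))
    (fun π π' f => by
      have e : S.Zser (π + π') = S.Zser π + S.Zser π' := by
        ext1 j; simp [coeff_Zser]
      rw [e, add_mul, map_add, smul_add])
    (fun c π f => by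
      have e : S.Zser (c • π) = c • S.Zser π := by
        ext1 j
        change (mfact j : ℝ)⁻¹ • S.Zlin j (c • π) = c • ((mfact j : ℝ)⁻¹ • S.Zlin j π)
        rw [map_smul, smul_comm]
      rw [e, smul_mul_assoc, smul_comm]
      rfl)
    (fun π f f' => by rw [map_add, mul_add, map_add, smul_add])
    (fun c π f => by
      rw [map_smul, mul_smul_comm, smul_comm]
      rfl)

theorem normMul_apply (n : NIdx d) (π : S.polyN) (f : S.Poly) :
    S.normMul n π f = (mfact n : ℝ) • MvPowerSeries.coeff n (S.Zser π * S.taylor f) := rfl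

theorem normMul_one (n : NIdx d) (π : S.polyN) : S.normMul n π 1 = S.Zlin n π := by
  rw [normMul_apply, map_one, mul_one, coeff_Zser, smul_smul, mul_inv_cancel₀ (mfact_ne_zero n),
    one_smul]

theorem normMul_X_inl (n : NIdx d) (π : S.polyN) (x : S.M) (f : S.Poly) :
    S.normMul n π (X (.inl x) * f) = X (.inl x) * S.normMul n π f := by
  have e : S.taylor (X (.inl x)) = MvPowerSeries.C (X (.inl x)) := by simp [taylor]
  rw [normMul_apply, normMul_apply, map_mul S.taylor, e, mul_left_comm, MvPowerSeries.coeff_C_mul,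
    mul_smul_comm]

/-- This is the rule `D^{(n)} ∂_i = ∂_i D^{(n)} + n(i) D^{(n-e_i)}` with `π` kept on the left. The
parameter that `taylor` adds to `∂_i` lowers the extracted coefficient by `e_i`, and `n! = n(i)
(n-e_i)!` supplies the factor. -/
theorem normMul_X_inr (n : NIdx d) (π : S.polyN) (i : Fin d) (f : S.Poly) :
    S.normMul n π (X (.inr i) * f) = X (.inr i) * S.normMul n π f +
      (n i : ℝ) • S.normMul (n - Finsupp.single i 1) π f := by
  classical
  have e : S.taylor (X (.inr i)) = MvPowerSeries.C (X (.inr i)) + MvPowerSeries.X i := by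
    simp [taylor]
  rw [normMul_apply, normMul_apply, normMul_apply, map_mul S.taylor, e, mul_left_comm, add_mul, map_add,
    MvPowerSeries.coeff_C_mul, smul_add, mul_smul_comm, MvPowerSeries.X,
    MvPowerSeries.coeff_monomial_mul]
  congr 1
  split_ifs with h
  · rw [one_mul, mfact_eq_mul h, smul_smul]
    push_cast
    rfl
  · have h0 : n i = 0 := by simpa [single_one_le_iff] using h
    simp [h0]

theorem normMul_Zlin (n m : NIdx d) (π π' : S.polyN) (f : S.Poly) :
    S.normMul n π (S.Zlin m π' * f) = S.Zlin m π' * S.normMul n π f := by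
  induction π' using S.polyN_induction with
  | mem γ => rw [Zlin_zN, normMul_X_inl]
  | zero => simp
  | add π π' h h' => simp only [map_add, add_mul, h, h']
  | smul c π h => simp only [map_smul, smul_mul_assoc, h]

/-- The induction has to run over all `n` and `n'` at once, since passing a variable `∂_i` lowers
these indices. -/
theorem normMul_comm (n n' : NIdx d) (π π' : S.polyN) (f : S.Poly) :
    S.normMul n π (S.normMul n' π' f) = S.normMul n' π' (S.normMul n π f) := by
  induction f using S.poly_induction generalizing n n' with
  | one =>
    have h := S.normMul_Zlin n n' π π' 1
    have h' := S.normMul_Zlin n' n π' π 1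
    rw [mul_one, normMul_one] at h h'
    rw [normMul_one, normMul_one, h, h', mul_comm]
  | add f g hf hg => simp only [map_add, hf, hg]
  | smul c f hf => simp only [map_smul, hf]
  | inl x f hf => simp only [normMul_X_inl, hf]
  | inr i f hf =>
    simp only [normMul_X_inr, map_add, map_smul, hf]
    exact add_right_comm _ _ _

/-- The derivation annihilates the variables `∂_i`, so it does not see the shift in `taylor` and
differentiates only `π` and the `z`-part of `f`. -/
theorem polyDer_normMul (D : S.L) (n : NIdx d) (π : S.polyN) (f : S.Poly) :
    S.polyDer D (S.normMul n π f) =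
      S.normMul n π (S.polyDer D f) + S.normMul n (S.actN D π) f := by
  induction f using S.poly_induction generalizing n with
  | one => simp [normMul_one, polyDer_Zlin]
  | add f g hf hg => simp only [map_add, hf, hg]; abel
  | smul c f hf => simp only [map_smul, Derivation.map_smul, hf, smul_add]
  | inl x f hf =>
    simp only [normMul_X_inl, Derivation.leibniz, smul_eq_mul, hf, map_add, polyDer_X_inl]
    rw [mul_comm f, normMul_Zlin]
    ring
  | inr i f hf =>
    simp only [normMul_X_inr, Derivation.leibniz, smul_eq_mul, hf, map_add, polyDer_X_inr,
      Derivation.map_smul, mul_zero, add_zero, smul_add]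
    ring

/-- The part of the representation of `L` on the polynomial algebra that creates new factors. -/
noncomputable def creation : S.L →ₗ[ℝ] Module.End ℝ S.Poly :=
  S.genBasis.constr ℝ
    (Sum.elim (fun x => S.normMul x.2 (S.zN x.1)) fun i => LinearMap.mulLeft ℝ (X (.inr i)))

theorem creation_inr (i : Fin d) (f : S.Poly) :
    S.creation (S.gen (.inr i)) f = X (.inr i) * f := by
  rw [← genBasis_apply, creation, S.genBasis.constr_basis]
  rfl

theorem creation_mulD (n : NIdx d) (π : S.polyN) : S.creation (S.mulD n π) = S.normMul n π := by
  induction π using S.polyN_induction with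
  | mem γ =>
    rw [mulD_zN, ← genBasis_apply, creation, S.genBasis.constr_basis]
    rfl
  | zero => simp
  | add π π' h h' => simp only [map_add, h, h']
  | smul c π h => simp only [map_smul, h]

theorem L_induction {p : S.L → Prop} (mulD : ∀ n γ, p (S.mulD n (S.zN γ)))
    (inr : ∀ i, p (S.gen (.inr i))) (zero : p 0) (add : ∀ D D', p D → p D' → p (D + D'))
    (smul : ∀ (c : ℝ) D, p D → p (c • D)) (D : S.L) : p D := by
  have h : D ∈ Submodule.span ℝ (Set.range S.gen) := by rw [span_range_gen]; trivial
  induction h using Submodule.span_induction with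
  | mem x h =>
    obtain ⟨⟨γ, n⟩ | i, rfl⟩ := h
    · exact mulD n γ
    · exact inr i
  | zero => exact zero
  | add x y _ _ h h' => exact add x y h h'
  | smul c x _ h => exact smul c x h

/-- The operators of the representation of `L` on the polynomial algebra. -/
noncomputable def polyRepFun (D : S.L) : Module.End ℝ S.Poly :=
  (S.polyDer D).toLinearMap + S.creation D

theorem polyRepFun_apply (D : S.L) (f : S.Poly) :
    S.polyRepFun D f = S.polyDer D f + S.creation D f := rfl

theorem polyRepFun_add (D D' : S.L) :
    S.polyRepFun (D + D') = S.polyRepFun D + S.polyRepFun D' := by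
  refine LinearMap.ext fun f => ?_
  simp only [polyRepFun_apply, LinearMap.add_apply, polyDer_add, map_add, Derivation.add_apply]
  abel

theorem polyRepFun_smul (c : ℝ) (D : S.L) : S.polyRepFun (c • D) = c • S.polyRepFun D := by
  refine LinearMap.ext fun f => ?_
  simp only [polyRepFun_apply, LinearMap.smul_apply, polyDer_smul, map_smul, Derivation.smul_apply,
    smul_add]

/-- The derivation parts already satisfy the bracket relation (`polyDer_lie`), so only the terms
that contain a creation operator have to be compared. -/
theorem polyRepFun_lie_gen (D D' : S.L)
    (h : ∀ f, S.creation ⁅D, D'⁆ f =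
      (S.polyDer D (S.creation D' f) - S.creation D' (S.polyDer D f)) -
      (S.polyDer D' (S.creation D f) - S.creation D (S.polyDer D' f)) +
      (S.creation D (S.creation D' f) - S.creation D' (S.creation D f))) :
    S.polyRepFun ⁅D, D'⁆ = ⁅S.polyRepFun D, S.polyRepFun D'⁆ := by
  refine LinearMap.ext fun f => ?_
  simp only [polyRepFun_apply, LieRing.of_associative_ring_bracket, LinearMap.sub_apply,
    Module.End.mul_apply, polyDer_lie, Derivation.commutator_apply, h, map_add]
  abel

/-- The terms `D^{(n)}(D' π)` of the bracket arise from the commutator of a derivation with a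
creation operator, and the terms with `n(i)` from commuting two creation operators. Two creation
operators of the type `π D^{(n)}` commute. -/
theorem polyRepFun_lie (D D' : S.L) :
    S.polyRepFun ⁅D, D'⁆ = ⁅S.polyRepFun D, S.polyRepFun D'⁆ := by
  have key : ∀ (i : Fin d) (n : NIdx d) (π : S.polyN),
      S.polyRepFun ⁅S.gen (.inr i), S.mulD n π⁆ =
        ⁅S.polyRepFun (S.gen (.inr i)), S.polyRepFun (S.mulD n π)⁆ := by
    intro i n π
    refine S.polyRepFun_lie_gen _ _ fun f => ?_
    simp only [lie_inr_mulD, map_sub, map_smul, LinearMap.sub_apply, LinearMap.smul_apply,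
      creation_mulD, creation_inr, polyDer_normMul, normMul_X_inr, Derivation.leibniz,
      polyDer_X_inr, smul_eq_mul, mul_zero, add_zero]
    abel
  have hz : S.polyRepFun 0 = 0 := by
    simpa using S.polyRepFun_smul 0 0
  induction D using S.L_induction with
  | mulD n γ =>
    induction D' using S.L_induction with
    | mulD n' γ' =>
      refine S.polyRepFun_lie_gen _ _ fun f => ?_
      simp only [lie_mulD_mulD, map_sub, LinearMap.sub_apply, creation_mulD, polyDer_normMul]
      rw [S.normMul_comm n' n]
      abel
    | inr i =>
      -- The opposite order follows by antisymmetry from `key`.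
      have h := S.polyRepFun_add ⁅S.mulD n (S.zN γ), S.gen (.inr i)⁆
        ⁅S.gen (.inr i), S.mulD n (S.zN γ)⁆
      rw [← lie_skew, neg_add_cancel, hz, key] at h
      rw [← lie_skew, ← lie_skew (S.polyRepFun _)]
      exact eq_neg_of_add_eq_zero_left h.symm
    | zero => simp [hz]
    | add D D' h h' => simp only [lie_add, polyRepFun_add, h, h']
    | smul c D h =>
      rw [lie_smul, polyRepFun_smul, polyRepFun_smul, h]
      simp only [LieRing.of_associative_ring_bracket, mul_smul_comm, smul_mul_assoc, smul_sub]
  | inr i =>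
    induction D' using S.L_induction with
    | mulD n γ => exact key i n _
    | inr j =>
      refine S.polyRepFun_lie_gen _ _ fun f => ?_
      simp only [lie_inr_inr, map_zero, LinearMap.zero_apply, creation_inr, Derivation.leibniz,
        polyDer_X_inr, smul_eq_mul]
      ring
    | zero => simp [hz]
    | add D D' h h' => simp only [lie_add, polyRepFun_add, h, h']
    | smul c D h =>
      rw [lie_smul, polyRepFun_smul, polyRepFun_smul, h]
      simp only [LieRing.of_associative_ring_bracket, mul_smul_comm, smul_mul_assoc, smul_sub]
  | zero => simp [hz]
  | add D D' h h' => simp only [add_lie, polyRepFun_add, h, h']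
  | smul c D h =>
    rw [smul_lie, polyRepFun_smul, polyRepFun_smul, h]
    simp only [LieRing.of_associative_ring_bracket, mul_smul_comm, smul_mul_assoc, smul_sub]

/-- The representation of `L` on the polynomial algebra. -/
noncomputable def polyRep : S.L →ₗ⁅ℝ⁆ Module.End ℝ S.Poly where
  toFun := S.polyRepFun
  map_add' := S.polyRepFun_add
  map_smul' := S.polyRepFun_smul
  map_lie' := S.polyRepFun_lie _ _

/-- The representation of `U(L)` on the polynomial algebra. -/
noncomputable def polyRepU : S.U →ₐ[ℝ] Module.End ℝ S.Poly :=
  UniversalEnvelopingAlgebra.lift ℝ S.polyRep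

theorem polyRepU_ιU_mul (D : S.L) (V : S.U) (f : S.Poly) :
    S.polyRepU (S.ιU D * V) f =
      S.polyDer D (S.polyRepU V f) + S.creation D (S.polyRepU V f) := by
  have e : S.polyRepU (S.ιU D) = S.polyRep D :=
    UniversalEnvelopingAlgebra.lift_ι_apply ℝ S.polyRep D
  rw [map_mul, e]
  rfl

/-- Words in `L` span `U(L)`; peeling off letters from the left matches the recursion that defines
`sandwichHom`. -/
theorem U_induction {p : S.U → Prop} (one : p 1) (add : ∀ V W, p V → p W → p (V + W))
    (smul : ∀ (c : ℝ) V, p V → p (c • V)) (mul : ∀ D V, p V → p (S.ιU D * V)) (V : S.U) :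
    p V := by
  have hsurj : Function.Surjective (UniversalEnvelopingAlgebra.mkAlgHom ℝ S.L) :=
    Quotient.mk_surjective
  -- The claim is made for every right factor `W`, which is what lets it pass through products in
  -- the tensor algebra.
  have key : ∀ t : TensorAlgebra ℝ S.L, ∀ W, p W →
      p (UniversalEnvelopingAlgebra.mkAlgHom ℝ S.L t * W) := by
    intro t
    induction t using TensorAlgebra.induction with
    | algebraMap r =>
      intro W hW
      rw [AlgHom.commutes, ← Algebra.smul_def]
      exact smul r W hW
    | ι D => exact fun W hW => mul D W hW
    | mul a b ha hb =>
      intro W hW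
      rw [map_mul, mul_assoc]
      exact ha _ (hb _ hW)
    | add a b ha hb =>
      intro W hW
      rw [map_add, add_mul]
      exact add _ _ (ha _ hW) (hb _ hW)
  obtain ⟨t, rfl⟩ := hsurj V
  simpa using key t 1 one

/-- The symbol of an element of `U(L)`: the image of the polynomial `1`. -/
noncomputable def symbol : S.U →ₗ[ℝ] S.Poly :=
  LinearMap.applyₗ 1 ∘ₗ S.polyRepU.toLinearMap

theorem symbol_apply (V : S.U) : S.symbol V = S.polyRepU V 1 := rfl

theorem symbol_one : S.symbol 1 = 1 := by
  rw [symbol_apply, map_one S.polyRepU]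
  rfl

theorem symbol_mul (V W : S.U) : S.symbol (V * W) = S.polyRepU V (S.symbol W) := by
  rw [symbol_apply, map_mul]
  rfl

theorem symbol_ιU_mul (D : S.L) (V : S.U) :
    S.symbol (S.ιU D * V) = S.polyDer D (S.symbol V) + S.creation D (S.symbol V) :=
  S.polyRepU_ιU_mul D V 1

/-- New factors `∂_i` and `D^{(n)}` do not act on the variables `z^γ D^{(n)}` in normal order; such
actions are the business of `polyDer` alone. -/
theorem creation_Zlin (D : S.L) (n : NIdx d) (π : S.polyN) (f : S.Poly) :
    S.creation D (S.Zlin n π * f) = S.Zlin n π * S.creation D f := by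
  induction D using S.L_induction with
  | mulD n γ => rw [creation_mulD, normMul_Zlin]
  | inr i => rw [creation_inr, creation_inr, mul_left_comm]
  | zero => simp
  | add D D' h h' => simp only [map_add, LinearMap.add_apply, h, h', mul_add]
  | smul c D h => simp only [map_smul, LinearMap.smul_apply, h, mul_smul_comm]

/-- In the recursion the subtracted term `sandwichHom n V (D π)` cancels exactly the Leibniz term in
which `D` differentiates the new variable. So inserting a pair `π`, `D^{(n)}` becomes a commutative
multiplication. -/
theorem symbol_sandwichHom (n : NIdx d) (V : S.U) (π : S.polyN) :
    S.symbol (S.sandwichHom n V π) = S.Zlin n π * S.symbol V := by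
  induction V using S.U_induction generalizing π with
  | one =>
    rw [sandwichHom_one, ← mul_one (S.ιU _), symbol_ιU_mul, symbol_one, creation_mulD, normMul_one,
      Derivation.map_one_eq_zero, zero_add, mul_one]
  | add V W h h' => simp only [map_add, LinearMap.add_apply, h, h', mul_add]
  | smul c V h => simp only [map_smul, LinearMap.smul_apply, h, mul_smul_comm]
  | mul D V h =>
    rw [sandwichHom_mul, map_sub, symbol_ιU_mul, symbol_ιU_mul, h, h, creation_Zlin,
      Derivation.leibniz, polyDer_Zlin, smul_eq_mul, smul_eq_mul]
    ring

/-- On `1` the two orders give a product minus the pre-Lie term, which is symmetric by the bracket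
formula `lie_mulD_mulD`. The recursion treats `π` and `π'` alike, so the symmetry propagates. -/
theorem sandwichHom_comm (n n' : NIdx d) (V : S.U) (π π' : S.polyN) :
    S.sandwichHom n (S.sandwichHom n' V π') π = S.sandwichHom n' (S.sandwichHom n V π) π' := by
  induction V using S.U_induction generalizing π π' with
  | one =>
    have h1 : ∀ (n n' : NIdx d) (π π' : S.polyN),
        S.sandwichHom n (S.sandwichHom n' 1 π') π =
          S.ιU (S.mulD n' π') * S.ιU (S.mulD n π) -
            S.ιU (S.mulD n (S.actN (S.mulD n' π') π)) := by
      intro n n' π π'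
      rw [sandwichHom_one, ← mul_one (S.ιU _), sandwichHom_mul, sandwichHom_one, sandwichHom_one,
        mul_one]
    rw [h1, h1]
    have h2 := congrArg S.ιU (S.lie_mulD_mulD n n' π π')
    rw [LieHom.map_lie, LieRing.of_associative_ring_bracket, map_sub] at h2
    rw [sub_eq_sub_iff_add_eq_add] at h2 ⊢
    rw [h2]
    abel
  | add V W h h' => simp only [map_add, LinearMap.add_apply, h, h']
  | smul c V h => simp only [map_smul, LinearMap.smul_apply, h]
  | mul D V h =>
    simp only [sandwichHom_mul, map_sub, LinearMap.sub_apply, h]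
    abel

theorem sandwich_apply (x : S.M) (V : S.U) :
    S.sandwich x V = S.sandwichHom x.2 V (S.zN x.1) := rfl

theorem sandwichList_perm {l l' : List S.M} (h : l.Perm l') (V : S.U) :
    S.sandwichList l V = S.sandwichList l' V := by
  induction h with
  | nil => rfl
  | cons x _ ih =>
    change S.sandwich x (S.sandwichList _ V) = S.sandwich x (S.sandwichList _ V)
    rw [ih]
  | swap x y l =>
    change S.sandwich y (S.sandwich x (S.sandwichList l V)) =
      S.sandwich x (S.sandwich y (S.sandwichList l V))
    simp only [sandwich_apply]
    exact S.sandwichHom_comm _ _ _ _ _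
  | trans _ _ ih ih' => rw [ih, ih']

end Setting

/-! ### Induction on multi-indices, and sums and ordered products over them. -/

section Combinatorics

variable {I : Type*}

theorem finsupp_nat_induction {p : (I →₀ ℕ) → Prop} (zero : p 0)
    (add_single : ∀ m x, p m → p (m + Finsupp.single x 1)) (m : I →₀ ℕ) : p m := by
  have key : ∀ f m : I →₀ ℕ, p m → p (m + f) := by
    intro f
    induction f using Finsupp.induction_linear with
    | zero => exact fun m hm => by rwa [add_zero]
    | add f g hf hg => exact fun m hm => by rw [← add_assoc]; exact hg _ (hf _ hm)
    | single x n =>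
      induction n with
      | zero => exact fun m hm => by rwa [Finsupp.single_zero, add_zero]
      | succ n ih =>
        intro m hm
        rw [Finsupp.single_add, ← add_assoc]
        exact add_single _ _ (ih m hm)
  simpa using key m 0 zero

/-- This is the Leibniz rule for divided powers. The factor `m x + 1` is split as `p.1 x + p.2 x`;
in each half the terms of weight zero drop out and the others are shifts by `x` of the antidiagonal
of `m`. -/
theorem sum_antidiagonal_add_single [DecidableEq I] {W : Type*} [AddCommGroup W] [Module ℝ W]
    (m : I →₀ ℕ) (x : I) (F : (I →₀ ℕ) → (I →₀ ℕ) → W) :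
    ((m x : ℝ) + 1) • ∑ p ∈ Finset.HasAntidiagonal.antidiagonal (m + Finsupp.single x 1),
        F p.1 p.2 =
      ∑ p ∈ Finset.HasAntidiagonal.antidiagonal m,
        (((p.1 x : ℝ) + 1) • F (p.1 + Finsupp.single x 1) p.2 +
          ((p.2 x : ℝ) + 1) • F p.1 (p.2 + Finsupp.single x 1)) := by
  have e1 : ∑ p ∈ Finset.HasAntidiagonal.antidiagonal (m + Finsupp.single x 1),
      ((p.1 : I →₀ ℕ) x : ℝ) • F p.1 p.2 = ∑ p ∈ Finset.HasAntidiagonal.antidiagonal m,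
        ((p.1 x : ℝ) + 1) • F (p.1 + Finsupp.single x 1) p.2 := by
    have hinj : Function.Injective fun p : (I →₀ ℕ) × (I →₀ ℕ) =>
        (p.1 + Finsupp.single x 1, p.2) := by
      rintro ⟨a, b⟩ ⟨a', b'⟩ h
      simpa using h
    have h1 := Finset.sum_image (s := Finset.HasAntidiagonal.antidiagonal m)
      (f := fun p : (I →₀ ℕ) × (I →₀ ℕ) => (p.1 x : ℝ) • F p.1 p.2) hinj.injOn
    simp only [Finsupp.add_apply, Finsupp.single_eq_same, Nat.cast_add, Nat.cast_one] at h1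
    rw [← h1]
    refine (Finset.sum_subset ?_ ?_).symm
    · intro p hp
      obtain ⟨q, hq, rfl⟩ := Finset.mem_image.mp hp
      rw [Finset.HasAntidiagonal.mem_antidiagonal] at hq ⊢
      simp only
      rw [← hq, add_right_comm]
    · rintro ⟨a, b⟩ hp hn
      rw [Finset.HasAntidiagonal.mem_antidiagonal] at hp
      have ha : a x = 0 := by
        by_contra h0
        have hle := single_one_le_iff.mpr h0
        refine hn (Finset.mem_image.mpr ⟨(a - Finsupp.single x 1, b), ?_, ?_⟩)
        · rw [Finset.HasAntidiagonal.mem_antidiagonal]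
          refine add_right_cancel (b := Finsupp.single x 1) ?_
          rw [add_right_comm, tsub_add_cancel_of_le hle, hp]
        · rw [tsub_add_cancel_of_le hle]
      simp [ha]
  have e2 : ∑ p ∈ Finset.HasAntidiagonal.antidiagonal (m + Finsupp.single x 1),
      ((p.2 : I →₀ ℕ) x : ℝ) • F p.1 p.2 = ∑ p ∈ Finset.HasAntidiagonal.antidiagonal m,
        ((p.2 x : ℝ) + 1) • F p.1 (p.2 + Finsupp.single x 1) := by
    have hinj : Function.Injective fun p : (I →₀ ℕ) × (I →₀ ℕ) =>
        (p.1, p.2 + Finsupp.single x 1) := by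
      rintro ⟨a, b⟩ ⟨a', b'⟩ h
      simpa using h
    have h1 := Finset.sum_image (s := Finset.HasAntidiagonal.antidiagonal m)
      (f := fun p : (I →₀ ℕ) × (I →₀ ℕ) => (p.2 x : ℝ) • F p.1 p.2) hinj.injOn
    simp only [Finsupp.add_apply, Finsupp.single_eq_same, Nat.cast_add, Nat.cast_one] at h1
    rw [← h1]
    refine (Finset.sum_subset ?_ ?_).symm
    · intro p hp
      obtain ⟨q, hq, rfl⟩ := Finset.mem_image.mp hp
      rw [Finset.HasAntidiagonal.mem_antidiagonal] at hq ⊢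
      simp only
      rw [← hq, add_assoc]
    · rintro ⟨a, b⟩ hp hn
      rw [Finset.HasAntidiagonal.mem_antidiagonal] at hp
      have ha : b x = 0 := by
        by_contra h0
        have hle := single_one_le_iff.mpr h0
        refine hn (Finset.mem_image.mpr ⟨(a, b - Finsupp.single x 1), ?_, ?_⟩)
        · rw [Finset.HasAntidiagonal.mem_antidiagonal]
          refine add_right_cancel (b := Finsupp.single x 1) ?_
          rw [add_assoc, tsub_add_cancel_of_le hle, hp]
        · rw [tsub_add_cancel_of_le hle]
      simp [ha]
  rw [Finset.sum_add_distrib, ← e1, ← e2, ← Finset.sum_add_distrib, Finset.smul_sum]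
  refine Finset.sum_congr rfl fun p hp => ?_
  rw [Finset.HasAntidiagonal.mem_antidiagonal] at hp
  have h := DFunLike.congr_fun hp x
  rw [Finsupp.add_apply, Finsupp.add_apply, Finsupp.single_eq_same] at h
  have h' : (m x : ℝ) + 1 = p.1 x + p.2 x := by exact_mod_cast h.symm
  rw [← add_smul, h']

theorem prod_map_pow_add_single {A : Type*} [Monoid A] [DecidableEq I] {a : I → A}
    (ha : ∀ i j, Commute (a i) (a j)) (m : I →₀ ℕ) (i : I) (l : List I) (hl : l.Nodup) :
    (l.map fun j => a j ^ (m + Finsupp.single i 1 : I →₀ ℕ) j).prod =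
      (if i ∈ l then a i else 1) * (l.map fun j => a j ^ m j).prod := by
  induction l with
  | nil => simp
  | cons j l ih =>
    rw [List.nodup_cons] at hl
    rw [List.map_cons, List.prod_cons, ih hl.2, List.map_cons, List.prod_cons]
    by_cases h : i = j
    · subst h
      rw [if_neg hl.1, if_pos List.mem_cons_self, one_mul, Finsupp.add_apply,
        Finsupp.single_eq_same, pow_succ', mul_assoc]
    · rw [Finsupp.add_apply, Finsupp.single_eq_of_ne (Ne.symm h), add_zero]
      by_cases h' : i ∈ l
      · rw [if_pos h', if_pos (List.mem_cons_of_mem _ h'), ← mul_assoc, ← mul_assoc,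
          ((ha i j).pow_right _).eq]
      · rw [if_neg h', if_neg (by simp [h, h']), one_mul, one_mul]

end Combinatorics

/-! ### The elements `D_{(J,m)}` span `U(L)` and are independent. -/

namespace Setting

variable {d : ℕ} {ℒ : Type*} (S : Setting d ℒ)

open MvPolynomial (X)

theorem commute_genX (i j : Fin d) :
    Commute (S.ιU (S.gen (.inr i))) (S.ιU (S.gen (.inr j))) := by
  have h := congrArg S.ιU (S.lie_inr_inr i j)
  rw [LieHom.map_lie, map_zero, LieRing.of_associative_ring_bracket, sub_eq_zero] at h
  exact h

theorem powX_zero : S.powX 0 = 1 := by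
  simp [powX]

theorem powX_add_single (m : NIdx d) (i : Fin d) :
    S.powX (m + Finsupp.single i 1) = S.ιU (S.gen (.inr i)) * S.powX m := by
  rw [powX, powX, List.ofFn_eq_map, List.ofFn_eq_map,
    prod_map_pow_add_single S.commute_genX m i _ (List.nodup_finRange d),
    if_pos (List.mem_finRange i)]

theorem powX_add_single' (m : NIdx d) (i : Fin d) :
    S.powX (m + Finsupp.single i 1) = S.powX m * S.ιU (S.gen (.inr i)) := by
  have h : Commute (S.ιU (S.gen (.inr i))) (S.powX m) := by
    refine Commute.list_prod_right _ _ fun x hx => ?_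
    obtain ⟨j, rfl⟩ := (List.mem_ofFn' _ _).mp hx
    exact (S.commute_genX i j).pow_right _
  rw [powX_add_single, h.eq]

theorem D_zero (m : NIdx d) : S.D (0, m) = (mfact m : ℝ)⁻¹ • S.powX m := by
  simp [D, sandwichList]

theorem sandwich_D (x : S.M) (J : S.M →₀ ℕ) (m : NIdx d) :
    S.sandwich x (S.D (J, m)) = ((J x : ℝ) + 1) • S.D (J + Finsupp.single x 1, m) := by
  have hp : (x :: (Finsupp.toMultiset J).toList).Perm
      (Finsupp.toMultiset (J + Finsupp.single x 1)).toList := by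
    rw [← Multiset.coe_eq_coe, ← Multiset.cons_coe, Multiset.coe_toList, Multiset.coe_toList,
      map_add, Finsupp.toMultiset_single, one_smul, add_comm, Multiset.singleton_add]
  have e : S.sandwichList (Finsupp.toMultiset (J + Finsupp.single x 1)).toList (S.powX m) =
      S.sandwich x (S.sandwichList (Finsupp.toMultiset J).toList (S.powX m)) :=
    (S.sandwichList_perm hp _).symm
  rw [D, D, map_smul, e, smul_smul, mfact_add_single]
  congr 1
  have h1 := mfact_ne_zero J
  have h2 := mfact_ne_zero m
  have h3 : (J x : ℝ) + 1 ≠ 0 := by positivity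
  push_cast
  field_simp

theorem D_add_single (x : S.M) (J : S.M →₀ ℕ) (m : NIdx d) :
    S.D (J + Finsupp.single x 1, m) = ((J x : ℝ) + 1)⁻¹ • S.sandwich x (S.D (J, m)) := by
  rw [sandwich_D, smul_smul, inv_mul_cancel₀ (by positivity), one_smul]

theorem genX_mul_D (i : Fin d) (m : NIdx d) :
    S.ιU (S.gen (.inr i)) * S.D (0, m) =
      ((m i : ℝ) + 1) • S.D (0, m + Finsupp.single i 1) := by
  rw [D_zero, D_zero, mul_smul_comm, ← powX_add_single, smul_smul, mfact_add_single]
  congr 1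
  have h2 := mfact_ne_zero m
  have h3 : (m i : ℝ) + 1 ≠ 0 := by positivity
  push_cast
  field_simp

theorem D_zero_add_single (i : Fin d) (m : NIdx d) :
    S.D (0, m + Finsupp.single i 1) =
      ((m i : ℝ) + 1)⁻¹ • (S.ιU (S.gen (.inr i)) * S.D (0, m)) := by
  rw [genX_mul_D, smul_smul, inv_mul_cancel₀ (by positivity), one_smul]

/-- On the right of `π V D^{(n)}` only `D^{(n)}` has to be moved past `∂_i`, so `π` and `V` stay
untouched. The base case is the bracket of `∂_i` with `π D^{(n)}`. -/
theorem sandwichHom_mul_genX (n : NIdx d) (V : S.U) (π : S.polyN) (i : Fin d) :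
    S.sandwichHom n V π * S.ιU (S.gen (.inr i)) =
      S.sandwichHom n (V * S.ιU (S.gen (.inr i))) π +
        (n i : ℝ) • S.sandwichHom (n - Finsupp.single i 1) V π := by
  induction V using S.U_induction generalizing π with
  | one =>
    have h := congrArg S.ιU (S.lie_inr_mulD i n π)
    rw [LieHom.map_lie, LieRing.of_associative_ring_bracket, map_sub, map_smul] at h
    rw [one_mul, ← mul_one (S.ιU (S.gen (.inr i))), sandwichHom_mul, sandwichHom_one,
      sandwichHom_one, sandwichHom_one, mul_one, sub_add, ← h]
    abel
  | add V W h h' =>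
    simp only [map_add, LinearMap.add_apply, add_mul, h, h', smul_add]
    abel
  | smul c V h =>
    simp only [map_smul, LinearMap.smul_apply, smul_mul_assoc, h, smul_add]
    rw [smul_comm]
  | mul D V h =>
    simp only [sandwichHom_mul, sub_mul, mul_assoc, h, mul_add, mul_smul_comm, smul_sub]
    abel

theorem powX_mem_span (m : NIdx d) : S.powX m ∈ Submodule.span ℝ (Set.range S.D) := by
  have e : S.powX m = (mfact m : ℝ) • S.D (0, m) := by
    rw [D_zero, smul_smul, mul_inv_cancel₀ (mfact_ne_zero m), one_smul]
  rw [e]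
  exact Submodule.smul_mem _ _ (Submodule.subset_span ⟨_, rfl⟩)

theorem sandwichHom_mem_span (n : NIdx d) {V : S.U}
    (hV : V ∈ Submodule.span ℝ (Set.range S.D)) (π : S.polyN) :
    S.sandwichHom n V π ∈ Submodule.span ℝ (Set.range S.D) := by
  induction π using S.polyN_induction with
  | mem γ =>
    induction hV using Submodule.span_induction with
    | mem V h =>
      obtain ⟨⟨J, m⟩, rfl⟩ := h
      have e := S.sandwich_D (γ, n) J m
      rw [sandwich_apply] at e
      rw [e]
      exact Submodule.smul_mem _ _ (Submodule.subset_span ⟨_, rfl⟩)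
    | zero => simp
    | add V W _ _ h h' =>
      rw [map_add, LinearMap.add_apply]
      exact Submodule.add_mem _ h h'
    | smul c V _ h =>
      rw [map_smul, LinearMap.smul_apply]
      exact Submodule.smul_mem _ c h
  | zero => simp
  | add π π' h h' => rw [map_add]; exact Submodule.add_mem _ h h'
  | smul c π h => rw [map_smul]; exact Submodule.smul_mem _ c h

theorem mulD_mul_powX_mem_span (n : NIdx d) (π : S.polyN) (m : NIdx d) :
    S.ιU (S.mulD n π) * S.powX m ∈ Submodule.span ℝ (Set.range S.D) := by
  -- With `π` fixed, the span of all `π ∂^m D^{(n)}` is stable under right multiplication by `∂_i`;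
  -- the span of the `D_{(J,m)}` is too coarse as an induction hypothesis here.
  have hle : Submodule.span ℝ {V | ∃ n m, V = S.sandwichHom n (S.powX m) π} ≤
      Submodule.span ℝ (Set.range S.D) := by
    refine Submodule.span_le.mpr ?_
    rintro _ ⟨n, m, rfl⟩
    exact S.sandwichHom_mem_span n (S.powX_mem_span m) π
  refine hle ?_
  induction m using finsupp_nat_induction with
  | zero =>
    refine Submodule.subset_span ⟨n, 0, ?_⟩
    rw [powX_zero, mul_one, sandwichHom_one]
  | add_single m i h =>
    rw [powX_add_single', ← mul_assoc]
    generalize S.ιU (S.mulD n π) * S.powX m = V at h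
    induction h using Submodule.span_induction with
    | mem V h =>
      obtain ⟨n, m, rfl⟩ := h
      rw [sandwichHom_mul_genX, ← powX_add_single']
      exact Submodule.add_mem _ (Submodule.subset_span ⟨_, _, rfl⟩)
        (Submodule.smul_mem _ _ (Submodule.subset_span ⟨_, _, rfl⟩))
    | zero => simp
    | add V W _ _ h h' => rw [add_mul]; exact Submodule.add_mem _ h h'
    | smul c V _ h => rw [smul_mul_assoc]; exact Submodule.smul_mem _ c h

theorem ιU_mul_powX_mem_span (D : S.L) (m : NIdx d) :
    S.ιU D * S.powX m ∈ Submodule.span ℝ (Set.range S.D) := by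
  induction D using S.L_induction with
  | mulD n γ => exact S.mulD_mul_powX_mem_span n _ m
  | inr i => rw [← powX_add_single]; exact S.powX_mem_span _
  | zero => simp
  | add D D' h h' => rw [map_add, add_mul]; exact Submodule.add_mem _ h h'
  | smul c D h => rw [map_smul, smul_mul_assoc]; exact Submodule.smul_mem _ c h

/-- The recursion is solved for `D` times a sandwich: either `D` enters the sandwich, where the
induction on `J` applies, or it acts on the monomial `z^γ`. The element `D` itself can then be held
general. -/
theorem ιU_mul_D_mem_span (D : S.L) (J : S.M →₀ ℕ) (m : NIdx d) :
    S.ιU D * S.D (J, m) ∈ Submodule.span ℝ (Set.range S.D) := by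
  induction J using finsupp_nat_induction generalizing D with
  | zero =>
    rw [D_zero, mul_smul_comm]
    exact Submodule.smul_mem _ _ (S.ιU_mul_powX_mem_span D m)
  | add_single J x h =>
    rw [D_add_single, mul_smul_comm]
    refine Submodule.smul_mem _ _ ?_
    have e := S.sandwichHom_mul x.2 D (S.D (J, m)) (S.zN x.1)
    rw [sandwich_apply, sub_eq_iff_eq_add.mp e.symm]
    exact Submodule.add_mem _ (S.sandwichHom_mem_span _ (h D) _)
      (S.sandwichHom_mem_span _ (Submodule.subset_span ⟨_, rfl⟩) _)

theorem span_range_D : Submodule.span ℝ (Set.range S.D) = ⊤ := by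
  rw [eq_top_iff]
  rintro V -
  induction V using S.U_induction with
  | one => rw [← powX_zero]; exact S.powX_mem_span 0
  | add V W h h' => exact Submodule.add_mem _ h h'
  | smul c V h => exact Submodule.smul_mem _ c h
  | mul D V h =>
    induction h using Submodule.span_induction with
    | mem V h =>
      obtain ⟨⟨J, m⟩, rfl⟩ := h
      exact S.ιU_mul_D_mem_span D J m
    | zero => simp
    | add V W _ _ h h' => rw [mul_add]; exact Submodule.add_mem _ h h'
    | smul c V _ h => rw [mul_smul_comm]; exact Submodule.smul_mem _ c h

/-- The monomial with exponent `(J,m)`. -/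
noncomputable def mono (p : S.Idx) : S.Poly :=
  MvPolynomial.monomial (Finsupp.sumFinsuppEquivProdFinsupp.symm p) 1

theorem X_inl_mul_mono (x : S.M) (J : S.M →₀ ℕ) (m : NIdx d) :
    X (.inl x) * S.mono (J, m) = S.mono (J + Finsupp.single x 1, m) := by
  classical
  rw [mono, mono, MvPolynomial.X, MvPolynomial.monomial_mul, one_mul]
  congr 2
  ext (y | j) <;> simp [Finsupp.sumFinsuppEquivProdFinsupp, Finsupp.single_apply, add_comm]

theorem X_inr_mul_mono (i : Fin d) (J : S.M →₀ ℕ) (m : NIdx d) :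
    X (.inr i) * S.mono (J, m) = S.mono (J, m + Finsupp.single i 1) := by
  classical
  rw [mono, mono, MvPolynomial.X, MvPolynomial.monomial_mul, one_mul]
  congr 2
  ext (y | j) <;> simp [Finsupp.sumFinsuppEquivProdFinsupp, Finsupp.single_apply, add_comm]

theorem mono_zero : S.mono 0 = 1 := by
  rw [mono, show Finsupp.sumFinsuppEquivProdFinsupp.symm (0 : S.Idx) = 0 from ?_]
  · rfl
  · ext (y | j) <;> simp [Finsupp.sumFinsuppEquivProdFinsupp]

theorem polyDer_mono (D : S.L) (m : NIdx d) : S.polyDer D (S.mono (0, m)) = 0 := by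
  induction m using finsupp_nat_induction with
  | zero =>
    rw [show ((0, 0) : S.Idx) = 0 from rfl, mono_zero, Derivation.map_one_eq_zero]
  | add_single m i h =>
    rw [← X_inr_mul_mono, Derivation.leibniz, h, polyDer_X_inr, smul_zero, smul_zero, add_zero]

theorem symbol_powX (m : NIdx d) : S.symbol (S.powX m) = S.mono (0, m) := by
  induction m using finsupp_nat_induction with
  | zero => rw [powX_zero, symbol_one, show ((0, 0) : S.Idx) = 0 from rfl, mono_zero]
  | add_single m i h =>
    rw [powX_add_single, symbol_ιU_mul, h, polyDer_mono, zero_add, creation_inr, X_inr_mul_mono]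

/-- Each map `U ↦ z^γ U D^{(n)}` multiplies the symbol by one variable, and the symbol of `∂^m` is
already a monomial, because `polyDer` vanishes on polynomials in the `∂_i`. -/
theorem symbol_D (p : S.Idx) :
    S.symbol (S.D p) = ((mfact p.1 : ℝ) * mfact p.2)⁻¹ • S.mono p := by
  obtain ⟨J, m⟩ := p
  induction J using finsupp_nat_induction with
  | zero => rw [D_zero, map_smul, symbol_powX, mfact_zero, Nat.cast_one, one_mul]
  | add_single J x h =>
    rw [D_add_single, map_smul, sandwich_apply, symbol_sandwichHom, Zlin_zN, h, mul_smul_comm,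
      X_inl_mul_mono, smul_smul, mfact_add_single]
    congr 1
    have h1 := mfact_ne_zero J
    have h2 := mfact_ne_zero m
    have h3 : (J x : ℝ) + 1 ≠ 0 := by positivity
    push_cast
    field_simp

theorem linearIndependent_D : LinearIndependent ℝ S.D := by
  refine LinearIndependent.of_comp S.symbol ?_
  have h1 : LinearIndependent ℝ S.mono :=
    (MvPolynomial.basisMonomials (S.M ⊕ Fin d) ℝ).linearIndependent.comp _
      Finsupp.sumFinsuppEquivProdFinsupp.symm.injective
  have h2 := h1.units_smul fun p : S.Idx => (Units.mk0 ((mfact p.1 : ℝ) * mfact p.2)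
    (mul_ne_zero (mfact_ne_zero _) (mfact_ne_zero _)))⁻¹
  convert h2 using 1
  funext p
  rw [Function.comp_apply, symbol_D]
  simp [Units.smul_def]

/-- The basis `D_{(J,m)}` of `U(L)`. -/
noncomputable def basisD : Module.Basis S.Idx ℝ S.U :=
  Module.Basis.mk S.linearIndependent_D S.span_range_D.ge

theorem basisD_apply (p : S.Idx) : S.basisD p = S.D p := Module.Basis.mk_apply _ _ p

/-! ### The coproduct and the pairing with polynomials. -/

theorem coprod_ιU_mul (D : S.L) (V : S.U) :
    S.coprod (S.ιU D * V) = ((1 : S.U) ⊗ₜ[ℝ] S.ιU D + S.ιU D ⊗ₜ[ℝ] (1 : S.U)) * S.coprod V := by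
  rw [map_mul]
  congr 1
  exact UniversalEnvelopingAlgebra.lift_ι_apply ℝ _ D

/-- The action of `V ↦ π V D^{(n)}` on `U(L) ⊗ U(L)` by the Leibniz rule. -/
noncomputable def sandwichTensor (n : NIdx d) (π : S.polyN) :
    S.U ⊗[ℝ] S.U →ₗ[ℝ] S.U ⊗[ℝ] S.U :=
  ((S.sandwichHom n).flip π).rTensor S.U + ((S.sandwichHom n).flip π).lTensor S.U

theorem sandwichTensor_tmul (n : NIdx d) (π : S.polyN) (V W : S.U) :
    S.sandwichTensor n π (V ⊗ₜ W) =
      S.sandwichHom n V π ⊗ₜ W + V ⊗ₜ S.sandwichHom n W π := by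
  simp [sandwichTensor]

theorem sandwichTensor_mul (n : NIdx d) (π : S.polyN) (D : S.L) (T : S.U ⊗[ℝ] S.U) :
    S.sandwichTensor n π (((1 : S.U) ⊗ₜ[ℝ] S.ιU D + S.ιU D ⊗ₜ[ℝ] (1 : S.U)) * T) =
      ((1 : S.U) ⊗ₜ[ℝ] S.ιU D + S.ιU D ⊗ₜ[ℝ] (1 : S.U)) * S.sandwichTensor n π T -
        S.sandwichTensor n (S.actN D π) T := by
  induction T using TensorProduct.induction_on with
  | zero => simp
  | tmul V W =>
    simp only [add_mul, mul_add, Algebra.TensorProduct.tmul_mul_tmul, one_mul, map_add,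
      sandwichTensor_tmul, sandwichHom_mul, TensorProduct.tmul_sub, TensorProduct.sub_tmul]
    abel
  | add T T' h h' =>
    simp only [map_add, mul_add _ T T', h, h']
    rw [mul_add]
    abel

/-- Elements of `L` are primitive, so the recursion holds in each tensor factor, and `V ↦ π V
D^{(n)}` is a coderivation. -/
theorem coprod_sandwichHom (n : NIdx d) (V : S.U) (π : S.polyN) :
    S.coprod (S.sandwichHom n V π) = S.sandwichTensor n π (S.coprod V) := by
  induction V using S.U_induction generalizing π with
  | one =>
    rw [sandwichHom_one, ← mul_one (S.ιU _), coprod_ιU_mul, map_one, mul_one,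
      Algebra.TensorProduct.one_def, sandwichTensor_tmul, sandwichHom_one, add_comm]
  | add V W h h' => simp only [map_add, LinearMap.add_apply, h, h']
  | smul c V h => simp only [map_smul, LinearMap.smul_apply, h]
  | mul D V h => rw [sandwichHom_mul, map_sub, coprod_ιU_mul, coprod_ιU_mul, h, h,
      sandwichTensor_mul]

/-- The induction adds one `∂_i`, then one `(γ,n)`, at a time. Each acts on the two tensor factors
by the Leibniz rule, and the factorials in `D_{(J,m)}` are those of divided powers, so no
coefficients remain. -/
theorem coprod_D [DecidableEq S.M] (J : S.M →₀ ℕ) (m : NIdx d) :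
    S.coprod (S.D (J, m)) =
      ∑ p ∈ Finset.HasAntidiagonal.antidiagonal J, ∑ q ∈ Finset.HasAntidiagonal.antidiagonal m,
        S.D (p.1, q.1) ⊗ₜ[ℝ] S.D (p.2, q.2) := by
  induction J using finsupp_nat_induction with
  | zero =>
    rw [Finsupp.antidiagonal_zero, Finset.sum_singleton]
    induction m using finsupp_nat_induction with
    | zero =>
      rw [Finsupp.antidiagonal_zero, Finset.sum_singleton, D_zero, powX_zero, mfact_zero,
        Nat.cast_one, inv_one, one_smul, map_one, Algebra.TensorProduct.one_def]
    | add_single m i h =>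
      have hs := sum_antidiagonal_add_single m i
        fun q q' => S.D (0, q) ⊗ₜ[ℝ] S.D (0, q')
      have hne : (m i : ℝ) + 1 ≠ 0 := by positivity
      rw [D_zero_add_single, map_smul, coprod_ιU_mul, h, inv_smul_eq_iff₀ hne]
      refine Eq.trans ?_ hs.symm
      rw [Finset.mul_sum]
      refine Finset.sum_congr rfl fun q _ => ?_
      rw [add_mul, Algebra.TensorProduct.tmul_mul_tmul, Algebra.TensorProduct.tmul_mul_tmul,
        one_mul, one_mul, genX_mul_D, genX_mul_D, TensorProduct.tmul_smul,
        ← TensorProduct.smul_tmul', add_comm]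
  | add_single J x h =>
    have hs := sum_antidiagonal_add_single J x fun p p' =>
      ∑ q ∈ Finset.HasAntidiagonal.antidiagonal m, S.D (p, q.1) ⊗ₜ[ℝ] S.D (p', q.2)
    have hne : (J x : ℝ) + 1 ≠ 0 := by positivity
    rw [D_add_single, map_smul, sandwich_apply, coprod_sandwichHom, h, inv_smul_eq_iff₀ hne]
    refine Eq.trans ?_ hs.symm
    rw [map_sum]
    refine Finset.sum_congr rfl fun p _ => ?_
    rw [map_sum, Finset.smul_sum, Finset.smul_sum, ← Finset.sum_add_distrib]
    refine Finset.sum_congr rfl fun q _ => ?_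
    rw [sandwichTensor_tmul, ← sandwich_apply, ← sandwich_apply, sandwich_D, sandwich_D,
      TensorProduct.tmul_smul, ← TensorProduct.smul_tmul']

theorem pairing_D (b : Module.Basis S.Idx ℝ S.U) (hb : ∀ p, b p = S.D p) (p : S.Idx)
    (P : MvPolynomial (S.M ⊕ Fin d) ℝ) :
    S.pairing b (S.D p) P =
      MvPolynomial.coeff (Finsupp.sumFinsuppEquivProdFinsupp.symm p) P := by
  rw [← hb, pairing, b.constr_basis]
  rfl

theorem pairing_mul [DecidableEq S.M] (b : Module.Basis S.Idx ℝ S.U) (hb : ∀ p, b p = S.D p)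
    (V : S.U) (P Q : MvPolynomial (S.M ⊕ Fin d) ℝ) :
    S.pairing b V (P * Q) = S.pairing₂ b P Q (S.coprod V) := by
  have h : (S.pairing b).flip (P * Q) = S.pairing₂ b P Q ∘ₗ S.coprod.toLinearMap := by
    refine b.ext fun p => ?_
    obtain ⟨J, m⟩ := p
    rw [hb, LinearMap.flip_apply, pairing_D S b hb, LinearMap.comp_apply,
      AlgHom.toLinearMap_apply, coprod_D, map_sum, MvPolynomial.coeff_mul]
    have e : ∀ p q : S.Idx, S.pairing₂ b P Q (S.D p ⊗ₜ S.D q) =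
        MvPolynomial.coeff (Finsupp.sumFinsuppEquivProdFinsupp.symm p) P *
          MvPolynomial.coeff (Finsupp.sumFinsuppEquivProdFinsupp.symm q) Q := by
      intro p q
      rw [← pairing_D S b hb, ← pairing_D S b hb]
      rfl
    simp only [map_sum, e]
    rw [← Finset.sum_product']
    let φ := Finsupp.sumFinsuppEquivProdFinsupp (α := S.M) (β := Fin d) (γ := ℕ)
    have hadd : ∀ p q : S.Idx, φ.symm p + φ.symm q = φ.symm (p + q) := by
      intro p q
      ext (y | j) <;> simp [φ, Finsupp.sumFinsuppEquivProdFinsupp]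
    -- An exponent over `ℳ ⊔ {1,…,d}` splits into `J` and `m`, so its antidiagonal is the product of
    -- the two antidiagonals; `hadd` makes the identification additive.
    refine Finset.sum_bij'
      (i := fun r _ => (((φ r.1).1, (φ r.2).1), ((φ r.1).2, (φ r.2).2)))
      (j := fun r _ => (φ.symm (r.1.1, r.2.1), φ.symm (r.1.2, r.2.2))) ?_ ?_ ?_ ?_ ?_
    · rintro ⟨r, s⟩ hr
      rw [Finset.HasAntidiagonal.mem_antidiagonal] at hr
      have h1 : φ.symm (φ r + φ s) = φ.symm (J, m) := by
        rw [← hadd, Equiv.symm_apply_apply, Equiv.symm_apply_apply]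
        exact hr
      have h2 := φ.symm.injective h1
      rw [Finset.mem_product, Finset.HasAntidiagonal.mem_antidiagonal, Finset.HasAntidiagonal.mem_antidiagonal]
      exact ⟨congrArg Prod.fst h2, congrArg Prod.snd h2⟩
    · rintro ⟨⟨a, a'⟩, c, c'⟩ hr
      rw [Finset.mem_product, Finset.HasAntidiagonal.mem_antidiagonal, Finset.HasAntidiagonal.mem_antidiagonal] at hr
      rw [Finset.HasAntidiagonal.mem_antidiagonal, hadd]
      exact congrArg φ.symm (Prod.ext hr.1 hr.2)
    · rintro ⟨r, s⟩ _
      simp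
    · rintro ⟨⟨a, a'⟩, c, c'⟩ _
      simp
    · rintro ⟨r, s⟩ _
      simp only [Prod.mk.eta]
      rw [show Finsupp.sumFinsuppEquivProdFinsupp.symm (φ r) = r from φ.symm_apply_apply r,
        show Finsupp.sumFinsuppEquivProdFinsupp.symm (φ s) = s from φ.symm_apply_apply s]
  exact LinearMap.congr_fun h V

end Setting

/-! ### Binomial coefficients of multi-indices. -/

section Binomials

variable {d : ℕ}

theorem mfact_eq_prod (m : NIdx d) : mfact m = ∏ i, (m i).factorial :=
  Finsupp.prod_fintype _ _ fun _ => rfl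

theorem mchoose_mul_mfact (n m : NIdx d) :
    mchoose (n + m) m * (mfact n * mfact m) = mfact (n + m) := by
  rw [mchoose, mfact_eq_prod, mfact_eq_prod, mfact_eq_prod, ← Finset.prod_mul_distrib,
    ← Finset.prod_mul_distrib]
  refine Finset.prod_congr rfl fun i _ => ?_
  rw [Finsupp.add_apply, ← Nat.add_choose_mul_factorial_mul_factorial, mul_assoc]

theorem mchoose_eq (n m : NIdx d) :
    (mchoose (n + m) m : ℝ) = (mfact n : ℝ)⁻¹ * (mfact m : ℝ)⁻¹ * mfact (n + m) := by
  have h : (mchoose (n + m) m : ℝ) * (mfact n * mfact m) = mfact (n + m) := by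
    exact_mod_cast mchoose_mul_mfact n m
  have h1 := mfact_ne_zero n
  have h2 := mfact_ne_zero m
  rw [← h]
  field_simp

end Binomials

/-! ### Linear parts of symbols and the projections of a product. -/

namespace Setting

variable {d : ℕ} {ℒ : Type*} (S : Setting d ℒ)

open MvPolynomial (X)

/-- The projection of the polynomial algebra onto the polynomials in the `∂_i`. -/
noncomputable def polyX : S.Poly →ₐ[ℝ] MvPolynomial (Fin d) ℝ :=
  MvPolynomial.aeval (Sum.elim 0 X)

theorem polyX_X_inl (x : S.M) : S.polyX (X (.inl x)) = 0 := by simp [polyX]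

theorem polyX_X_inr (i : Fin d) : S.polyX (X (.inr i)) = X i := by simp [polyX]

theorem polyX_Zlin (n : NIdx d) (π : S.polyN) : S.polyX (S.Zlin n π) = 0 := by
  induction π using S.polyN_induction with
  | mem γ => rw [Zlin_zN, polyX_X_inl]
  | zero => simp
  | add π π' h h' => rw [map_add, map_add, h, h', add_zero]
  | smul c π h => rw [map_smul, map_smul, h, smul_zero]

theorem polyX_polyDer (D : S.L) (f : S.Poly) : S.polyX (S.polyDer D f) = 0 := by
  induction f using S.poly_induction with
  | one => simp
  | add f g hf hg => rw [map_add, map_add, hf, hg, add_zero]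
  | smul c f hf => rw [Derivation.map_smul, map_smul, hf, smul_zero]
  | inl x f hf => simp [hf, polyDer_X_inl, polyX_Zlin]
  | inr i f hf => simp [hf, polyDer_X_inr]

theorem polyX_normMul (n : NIdx d) (π : S.polyN) (f : S.Poly) :
    S.polyX (S.normMul n π f) = 0 := by
  induction f using S.poly_induction generalizing n with
  | one => rw [normMul_one, polyX_Zlin]
  | add f g hf hg => rw [map_add, map_add, hf, hg, add_zero]
  | smul c f hf => rw [map_smul, map_smul, hf, smul_zero]
  | inl x f hf => rw [normMul_X_inl, map_mul, hf, mul_zero]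
  | inr i f hf => rw [normMul_X_inr, map_add, map_mul, map_smul, hf, hf, mul_zero, smul_zero,
      add_zero]

theorem polyX_creation (D : S.L) (f : S.Poly) :
    S.polyX (S.creation D f) = S.polyX (S.creation D 1) * S.polyX f := by
  induction D using S.L_induction with
  | mulD n γ => rw [creation_mulD, polyX_normMul, polyX_normMul, zero_mul]
  | inr i => rw [creation_inr, creation_inr, mul_one, map_mul]
  | zero => simp
  | add D D' h h' => simp only [map_add, LinearMap.add_apply, h, h', add_mul]
  | smul c D h => simp only [map_smul, LinearMap.smul_apply, h, smul_mul_assoc]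

/-- Modulo the variables `(γ,n)` both derivations and normal-ordered products vanish, and `∂_i` acts
by multiplication. So `polyX ∘ symbol` is multiplicative. -/
theorem polyX_polyRepU (V : S.U) (f : S.Poly) :
    S.polyX (S.polyRepU V f) = S.polyX (S.symbol V) * S.polyX f := by
  induction V using S.U_induction with
  | one =>
    rw [symbol_one, map_one S.polyRepU, map_one, one_mul]
    rfl
  | add V W h h' => simp only [map_add, LinearMap.add_apply, h, h', add_mul]
  | smul c V h => simp only [map_smul, LinearMap.smul_apply, h, smul_mul_assoc]
  | mul D V h =>
    rw [polyRepU_ιU_mul, symbol_ιU_mul, map_add, map_add, polyX_polyDer, polyX_polyDer,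
      polyX_creation, polyX_creation S D (S.symbol V), h]
    ring

theorem symbol_genX (i : Fin d) : S.symbol (S.ιU (S.gen (.inr i))) = X (.inr i) := by
  rw [← mul_one (S.ιU _), symbol_ιU_mul, symbol_one, Derivation.map_one_eq_zero, zero_add,
    creation_inr, mul_one]

theorem polyX_symbol_mul_genX (V : S.U) (i : Fin d) :
    S.polyX (S.symbol (V * S.ιU (S.gen (.inr i)))) = X i * S.polyX (S.symbol V) := by
  rw [symbol_mul, polyX_polyRepU, symbol_genX, polyX_X_inr, mul_comm]

open Classical in
/-- The part of a polynomial that is linear in the variables `(γ,n)`, `γ ∈ 𝒩`, for fixed `n`. -/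
noncomputable def linPart (n : NIdx d) : S.Poly →ₗ[ℝ] S.polyN :=
  (MvPolynomial.basisMonomials (S.M ⊕ Fin d) ℝ).constr ℝ fun s =>
    if h : ∃ γ : S.setN, s = Finsupp.single (.inl (γ, n)) 1 then S.zN h.choose else 0

open Classical in
theorem linPart_monomial (n : NIdx d) (s : S.M ⊕ Fin d →₀ ℕ) :
    S.linPart n (MvPolynomial.monomial s 1) =
      if h : ∃ γ : S.setN, s = Finsupp.single (.inl (γ, n)) 1 then S.zN h.choose else 0 := by
  have e : (MvPolynomial.monomial s 1 : S.Poly) = MvPolynomial.basisMonomials _ ℝ s := by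
    rw [MvPolynomial.coe_basisMonomials]
  rw [e]
  exact (MvPolynomial.basisMonomials (S.M ⊕ Fin d) ℝ).constr_basis ℝ _ s

theorem linPart_single (n : NIdx d) (γ : S.setN) :
    S.linPart n (MvPolynomial.monomial (Finsupp.single (.inl (γ, n)) 1) 1) = S.zN γ := by
  have h : ∃ γ' : S.setN, (Finsupp.single (.inl (γ, n)) 1 : S.M ⊕ Fin d →₀ ℕ) =
      Finsupp.single (.inl (γ', n)) 1 := ⟨γ, rfl⟩
  rw [linPart_monomial, dif_pos h]
  have h' := (Finsupp.single_left_inj one_ne_zero).mp h.choose_spec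
  simp only [Sum.inl.injEq, Prod.mk.injEq, and_true] at h'
  rw [← h']

theorem linPart_eq_zero (n : NIdx d) {s : S.M ⊕ Fin d →₀ ℕ}
    (h : ∀ γ : S.setN, s ≠ Finsupp.single (.inl (γ, n)) 1) :
    S.linPart n (MvPolynomial.monomial s 1) = 0 := by
  rw [linPart_monomial, dif_neg]
  rintro ⟨γ, hγ⟩
  exact h γ hγ

theorem linPart_one (n : NIdx d) : S.linPart n 1 = 0 :=
  S.linPart_eq_zero n (s := 0) fun γ h => by
    have := DFunLike.congr_fun h (.inl (γ, n))
    simp at this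

theorem linPart_X_mul (n : NIdx d) (x : S.M ⊕ Fin d) (f : S.Poly) :
    S.linPart n (X x * f) = MvPolynomial.constantCoeff f • S.linPart n (X x) := by
  classical
  induction f using MvPolynomial.induction_on' with
  | monomial s a =>
    have e : (MvPolynomial.monomial s a : S.Poly) = a • MvPolynomial.monomial s 1 := by
      rw [MvPolynomial.smul_monomial, smul_eq_mul, mul_one]
    rw [e, mul_smul_comm, map_smul, MvPolynomial.constantCoeff_smul, smul_assoc]
    congr 1
    rw [MvPolynomial.constantCoeff_monomial, MvPolynomial.X, MvPolynomial.monomial_mul, one_mul]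
    by_cases hs : s = 0
    · rw [hs, if_pos rfl, one_smul, add_zero]
    · rw [if_neg hs, zero_smul]
      refine S.linPart_eq_zero n fun γ h => hs ?_
      have hx : x = .inl (γ, n) := by
        by_contra hne
        have := DFunLike.congr_fun h x
        rw [Finsupp.add_apply, Finsupp.single_eq_same, Finsupp.single_eq_of_ne hne] at this
        omega
      rw [hx] at h
      simpa using h
  | add f g hf hg => rw [mul_add, map_add, map_add, hf, hg, add_smul]

theorem constantCoeff_polyX (f : S.Poly) :
    MvPolynomial.constantCoeff (S.polyX f) = MvPolynomial.constantCoeff f := by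
  induction f using S.poly_induction with
  | one => simp
  | add f g hf hg => simp only [map_add, hf, hg]
  | smul c f hf => simp only [map_smul, MvPolynomial.constantCoeff_smul, hf]
  | inl x f hf => simp [polyX_X_inl]
  | inr i f hf => simp [polyX_X_inr]

theorem linPart_X_inr (n : NIdx d) (i : Fin d) : S.linPart n (X (.inr i)) = 0 :=
  S.linPart_eq_zero n fun γ h => by
    have := (Finsupp.single_left_inj one_ne_zero).mp h
    simp at this

open Classical in
theorem linPart_Zlin (n m : NIdx d) (π : S.polyN) :
    S.linPart n (S.Zlin m π) = if m = n then π else 0 := by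
  induction π using S.polyN_induction with
  | mem γ =>
    rw [Zlin_zN]
    split_ifs with h
    · rw [h]
      exact S.linPart_single n γ
    · refine S.linPart_eq_zero n fun γ' h' => h ?_
      have := (Finsupp.single_left_inj one_ne_zero).mp h'
      simp only [Sum.inl.injEq, Prod.mk.injEq] at this
      exact this.2
  | zero => simp
  | add π π' h h' => rw [map_add, map_add, h, h']; split_ifs <;> simp
  | smul c π h => rw [map_smul, map_smul, h]; split_ifs <;> simp

theorem linPart_Zlin_mul (n m : NIdx d) (π : S.polyN) (f : S.Poly) :
    S.linPart n (S.Zlin m π * f) = MvPolynomial.constantCoeff f • S.linPart n (S.Zlin m π) := by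
  induction π using S.polyN_induction with
  | mem γ => rw [Zlin_zN, linPart_X_mul]
  | zero => simp
  | add π π' h h' => simp only [map_add, add_mul, h, h', smul_add]
  | smul c π h =>
    simp only [map_smul, smul_mul_assoc, h]
    rw [smul_comm]

/-- The derivation replaces each variable `(γ,n)` by a combination of variables with the same `n`
and kills the `∂_i`, so it respects the number of variables of either kind. -/
theorem linPart_polyDer (n : NIdx d) (D : S.L) (f : S.Poly) :
    S.linPart n (S.polyDer D f) = S.actN D (S.linPart n f) := by
  classical
  have h0 : ∀ f, MvPolynomial.constantCoeff (S.polyDer D f) = 0 := fun f => by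
    rw [← constantCoeff_polyX, polyX_polyDer, map_zero]
  induction f using S.poly_induction with
  | one => simp [linPart_one]
  | add f g hf hg => simp only [map_add, hf, hg]
  | smul c f hf => simp only [map_smul, Derivation.map_smul, hf]
  | inl x f hf =>
    rw [Derivation.leibniz, map_add, smul_eq_mul, smul_eq_mul, linPart_X_mul, h0, zero_smul,
      zero_add, polyDer_X_inl, mul_comm, linPart_Zlin_mul, linPart_X_mul, map_smul, linPart_Zlin,
      ← Prod.mk.eta (p := x), ← Zlin_zN, linPart_Zlin]
    split_ifs <;> simp
  | inr i f hf =>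
    rw [Derivation.leibniz, map_add, smul_eq_mul, polyDer_X_inr, smul_zero, map_zero,
      add_zero, linPart_X_mul, linPart_X_mul, linPart_X_inr, smul_zero, smul_zero, map_zero]

open Classical in
-- A term linear in the variables with index `n` arises from the coefficient of order `n` in `Zser
-- π` times the constant term of the coefficient of order `n' - n` in `taylor f`; the latter is read
-- off from `f` with all variables `(γ,n)` set to zero.
theorem linPart_normMul (n n' : NIdx d) (π : S.polyN) (f : S.Poly) :
    S.linPart n (S.normMul n' π f) =
      (if n ≤ n' then (mfact n : ℝ)⁻¹ * mfact n' * MvPolynomial.coeff (n' - n) (S.polyX f)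
        else 0) • π := by
  induction f using S.poly_induction generalizing n' with
  | one =>
    rw [normMul_one, linPart_Zlin, map_one, MvPolynomial.coeff_one]
    by_cases h : n' = n
    · rw [h, if_pos rfl, if_pos le_rfl, tsub_self, if_pos rfl, mul_one,
        inv_mul_cancel₀ (mfact_ne_zero n), one_smul]
    · rw [if_neg h]
      split_ifs with h1 h2
      · exact absurd (le_antisymm (tsub_eq_zero_iff_le.mp h2.symm) h1) h
      · rw [mul_zero, zero_smul]
      · rw [zero_smul]
  | add f g hf hg =>
    rw [map_add, map_add, hf, hg, map_add, MvPolynomial.coeff_add, ← add_smul]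
    congr 1
    split_ifs
    · ring
    · ring
  | smul c f hf =>
    rw [map_smul, map_smul, hf, map_smul, MvPolynomial.coeff_smul, smul_smul, smul_eq_mul]
    congr 1
    split_ifs
    · ring
    · ring
  | inl x f hf =>
    rw [normMul_X_inl, linPart_X_mul, ← constantCoeff_polyX, polyX_normMul, map_mul, polyX_X_inl,
      map_zero, zero_mul, MvPolynomial.coeff_zero, mul_zero, ite_self, zero_smul, zero_smul]
  | inr i f hf =>
    rw [normMul_X_inr, map_add, map_smul, linPart_X_mul, linPart_X_inr, smul_zero, zero_add, hf,
      smul_smul, map_mul, polyX_X_inr, MvPolynomial.coeff_X_mul']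
    congr 1
    by_cases hi : n' i = 0
    · rw [hi, Nat.cast_zero, zero_mul, if_neg (c := i ∈ _) (by simp [hi]), mul_zero, ite_self]
    · have hle := single_one_le_iff.mpr hi
      by_cases h : n ≤ n' - Finsupp.single i 1
      · have h1 : n ≤ n' := h.trans tsub_le_self
        have h2 : i ∈ (n' - n).support := by
          have := h i
          simp at this ⊢
          omega
        rw [if_pos h, if_pos h1, if_pos h2, mfact_eq_mul hle, tsub_right_comm]
        push_cast
        ring
      · rw [if_neg h, mul_zero]
        split_ifs with h1 h2
        · refine absurd ?_ h
          intro j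
          have h3 := h1 j
          by_cases hj : j = i
          · subst hj
            simp at h2 ⊢
            omega
          · simpa [Finsupp.single_eq_of_ne hj] using h3
        · rw [mul_zero]
        · rfl

theorem linPart_creation_eq_zero (n : NIdx d) (D : S.L) {f : S.Poly} (hf : S.polyX f = 0) :
    S.linPart n (S.creation D f) = 0 := by
  classical
  induction D using S.L_induction with
  | mulD n' γ =>
    rw [creation_mulD, linPart_normMul, hf, MvPolynomial.coeff_zero, mul_zero, ite_self, zero_smul]
  | inr i => rw [creation_inr, linPart_X_mul, linPart_X_inr, smul_zero]
  | zero => simp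
  | add D D' h h' => rw [map_add, LinearMap.add_apply, map_add, h, h', add_zero]
  | smul c D h => rw [map_smul, LinearMap.smul_apply, map_smul, h, smul_zero]

/-- By `linPart_normMul` only the pure `∂`-part of the argument matters. A further factor `∂_i`
shifts the coefficient read off by `e_i`, and the factor is `(n+e_i)!/n! = n(i)+1`. -/
theorem linPart_creation_shift (n : NIdx d) (D : S.L) {f g : S.Poly} (i : Fin d)
    (hf : S.polyX g = X i * S.polyX f) :
    S.linPart n (S.creation D g) =
      ((n i : ℝ) + 1) • S.linPart (n + Finsupp.single i 1) (S.creation D f) := by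
  classical
  induction D using S.L_induction with
  | mulD n' γ =>
    rw [creation_mulD, linPart_normMul, linPart_normMul, hf, smul_smul, MvPolynomial.coeff_X_mul',
      mfact_add_single]
    congr 1
    by_cases h : n + Finsupp.single i 1 ≤ n'
    · have h1 : n ≤ n' := le_self_add.trans h
      have h2 : i ∈ (n' - n).support := by
        have := h i
        simp at this ⊢
        omega
      rw [if_pos h, if_pos h1, if_pos h2, tsub_add_eq_tsub_tsub]
      have h3 : (n i : ℝ) + 1 ≠ 0 := by positivity
      have h4 := mfact_ne_zero n
      push_cast
      field_simp
    · rw [if_neg h, mul_zero]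
      split_ifs with h1 h2
      · refine absurd ?_ h
        intro j
        have h3 := h1 j
        by_cases hj : j = i
        · subst hj
          simp at h2 ⊢
          omega
        · simpa [Finsupp.single_eq_of_ne hj] using h3
      · rw [mul_zero]
      · rfl
  | inr j =>
    rw [creation_inr, creation_inr, linPart_X_mul, linPart_X_mul, linPart_X_inr, linPart_X_inr,
      smul_zero, smul_zero, smul_zero]
  | zero => simp
  | add D D' h h' => simp only [map_add, LinearMap.add_apply, h, h', smul_add]
  | smul c D h =>
    simp only [map_smul, LinearMap.smul_apply, h]
    rw [smul_comm]

theorem rho_ιU_mul (D : S.L) (V : S.U) (π : PS d ℒ) :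
    S.rho (S.ιU D * V) π = (D : Module.End ℝ (PS d ℒ)) (S.rho V π) := by
  have e : S.rho (S.ιU D) = S.L.incl D := UniversalEnvelopingAlgebra.lift_ι_apply ℝ S.L.incl D
  rw [map_mul, e]
  rfl

/-- If every term of `f` contains a variable `(γ,n)`, creation operators yield nothing linear and
`V` acts on the linear part through `ρ` alone. The hypothesis persists along the induction by
`polyX_polyRepU`. -/
theorem coe_linPart_polyRepU (n : NIdx d) (V : S.U) {f : S.Poly} (hf : S.polyX f = 0) :
    (S.linPart n (S.polyRepU V f) : PS d ℒ) = S.rho V (S.linPart n f : PS d ℒ) := by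
  induction V using S.U_induction with
  | one =>
    rw [map_one S.polyRepU, map_one S.rho]
    rfl
  | add V W h h' =>
    simp only [map_add, LinearMap.add_apply, Submodule.coe_add, h, h']
  | smul c V h =>
    simp only [map_smul, LinearMap.smul_apply, Submodule.coe_smul, h]
  | mul D V h =>
    rw [polyRepU_ιU_mul, map_add, linPart_polyDer, linPart_creation_eq_zero, add_zero, rho_ιU_mul,
      ← h]
    · rfl
    · rw [polyX_polyRepU, hf, mul_zero]

theorem linPart_symbol_mul_genX (n : NIdx d) (V : S.U) (i : Fin d) :
    S.linPart n (S.symbol (V * S.ιU (S.gen (.inr i)))) =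
      ((n i : ℝ) + 1) • S.linPart (n + Finsupp.single i 1) (S.symbol V) := by
  induction V using S.U_induction with
  | one => rw [one_mul, symbol_genX, linPart_X_inr, symbol_one, linPart_one, smul_zero]
  | add V W h h' => simp only [add_mul, map_add, h, h', smul_add]
  | smul c V h =>
    simp only [smul_mul_assoc, map_smul, h]
    rw [smul_comm]
  | mul D V h =>
    rw [mul_assoc, symbol_ιU_mul, symbol_ιU_mul, map_add, map_add, linPart_polyDer,
      linPart_polyDer, h, map_smul, smul_add,
      S.linPart_creation_shift n D i (S.polyX_symbol_mul_genX V i)]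

/-- Each right factor `∂_i` raises the index by `e_i` with weight `n(i)+1`; the weights accumulate
to `(n+m)!/n!`, and the `1/m!` in `D_{(0,m)}` makes this a binomial coefficient. -/
theorem linPart_symbol_mul_D_zero (n m : NIdx d) (V : S.U) :
    S.linPart n (S.symbol (V * S.D (0, m))) =
      (mchoose (n + m) m : ℝ) • S.linPart (n + m) (S.symbol V) := by
  induction m using finsupp_nat_induction generalizing n with
  | zero =>
    rw [D_zero, powX_zero, mchoose_eq, mfact_zero, Nat.cast_one, inv_one, one_smul, mul_one,
      mul_one, add_zero, inv_mul_cancel₀ (mfact_ne_zero n), one_smul]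
  | add_single m i h =>
    have e : S.D (0, m + Finsupp.single i 1) =
        ((m i : ℝ) + 1)⁻¹ • (S.D (0, m) * S.ιU (S.gen (.inr i))) := by
      rw [D_zero_add_single, D_zero, mul_smul_comm, ← powX_add_single, powX_add_single',
        smul_mul_assoc]
    rw [e, mul_smul_comm, map_smul, map_smul, ← mul_assoc, linPart_symbol_mul_genX, h, smul_smul,
      smul_smul, mchoose_eq, mchoose_eq, mfact_add_single n, mfact_add_single m,
      add_right_comm n, ← add_assoc]
    congr 1
    have h1 := mfact_ne_zero n
    have h2 := mfact_ne_zero m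
    have h3 : (n i : ℝ) + 1 ≠ 0 := by positivity
    have h4 : (m i : ℝ) + 1 ≠ 0 := by positivity
    push_cast
    field_simp

theorem sumFinsupp_symm_single (x : S.M) :
    Finsupp.sumFinsuppEquivProdFinsupp.symm ((Finsupp.single x 1, 0) : S.Idx) =
      (Finsupp.single (.inl x) 1 : S.M ⊕ Fin d →₀ ℕ) := by
  classical
  ext (y | j) <;> simp [Finsupp.sumFinsuppEquivProdFinsupp, Finsupp.single_apply]

theorem mfact_single {I : Type*} (x : I) : mfact (Finsupp.single x 1) = 1 := by
  rw [← zero_add (Finsupp.single x 1), mfact_add_single]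
  simp

/-- The index `(e_{(γ,n)}, 0)` has factorials equal to one, so the symbol there is the bare variable
`(γ,n)`; every other index has no such linear part. -/
theorem coe_iota (b : Module.Basis S.Idx ℝ S.U) (hb : ∀ p, b p = S.D p) (n : NIdx d) (V : S.U) :
    (S.iota b n V : PS d ℒ) = (S.linPart n (S.symbol V) : PS d ℒ) := by
  have h : (TStar S.setN).subtype ∘ₗ S.iota b n =
      S.polyN.subtype ∘ₗ S.linPart n ∘ₗ S.symbol := by
    refine b.ext fun p => ?_
    simp only [LinearMap.comp_apply]
    rw [iota, b.constr_basis, hb, symbol_D, map_smul, mono]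
    by_cases hp : ∃ γ : S.setN, p = (Finsupp.single (γ, n) 1, 0)
    · rw [dif_pos hp]
      obtain ⟨γ, hγ⟩ := id hp
      have h1 : hp.choose = γ := by
        have h2 := congrArg Prod.fst (hγ.symm.trans hp.choose_spec)
        have h3 := (Finsupp.single_left_inj one_ne_zero).mp h2
        exact (congrArg Prod.fst h3).symm
      have h4 : (((mfact p.1 : ℝ) * mfact p.2)⁻¹ • S.linPart n (MvPolynomial.monomial
          (Finsupp.sumFinsuppEquivProdFinsupp.symm p) 1)) = S.zN γ := by
        rw [hγ, sumFinsupp_symm_single, linPart_single, mfact_single, mfact_zero]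
        simp
      rw [h4]
      change z hp.choose.1 = z γ.1
      rw [h1]
    · rw [dif_neg hp, linPart_eq_zero, smul_zero, map_zero, map_zero]
      intro γ hγ
      refine hp ⟨γ, Finsupp.sumFinsuppEquivProdFinsupp.symm.injective ?_⟩
      rw [hγ, sumFinsupp_symm_single]
  exact LinearMap.congr_fun h V

open Classical in
theorem eps_D (b : Module.Basis S.Idx ℝ S.U) (hb : ∀ p, b p = S.D p) (m : NIdx d) (p : S.Idx) :
    S.eps b m (S.D p) = if p = (0, m) then 1 else 0 := by
  rw [← hb, eps, b.constr_basis]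

theorem finite_eps (b : Module.Basis S.Idx ℝ S.U) (hb : ∀ p, b p = S.D p) (V : S.U) :
    {m | S.eps b m V ≠ 0}.Finite := by
  classical
  have hV : V ∈ Submodule.span ℝ (Set.range S.D) := by rw [span_range_D]; trivial
  induction hV using Submodule.span_induction with
  | mem V h =>
    obtain ⟨p, rfl⟩ := h
    refine (Set.finite_singleton p.2).subset fun m hm => ?_
    rw [Set.mem_ofPred_eq, eps_D S b hb] at hm
    by_cases hp : p = (0, m)
    · rw [hp]; rfl
    · exact absurd (if_neg hp) hm
  | zero => simp
  | add V W _ _ h h' =>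
    refine (h.union h').subset fun m hm => ?_
    by_contra hn
    simp only [Set.mem_union, Set.mem_ofPred_eq, not_or, not_not] at hn
    exact hm (by rw [map_add, hn.1, hn.2, add_zero])
  | smul c V _ h =>
    refine h.subset fun m hm => ?_
    rw [Set.mem_ofPred_eq, map_smul] at hm
    exact right_ne_zero_of_mul hm

theorem polyX_symbol_D_of_ne_zero {J : S.M →₀ ℕ} (hJ : J ≠ 0) (m : NIdx d) :
    S.polyX (S.symbol (S.D (J, m))) = 0 := by
  obtain ⟨x, hx⟩ := Finsupp.ne_iff.mp hJ
  have e : J = J - Finsupp.single x 1 + Finsupp.single x 1 :=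
    (tsub_add_cancel_of_le (single_one_le_iff.mpr hx)).symm
  rw [e, D_add_single, map_smul, map_smul, sandwich_apply, symbol_sandwichHom, map_mul, polyX_Zlin,
    zero_mul, smul_zero]

theorem iota_mul (b : Module.Basis S.Idx ℝ S.U) (hb : ∀ p, b p = S.D p) (n : NIdx d)
    (V W : S.U) :
    (S.iota b n (V * W) : PS d ℒ) = S.rho V (S.iota b n W : PS d ℒ) +
      ∑ᶠ m, ((mchoose (n + m) m : ℝ) * S.eps b m W) • (S.iota b (n + m) V : PS d ℒ) := by
  classical
  have hfin : ∀ W, (Function.support fun m =>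
      ((mchoose (n + m) m : ℝ) * S.eps b m W) • (S.iota b (n + m) V : PS d ℒ)).Finite := fun W =>
    (S.finite_eps b hb W).subset fun m hm hn => hm (by simp [hn])
  have hW : W ∈ Submodule.span ℝ (Set.range S.D) := by rw [span_range_D]; trivial
  induction hW using Submodule.span_induction with
  | mem W h =>
    obtain ⟨⟨J, m⟩, rfl⟩ := h
    -- For `J = 0` the term with `ρ` vanishes and a single `m` contributes to the sum; for `J ≠ 0`
    -- the whole sum vanishes and the symbol of the right factor lies in the kernel of `polyX`.
    by_cases hJ : J = 0
    · subst hJ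
      have h1 : S.iota b n (S.D (0, m)) = 0 := by
        rw [← hb, iota, b.constr_basis, dif_neg]
        rintro ⟨γ, hγ⟩
        have h2 := DFunLike.congr_fun (congrArg Prod.fst hγ) (γ, n)
        simp at h2
      have h3 := finsum_eq_single (fun m' => ((mchoose (n + m') m' : ℝ) *
        S.eps b m' (S.D (0, m))) • (S.iota b (n + m') V : PS d ℒ)) m fun m' hm' => by
          rw [eps_D S b hb, if_neg (by simpa using hm'.symm), mul_zero, zero_smul]
      rw [h3, h1, eps_D S b hb, if_pos rfl, mul_one, coe_iota S b hb, linPart_symbol_mul_D_zero,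
        coe_iota S b hb, Submodule.coe_zero, map_zero, zero_add]
      rfl
    · have h3 : ∀ m', ((mchoose (n + m') m' : ℝ) * S.eps b m' (S.D (J, m))) •
          (S.iota b (n + m') V : PS d ℒ) = 0 := fun m' => by
        rw [eps_D S b hb, if_neg fun h => hJ (congrArg Prod.fst h), mul_zero, zero_smul]
      rw [finsum_eq_zero_of_forall_eq_zero h3, add_zero, coe_iota S b hb, coe_iota S b hb,
        symbol_mul, coe_linPart_polyRepU S n V (S.polyX_symbol_D_of_ne_zero hJ m)]
  | zero => simp
  | add W W' _ _ h h' =>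
    have e := finsum_add_distrib (hfin W) (hfin W')
    simp only [mul_add, map_add, add_smul, Submodule.coe_add]
    rw [h, h', e]
    abel
  | smul c W _ h =>
    have e := smul_finsum' c (hfin W)
    simp only [mul_smul_comm, map_smul, Submodule.coe_smul, smul_eq_mul]
    rw [h, smul_add, e]
    congr 1
    refine finsum_congr fun m => ?_
    rw [smul_smul]
    congr 1
    ring

/-! ### Homogeneities. -/

theorem homog_add (β γ : MIdx d ℒ) : S.homog (β + γ) = S.homog β + S.homog γ := by
  classical
  refine Finsupp.sum_add_index' ?_ ?_
  · rintro (⟨l, k⟩ | n) <;> simp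
  · rintro (⟨l, k⟩ | n) a b
    · push_cast; ring
    · push_cast; ring

theorem homog_inr (n : NIdx d) :
    S.homog (Finsupp.single (.inr n) 1 : MIdx d ℒ) = S.sdeg n - S.eta := by
  simp [homog]

theorem homog_inl_add_single (l : Option ℒ) (k : NIdx d →₀ ℕ) (n : NIdx d) :
    S.homog (Finsupp.single (.inl (l, k + Finsupp.single n 1)) 1 : MIdx d ℒ) =
      S.homog (Finsupp.single (.inl (l, k)) 1 : MIdx d ℒ) + (S.eta - S.sdeg n) := by
  classical
  have e : (k + Finsupp.single n 1).sum (fun n a => (S.eta - S.sdeg n) * (a : ℝ)) =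
      k.sum (fun n a => (S.eta - S.sdeg n) * (a : ℝ)) + (S.eta - S.sdeg n) := by
    rw [Finsupp.sum_add_index' (by simp) (by intro n a b; push_cast; ring)]
    simp
  simp only [homog, Finsupp.sum_single_index, Nat.cast_zero, mul_zero, Nat.cast_one, mul_one, e]
  ring

theorem StepD.homog_eq {n : NIdx d} {γ β : MIdx d ℒ} (h : S.StepD n γ β) :
    S.homog β = S.homog γ + (S.eta - S.sdeg n) := by
  rcases h with ⟨l, k, -, δ, rfl, rfl⟩ | rfl
  · rw [homog_add, homog_add, homog_inl_add_single, add_assoc]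
  · rw [homog_add, homog_inr]
    ring

/-- A step of `D^{(n)}` adds `η - |n|`. The prefactor `z^{γ'}` adds `|γ'|`, while the prefactor
`z_{n+e_i}` adds `|n+e_i| - η`, so that in `∂_i` the dependence on `n` cancels. -/
theorem homog_of_coeff_genEnd {x : S.M ⊕ Fin d} {γ : S.setN} {β : MIdx d ℒ}
    (h : MvPowerSeries.coeff β (S.genEnd x (z γ.1)) ≠ 0) :
    S.homog β = S.homog γ.1 + S.genHomog x := by
  rw [genEnd_z] at h
  rcases x with ⟨γ', n⟩ | i
  · obtain ⟨δ, rfl, hδ⟩ := exists_add_of_coeff_z_mul h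
    obtain ⟨ε, hε, hs⟩ := S.exists_stepD_of_coeff_derivD₀ hδ
    rw [homog_add, hs.homog_eq, coeff_z_ne hε, genHomog]
    ring
  · change MvPowerSeries.coeff β (S.derivX₀ i _) ≠ 0 at h
    rw [derivX₀, coeff_locSum] at h
    obtain ⟨n, hn⟩ := exists_ne_of_fs h
    simp only [LinearMap.smul_apply, LinearMap.comp_apply, map_smul, smul_eq_mul] at hn
    obtain ⟨δ, rfl, hδ⟩ := exists_add_of_coeff_z_mul (right_ne_zero_of_mul hn)
    obtain ⟨ε, hε, hs⟩ := S.exists_stepD_of_coeff_derivD₀ hδ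
    rw [homog_add, hs.homog_eq, coeff_z_ne hε, genHomog, homog_inr, sdeg_add]
    ring

/-- The homogeneous subspaces of `polyN`. -/
noncomputable def polyNgr (ν : ℝ) : Submodule ℝ S.polyN :=
  Submodule.span ℝ {π | ∃ γ : S.setN, S.homog γ.1 = ν ∧ π = S.zN γ}

theorem zBasis_repr (π : S.polyN) (γ : S.setN) :
    S.zBasis.repr π γ = MvPowerSeries.coeff γ.1 (π : PS d ℒ) := by
  classical
  have h : S.zBasis.coord γ = MvPowerSeries.coeff γ.1 ∘ₗ S.polyN.subtype := by
    refine S.zBasis.ext fun γ' => ?_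
    rw [Module.Basis.coord_apply, Module.Basis.repr_self, zBasis_apply]
    change _ = MvPowerSeries.coeff γ.1 (z γ'.1)
    rw [coeff_z, Finsupp.single_apply]
    exact if_congr (by rw [Subtype.ext_iff]; exact eq_comm) rfl rfl
  exact LinearMap.congr_fun h π

theorem mem_polyNgr {ν : ℝ} {π : S.polyN}
    (h : ∀ β, MvPowerSeries.coeff β (π : PS d ℒ) ≠ 0 → S.homog β = ν) : π ∈ S.polyNgr ν := by
  rw [← S.zBasis.linearCombination_repr π, Finsupp.linearCombination_apply]
  refine Submodule.sum_mem _ fun γ hγ => Submodule.smul_mem _ _ (Submodule.subset_span ⟨γ, ?_, ?_⟩)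
  · refine h _ ?_
    rw [← zBasis_repr]
    simpa using hγ
  · exact S.zBasis_apply γ

theorem actN_mem_polyNgr {κ ν : ℝ} {D : S.L} (hD : D ∈ S.Lgr κ) {π : S.polyN}
    (hπ : π ∈ S.polyNgr ν) : S.actN D π ∈ S.polyNgr (ν + κ) := by
  induction hπ using Submodule.span_induction with
  | mem π h =>
    obtain ⟨γ, rfl, rfl⟩ := h
    induction hD using Submodule.span_induction with
    | mem D h =>
      obtain ⟨x, rfl, rfl⟩ := h
      exact S.mem_polyNgr fun β hβ => S.homog_of_coeff_genEnd hβ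
    | zero => exact Submodule.zero_mem _
    | add D D' _ _ h h' => rw [actN_add]; exact Submodule.add_mem _ h h'
    | smul c D _ h => rw [actN_smul]; exact Submodule.smul_mem _ c h
  | zero => rw [map_zero]; exact Submodule.zero_mem _
  | add π π' _ _ h h' => rw [map_add]; exact Submodule.add_mem _ h h'
  | smul c π _ h => rw [map_smul]; exact Submodule.smul_mem _ c h

theorem mulD_mem_Lgr (n : NIdx d) {ν : ℝ} {π : S.polyN} (hπ : π ∈ S.polyNgr ν) :
    S.mulD n π ∈ S.Lgr (ν + S.eta - S.sdeg n) := by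
  induction hπ using Submodule.span_induction with
  | mem π h =>
    obtain ⟨γ, rfl, rfl⟩ := h
    exact Submodule.subset_span ⟨.inl (γ, n), rfl, rfl⟩
  | zero => rw [map_zero]; exact Submodule.zero_mem _
  | add π π' _ _ h h' => rw [map_add]; exact Submodule.add_mem _ h h'
  | smul c π _ h => rw [map_smul]; exact Submodule.smul_mem _ c h

theorem one_mem_Ugr : (1 : S.U) ∈ S.Ugr 0 :=
  Submodule.subset_span ⟨[], by simp, by simp, by simp⟩

theorem ιU_mul_mem_Ugr {κ ν : ℝ} {D : S.L} (hD : D ∈ S.Lgr κ) {V : S.U} (hV : V ∈ S.Ugr ν) :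
    S.ιU D * V ∈ S.Ugr (κ + ν) := by
  induction hV using Submodule.span_induction with
  | mem V h =>
    obtain ⟨l, hl, rfl, rfl⟩ := h
    refine Submodule.subset_span ⟨(κ, D) :: l, ?_, by simp, by simp⟩
    intro q hq
    rcases List.mem_cons.mp hq with rfl | hq
    · exact hD
    · exact hl q hq
  | zero => rw [mul_zero]; exact Submodule.zero_mem _
  | add V W _ _ h h' => rw [mul_add]; exact Submodule.add_mem _ h h'
  | smul c V _ h => rw [mul_smul_comm]; exact Submodule.smul_mem _ c h

/-- Along a word, each letter either stays as a left factor or is absorbed into `π`; both add its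
homogeneity to the total. The induction therefore runs over all `π` and `μ`. -/
theorem sandwichHom_mem_Ugr (n : NIdx d) {ν μ : ℝ} {V : S.U} (hV : V ∈ S.Ugr ν) {π : S.polyN}
    (hπ : π ∈ S.polyNgr μ) :
    S.sandwichHom n V π ∈ S.Ugr (μ + S.eta - S.sdeg n + ν) := by
  induction hV using Submodule.span_induction with
  | mem V h =>
    obtain ⟨l, hl, rfl, rfl⟩ := h
    induction l generalizing π μ with
    | nil =>
      rw [List.map_nil, List.map_nil, List.prod_nil, List.sum_nil, sandwichHom_one, ← mul_one (S.ιU _)]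
      exact S.ιU_mul_mem_Ugr (S.mulD_mem_Lgr n hπ) S.one_mem_Ugr
    | cons q l ih =>
      have hl' : ∀ q ∈ l, q.2 ∈ S.Lgr q.1 := fun q' hq' => hl q' (List.mem_cons_of_mem _ hq')
      have hq := hl q List.mem_cons_self
      rw [List.map_cons, List.map_cons, List.prod_cons, List.sum_cons, sandwichHom_mul]
      refine Submodule.sub_mem _ ?_ ?_
      · have h := S.ιU_mul_mem_Ugr hq (ih hπ hl')
        rwa [add_left_comm] at h
      · have h := ih (S.actN_mem_polyNgr hq hπ) hl'
        convert h using 2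
        ring
  | zero => rw [map_zero]; exact Submodule.zero_mem _
  | add V W _ _ h h' => rw [map_add, LinearMap.add_apply]; exact Submodule.add_mem _ h h'
  | smul c V _ h => rw [map_smul, LinearMap.smul_apply]; exact Submodule.smul_mem _ c h

theorem D_mem_Ugr (p : S.Idx) : S.D p ∈ S.Ugr (S.idxHomog p) := by
  classical
  obtain ⟨J, m⟩ := p
  induction J using finsupp_nat_induction with
  | zero =>
    induction m using finsupp_nat_induction with
    | zero =>
      rw [D_zero, powX_zero]
      refine Submodule.smul_mem _ _ ?_
      have e : S.idxHomog (0, 0) = 0 := by simp [idxHomog]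
      rw [e]
      exact S.one_mem_Ugr
    | add_single m i h =>
      rw [D_zero_add_single]
      refine Submodule.smul_mem _ _ ?_
      have e : S.idxHomog (0, m + Finsupp.single i 1) =
          S.genHomog (.inr i) + S.idxHomog (0, m) := by
        simp [idxHomog, add_mul, Finset.sum_add_distrib, Finsupp.single_apply, add_comm]
      rw [e]
      exact S.ιU_mul_mem_Ugr (Submodule.subset_span ⟨_, rfl, rfl⟩) h
  | add_single J x h =>
    rw [D_add_single]
    refine Submodule.smul_mem _ _ ?_
    have e : S.idxHomog (J + Finsupp.single x 1, m) =
        S.genHomog (.inl x) + S.idxHomog (J, m) := by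
      simp only [idxHomog]
      rw [Finsupp.sum_add_index' (by simp) (by intro n a b; push_cast; ring)]
      simp
      ring
    rw [e]
    exact S.sandwichHom_mem_Ugr x.2 h (Submodule.subset_span ⟨x.1, rfl, rfl⟩)

end Setting

end MultiIndexSPDE

theorem mainTheorem3 {d : ℕ} {ℒ : Type*} [Finite ℒ] (S : MultiIndexSPDE.Setting d ℒ)
    [DecidableEq S.M] :
    -- the generators form a basis of `L`, with the Lie bracket given by the pre-Lie relations
    ((∃ g : Module.Basis (S.M ⊕ Fin d) ℝ S.L, ∀ x, g x = S.gen x) ∧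
      (∀ (γ γ' : S.setN) (n n' : MultiIndexSPDE.NIdx d),
        ⁅S.gen (.inl (γ', n')), S.gen (.inl (γ, n))⁆ =
          S.mulD n (S.actN (S.gen (.inl (γ', n'))) (S.zN γ)) -
            S.mulD n' (S.actN (S.gen (.inl (γ, n))) (S.zN γ'))) ∧
      (∀ (i : Fin d) (γ : S.setN) (n : MultiIndexSPDE.NIdx d),
        ⁅S.gen (.inr i), S.gen (.inl (γ, n))⁆ =
          S.mulD n (S.actN (S.gen (.inr i)) (S.zN γ)) -
            (n i : ℝ) • S.gen (.inl (γ, n - Finsupp.single i 1))) ∧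
      (∀ i j : Fin d, ⁅S.gen (.inr i), S.gen (.inr j)⁆ = 0)) ∧
    -- the factors in the definition of `D_{(J,m)}` may be taken in any order
    (∀ l l' : List S.M, l.Perm l' → ∀ V : S.U, S.sandwichList l V = S.sandwichList l' V) ∧
    -- the elements `D_{(J,m)}` form a basis of `U(L)`
    ∃ b : Module.Basis S.Idx ℝ S.U, (∀ p, b p = S.D p) ∧
      -- representation of the coproduct
      (∀ (J : S.M →₀ ℕ) (m : MultiIndexSPDE.NIdx d),
        S.coprod (S.D (J, m)) =
          ∑ p ∈ Finset.HasAntidiagonal.antidiagonal J, ∑ q ∈ Finset.HasAntidiagonal.antidiagonal m,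
            S.D (p.1, q.1) ⊗ₜ[ℝ] S.D (p.2, q.2)) ∧
      -- the coproduct is the transpose of the free commutative product
      (∀ (V : S.U) (M₁ M₂ : MvPolynomial (S.M ⊕ Fin d) ℝ),
        S.pairing b V (M₁ * M₂) = S.pairing₂ b M₁ M₂ (S.coprod V)) ∧
      -- rank one projection of the product; the sum over `m` is finite
      (∀ V : S.U, {m | S.eps b m V ≠ 0}.Finite) ∧
      (∀ (n : MultiIndexSPDE.NIdx d) (U₁ U₂ : S.U),
        (S.iota b n (U₁ * U₂) : MultiIndexSPDE.PS d ℒ) =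
          S.rho U₁ (S.iota b n U₂ : MultiIndexSPDE.PS d ℒ) +
            ∑ᶠ m, ((MultiIndexSPDE.mchoose (n + m) m : ℝ) * S.eps b m U₂) •
              (S.iota b (n + m) U₁ : MultiIndexSPDE.PS d ℒ)) ∧
      -- homogeneity
      (∀ p, S.D p ∈ S.Ugr (S.idxHomog p)) := by
  exact ⟨⟨⟨S.genBasis, S.genBasis_apply⟩, S.lie_inl_inl, S.lie_inr_inl, S.lie_inr_inr⟩,
    fun _ _ h V => S.sandwichList_perm h V, S.basisD, S.basisD_apply, S.coprod_D,
    S.pairing_mul S.basisD S.basisD_apply, S.finite_eps S.basisD S.basisD_apply,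
    S.iota_mul S.basisD S.basisD_apply, S.D_mem_Ugr⟩
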